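/- **Setting.** For $m,n\ge 0$ let $\mathrm{Cob}^m_n$ be Bar-Natan's graded category. Its objects are formal shifts $q^k a$ ($k\in\mathbb Z$) of properly embedded compact 1-submanifolds $a$ of the square with $m$ boundary points on the top edge and $n$ on the bottom edge. Its morphisms are $\mathbb Z[\alpha]$-linear combinations of dotted cobordisms in the square times $[0,1]$, up to isotopy rel boundary, modulo the local relations: a sphere with $0,1,2,3$ dots equals $0,1,0,\alpha$ respectively; a tube equals the sum of the two dotted cut tubes (two discs, with a dot on one or the other of them); a handle on a component equals $2$ times a dot on it. Composition is stacking. A dot has degree $2$, $\deg\alpha=4$, and a cobordism $S\colon q^k a\to q^l b$ with $d$ dots has degree $l-k-\chi(S)+\tfrac{m+n}{2}+2d$. Let $\mathrm{BN}^m_n$ be the additive category of finite formal direct sums of objects of $\mathrm{Cob}^m_n$ and matrices of morphisms of degree $0$. Write $\otimes$ for vertical composition of diagrams, extended to complexes, and let $1_n\in\mathrm{BN}^n_n$ be the diagram of $n$ vertical strands. Complexes are cohomological; differentials, chain maps and homotopies have quantum degree $0$. For $0\le i\le m-2$ let $a_i$ be the diagram with $i$ vertical strands, an arc joining the next two points,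 and $m-i-2$ vertical strands, placed on top of diagrams of $\mathrm{BN}^m_n$; for $0\le j\le n-2$ let $b_j$ be the analogous diagram with an arc joining the $(j+1)$-st and $(j+2)$-nd points, placed below. A complex $Q$ over $\mathrm{BN}^m_n$ *kills turnbacks* if $a_i\otimes Q\simeq 0$ for $0\le i\le m-2$ and $Q\otimes b_j\simeq 0$ for $0\le j\le n-2$. A *universal projector* on $n$ strands is a cochain complex $P$ over $\mathrm{BN}^n_n$, concentrated in non-positive homological degrees, that kills turnbacks, together with an identification $P^0\cong 1_n$, and such that for $i\neq 0$ no shift $q^r 1_n$ ($r\in\mathbb Z$) is a direct summand of $P^i$. Let $\iota_P\colon 1_n\to P$ be the chain map given by the inclusion of the degree-zero chain group. **Statement.** Let $n\ge 0$ and let $P$ and $Q$ be universal projectors on $n$ strands. Then there is a chain map $\psi\colon P\to Q$ with $\psi\circ\iota_P=\iota_Q$ such that 1. every chain map $\psi'\colon P\to Q$ with $\psi'\circ\iota_P=\iota_Q$ is chain homotopic to $\psi$; 2. $\psi$ is a homotopy equivalence; 3. every homotopy equivalence $\varphi\colon P\to Q$ is chain homotopic to $\psi$ or to $-\psi$. In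 particular, any two universal projectors are homotopy equivalent, by an equivalence that is unique up to homotopy and a scalar $\pm1$. -/

import Mathlib

open CategoryTheory CategoryTheory.Limits

namespace BarNatan

/-! ### Planar diagrams -/

/-- A properly embedded compact 1-manifold in the disc with `N` marked boundary points, up to
planar isotopy: the points are numbered in cyclic order along the boundary, `mate` sends each point
to the other end of its arc, arcs do not cross, and there are `circles` closed components.  (Where
the circles lie is not recorded: moving a circle through an arc gives an isomorphic object.) -/
@[ext]
structure Diagram (N : ℕ) where
  mate : Fin N → Fin N
  mate_mate : ∀ p, mate (mate p) = p
  mate_ne : ∀ p, mate p ≠ p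
  noncrossing : ∀ p q, p < q → q < mate p → p < mate q ∧ mate q < mate p
  circles : ℕ

/-- A choice of two cyclically adjacent boundary points `pos`, `pos + 1` among `N`, leaving `M`
boundary points. -/
structure Slot (N M : ℕ) where
  size : M + 2 = N
  pos : ℕ
  pos_le : pos ≤ M

namespace Slot

variable {N M : ℕ} (s : Slot N M)

def left : Fin N := ⟨s.pos, by have := s.size; have := s.pos_le; omega⟩

def right : Fin N := ⟨s.pos + 1, by have := s.size; have := s.pos_le; omega⟩

/-- The order preserving numbering of the remaining `M` points. -/
def skip (j : Fin M) : Fin N :=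
  ⟨if j.1 < s.pos then j.1 else j.1 + 2, by have := s.size; have := j.2; split <;> omega⟩

def unskip (x : Fin N) (hl : x ≠ s.left) (hr : x ≠ s.right) : Fin M :=
  ⟨if x.1 < s.pos then x.1 else x.1 - 2, by
    have h1 : x.1 ≠ s.pos := fun h => hl (Fin.ext h)
    have h2 : x.1 ≠ s.pos + 1 := fun h => hr (Fin.ext h)
    have := s.size; have := s.pos_le; have := x.2
    split <;> omega⟩

theorem left_ne_right : s.left ≠ s.right := by
  simp [left, right, Fin.ext_iff]

theorem skip_ne_left (j : Fin M) : s.skip j ≠ s.left := by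
  simp only [skip, left, ne_eq, Fin.ext_iff]; split <;> omega

theorem skip_ne_right (j : Fin M) : s.skip j ≠ s.right := by
  simp only [skip, right, ne_eq, Fin.ext_iff]; split <;> omega

theorem skip_unskip (x : Fin N) (hl : x ≠ s.left) (hr : x ≠ s.right) :
    s.skip (s.unskip x hl hr) = x := by
  have h1 : x.1 ≠ s.pos := fun h => hl (Fin.ext h)
  have h2 : x.1 ≠ s.pos + 1 := fun h => hr (Fin.ext h)
  simp only [skip, unskip, Fin.ext_iff]
  split_ifs <;> omega

theorem skip_lt_skip {i j : Fin M} : s.skip i < s.skip j ↔ i < j := by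
  simp only [skip, Fin.lt_def]; split <;> split <;> omega

theorem skip_injective : Function.Injective s.skip := by
  intro i j h
  simp only [skip, Fin.ext_iff] at h ⊢
  split at h <;> split at h <;> omega

/-- The other end of the arc starting at `x`, after the ends `left` and `right` have been joined. -/
def joinMate (a : Diagram N) (x : Fin N) : Fin N :=
  if a.mate x = s.left then a.mate s.right
  else if a.mate x = s.right then a.mate s.left
  else a.mate x

variable {s} in
theorem joinMate_ne_left {a : Diagram N} {x : Fin N} (hr : x ≠ s.right) :
    s.joinMate a x ≠ s.left := by
  have := a.mate_mate; have := a.mate_ne; have := s.left_ne_right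
  unfold joinMate; grind

variable {s} in
theorem joinMate_ne_right {a : Diagram N} {x : Fin N} (hl : x ≠ s.left) :
    s.joinMate a x ≠ s.right := by
  have := a.mate_mate; have := a.mate_ne; have := s.left_ne_right
  unfold joinMate; grind

variable {s} in
theorem joinMate_joinMate {a : Diagram N} {x : Fin N} (hl : x ≠ s.left) (hr : x ≠ s.right) :
    s.joinMate a (s.joinMate a x) = x := by
  have := a.mate_mate; have := a.mate_ne; have := s.left_ne_right
  unfold joinMate; grind

variable {s} in
theorem joinMate_ne {a : Diagram N} {x : Fin N} :
    s.joinMate a x ≠ x := by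
  have := a.mate_mate; have := a.mate_ne; have := s.left_ne_right
  unfold joinMate; grind

variable {s} in
theorem joinMate_noncrossing {a : Diagram N} {x y : Fin N} (hxl : x ≠ s.left) (hxr : x ≠ s.right)
    (hyl : y ≠ s.left) (hyr : y ≠ s.right) (h1 : x < y) (h2 : y < s.joinMate a x) :
    x < s.joinMate a y ∧ s.joinMate a y < s.joinMate a x := by
  unfold joinMate at *
  have adj : ∀ z : Fin N, z ≠ s.left → z ≠ s.right → (z < s.left ↔ z < s.right) := by
    intro z h h'
    simp only [left, right, ne_eq, Fin.ext_iff, Fin.lt_def] at *; omega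
  have hlr : s.left < s.right := by simp [left, right, Fin.lt_def]
  have mm := a.mate_mate
  have ne := a.mate_ne
  have nc := a.noncrossing
  generalize s.left = l at *
  generalize s.right = r at *
  by_cases c1 : a.mate x = l
  · grind
  · by_cases c2 : a.mate x = r
    · grind
    · grind

end Slot

/-- The diagram obtained from `a` by joining two adjacent boundary points by an arc. -/
def Diagram.cap {N M : ℕ} (s : Slot N M) (a : Diagram N) : Diagram M where
  mate j := s.unskip (s.joinMate a (s.skip j))
    (Slot.joinMate_ne_left (s.skip_ne_right j)) (Slot.joinMate_ne_right (s.skip_ne_left j))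
  mate_mate j := by
    apply s.skip_injective
    simp only [s.skip_unskip]
    exact Slot.joinMate_joinMate (s.skip_ne_left j) (s.skip_ne_right j)
  mate_ne j h := by
    have := congrArg s.skip h
    rw [s.skip_unskip] at this
    exact Slot.joinMate_ne this
  noncrossing i j h1 h2 := by
    rw [← s.skip_lt_skip] at h1 h2
    rw [s.skip_unskip] at h2
    rw [← s.skip_lt_skip, ← s.skip_lt_skip]
    simp only [s.skip_unskip]
    exact Slot.joinMate_noncrossing (s.skip_ne_left i) (s.skip_ne_right i)
      (s.skip_ne_left j) (s.skip_ne_right j) h1 h2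
  circles := a.circles + if a.mate s.left = s.right then 1 else 0

theorem Diagram.skip_cap_mate {N M : ℕ} (s : Slot N M) (a : Diagram N) (j : Fin M) :
    s.skip ((a.cap s).mate j) = s.joinMate a (s.skip j) := by
  simp only [Diagram.cap, s.skip_unskip]

/-- `n` parallel vertical strands joining `n` top points to `n` bottom points.  The top points are
numbered from left to right, then the bottom points from right to left. -/
def Diagram.identity (n : ℕ) : Diagram (n + n) where
  mate p := p.rev
  mate_mate p := by simp
  mate_ne p h := by simp [Fin.ext_iff, Fin.val_rev] at h; omega
  noncrossing p q h1 h2 := by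
    simp only [Fin.lt_def, Fin.val_rev] at *; omega
  circles := 0

/-- Two points are related if the second is the other end of the arc starting at the first. -/
def Diagram.ArcRel {N : ℕ} (a : Diagram N) (p q : Fin N) : Prop := q = a.mate p

/-- The components of a diagram: its arcs and its circles. -/
abbrev Diagram.Component {N : ℕ} (a : Diagram N) : Type := Quot a.ArcRel ⊕ Fin a.circles

/-! ### Dotted cobordisms -/

/-- Combinatorial data of a dotted surface in `D² × [0,1]` from `a × {0}` to `b × {1}`, with
vertical boundary over the marked points of the disc, multiplied by a power of `α`. -/
structure Surface {N : ℕ} (a b : Diagram N) where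
  /-- the set of connected components -/
  Comp : Type
  finite_comp : Finite Comp
  /-- the component that contains the vertical segment over a marked point -/
  pt : Fin N → Comp
  pt_source : ∀ p, pt (a.mate p) = pt p
  pt_target : ∀ p, pt (b.mate p) = pt p
  /-- the component bounded by a circle of `a` -/
  source : Fin a.circles → Comp
  /-- the component bounded by a circle of `b` -/
  target : Fin b.circles → Comp
  /-- the relative Euler characteristic `χ(K, K ∩ a) = χ(K) - χ(K ∩ a)` of a component `K` -/
  euler : Comp →₀ ℤ
  /-- the number of dots on a component -/
  dots : Comp →₀ ℕ
  /-- the exponent of `α` -/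
  alpha : ℕ

namespace Surface

variable {N M : ℕ} {a b c d : Diagram N}

/-- Equality of surfaces up to a homeomorphism relative to the boundary. -/
def Homeo (S T : Surface a b) : Prop :=
  ∃ e : S.Comp ≃ T.Comp,
    (∀ p, e (S.pt p) = T.pt p) ∧ (∀ i, e (S.source i) = T.source i) ∧
    (∀ i, e (S.target i) = T.target i) ∧ S.euler.mapDomain e = T.euler ∧
    S.dots.mapDomain e = T.dots ∧ S.alpha = T.alpha

/-- The quantum degree, up to the shifts of the source and the target:
`-χ(S) + N / 2`, plus `2` for each dot and `4` for each `α`. -/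
noncomputable def degree (S : Surface a b) : ℤ :=
  4 * S.alpha + 2 * S.dots.degree - S.euler.degree

theorem Homeo.refl (S : Surface a b) : S.Homeo S :=
  ⟨Equiv.refl _, by simp⟩

theorem Homeo.symm {S T : Surface a b} (h : S.Homeo T) : T.Homeo S := by
  obtain ⟨e, h1, h2, h3, h4, h5, h6⟩ := h
  refine ⟨e.symm, fun p => by simp [← h1], fun p => by simp [← h2], fun p => by simp [← h3],
    ?_, ?_, h6.symm⟩
  · rw [← h4, ← Finsupp.mapDomain_comp]; simp
  · rw [← h5, ← Finsupp.mapDomain_comp]; simp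

theorem Homeo.trans {S T U : Surface a b} (h : S.Homeo T) (h' : T.Homeo U) : S.Homeo U := by
  obtain ⟨e, h1, h2, h3, h4, h5, h6⟩ := h
  obtain ⟨f, g1, g2, g3, g4, g5, g6⟩ := h'
  refine ⟨e.trans f, fun p => by simp [h1, g1], fun p => by simp [h2, g2],
    fun p => by simp [h3, g3], ?_, ?_, h6.trans g6⟩
  · rw [← g4, ← h4, ← Finsupp.mapDomain_comp]; rfl
  · rw [← g5, ← h5, ← Finsupp.mapDomain_comp]; rfl

/-- A homeomorphism from mutually inverse maps of components. -/
theorem Homeo.of_maps {S T : Surface a b} (f : S.Comp → T.Comp) (g : T.Comp → S.Comp)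
    (hgf : ∀ x, g (f x) = x) (hfg : ∀ y, f (g y) = y)
    (h1 : ∀ p, f (S.pt p) = T.pt p) (h2 : ∀ i, f (S.source i) = T.source i)
    (h3 : ∀ i, f (S.target i) = T.target i) (h4 : S.euler.mapDomain f = T.euler)
    (h5 : S.dots.mapDomain f = T.dots) (h6 : S.alpha = T.alpha) : S.Homeo T :=
  ⟨⟨f, g, hgf, hfg⟩, h1, h2, h3, h4, h5, h6⟩

/-- The cylinder `a × [0,1]`: one component for each component of `a`. -/
noncomputable def cylinder (a : Diagram N) : Surface a a where
  Comp := a.Component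
  finite_comp := inferInstance
  pt p := Sum.inl (Quot.mk _ p)
  pt_source _ := congrArg Sum.inl (Quot.sound (r := a.ArcRel) rfl).symm
  pt_target _ := congrArg Sum.inl (Quot.sound (r := a.ArcRel) rfl).symm
  source := Sum.inr
  target := Sum.inr
  euler := 0
  dots := 0
  alpha := 0

/-- Components of two stacked surfaces that meet along a component of the diagram in the middle. -/
inductive Meets (S : Surface a b) (T : Surface b c) : S.Comp ⊕ T.Comp → S.Comp ⊕ T.Comp → Prop
  | pt (p : Fin N) : Meets S T (Sum.inl (S.pt p)) (Sum.inr (T.pt p))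
  | circle (i : Fin b.circles) : Meets S T (Sum.inl (S.target i)) (Sum.inr (T.source i))

/-- Stacking.  The relative Euler characteristic is additive. -/
noncomputable def comp (S : Surface a b) (T : Surface b c) : Surface a c where
  Comp := Quot (Meets S T)
  finite_comp := by
    have := S.finite_comp; have := T.finite_comp
    infer_instance
  pt p := Quot.mk _ (Sum.inl (S.pt p))
  pt_source p := by rw [S.pt_source]
  pt_target p := by
    rw [Quot.sound (Meets.pt (S := S) (T := T) p), ← T.pt_target p]
    exact Quot.sound (Meets.pt _)
  source i := Quot.mk _ (Sum.inl (S.source i))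
  target i := Quot.mk _ (Sum.inr (T.target i))
  euler := S.euler.mapDomain (fun x => Quot.mk _ (Sum.inl x)) +
    T.euler.mapDomain (fun x => Quot.mk _ (Sum.inr x))
  dots := S.dots.mapDomain (fun x => Quot.mk _ (Sum.inl x)) +
    T.dots.mapDomain (fun x => Quot.mk _ (Sum.inr x))
  alpha := S.alpha + T.alpha

theorem comp_pt (S : Surface a b) (T : Surface b c) (p : Fin N) :
    (S.comp T).pt p = Quot.mk _ (Sum.inr (T.pt p)) :=
  Quot.sound (Meets.pt p)

theorem comp_congr {S S' : Surface a b} {T T' : Surface b c} (hS : S.Homeo S') (hT : T.Homeo T') :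
    (S.comp T).Homeo (S'.comp T') := by
  obtain ⟨e, h1, h2, h3, h4, h5, h6⟩ := hS
  obtain ⟨f, g1, g2, g3, g4, g5, g6⟩ := hT
  refine Homeo.of_maps
    (Quot.map (Sum.map e f) ?_) (Quot.map (Sum.map e.symm f.symm) ?_) ?_ ?_ ?_ ?_ ?_ ?_ ?_ ?_
  · rintro _ _ (p | i)
    · simpa [h1, g1] using Meets.pt p
    · simpa [h3, g2] using Meets.circle i
  · rintro _ _ (p | i)
    · simpa [← h1, ← g1] using Meets.pt p
    · simpa [← h3, ← g2] using Meets.circle i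
  · rintro ⟨x | x⟩ <;> simp [Quot.map] <;> rfl
  · rintro ⟨x | x⟩ <;> simp [Quot.map] <;> rfl
  · intro p; simp [comp, Quot.map, h1]
  · intro p; simp [comp, Quot.map, h2]
  · intro p; simp [comp, Quot.map, g3]
  · simp only [comp, Finsupp.mapDomain_add, ← h4, ← g4, ← Finsupp.mapDomain_comp]; rfl
  · simp only [comp, Finsupp.mapDomain_add, ← h5, ← g5, ← Finsupp.mapDomain_comp]; rfl
  · simp [comp, h6, g6]

theorem cylinder_comp (S : Surface a b) : ((cylinder a).comp S).Homeo S := by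
  refine Homeo.of_maps
    (Quot.lift (Sum.elim (Sum.elim (Quot.lift (r := a.ArcRel) S.pt ?_) S.source) id) ?_)
    (fun x => Quot.mk _ (Sum.inr x)) ?_ ?_ ?_ ?_ ?_ ?_ ?_ ?_
  · rintro p _ rfl; exact (S.pt_source p).symm
  · rintro _ _ (p | i) <;> rfl
  · rintro ⟨(p | i) | x⟩
    · obtain ⟨p⟩ := p
      exact (Quot.sound (Meets.pt (S := cylinder a) (T := S) p)).symm
    · exact (Quot.sound (Meets.circle (S := cylinder a) (T := S) i)).symm
    · rfl
  · intro y; rfl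
  · intro p; rfl
  · intro p; rfl
  · intro p; rfl
  · simp only [comp, cylinder, ← Finsupp.mapDomain_comp,
      Finsupp.mapDomain_zero, zero_add]
    exact Finsupp.mapDomain_id
  · simp only [comp, cylinder, ← Finsupp.mapDomain_comp,
      Finsupp.mapDomain_zero, zero_add]
    exact Finsupp.mapDomain_id
  · simp [comp, cylinder]

theorem comp_cylinder (S : Surface a b) : (S.comp (cylinder b)).Homeo S := by
  refine Homeo.of_maps
    (Quot.lift (Sum.elim id (Sum.elim (Quot.lift (r := b.ArcRel) S.pt ?_) S.target)) ?_)
    (fun x => Quot.mk _ (Sum.inl x)) ?_ ?_ ?_ ?_ ?_ ?_ ?_ ?_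
  · rintro p _ rfl; exact (S.pt_target p).symm
  · rintro _ _ (p | i) <;> rfl
  · rintro ⟨x | (p | i)⟩
    · rfl
    · obtain ⟨p⟩ := p
      exact Quot.sound (Meets.pt (S := S) (T := cylinder b) p)
    · exact Quot.sound (Meets.circle (S := S) (T := cylinder b) i)
  · intro y; rfl
  · intro p; rfl
  · intro p; rfl
  · intro p; rfl
  · simp only [comp, cylinder, ← Finsupp.mapDomain_comp,
      Finsupp.mapDomain_zero, add_zero]
    exact Finsupp.mapDomain_id
  · simp only [comp, cylinder, ← Finsupp.mapDomain_comp,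
      Finsupp.mapDomain_zero, add_zero]
    exact Finsupp.mapDomain_id
  · simp [comp, cylinder]

theorem comp_assoc (S : Surface a b) (T : Surface b c) (U : Surface c d) :
    ((S.comp T).comp U).Homeo (S.comp (T.comp U)) := by
  refine Homeo.of_maps
    (Quot.lift (Sum.elim
      (Quot.lift (Sum.elim (fun x => Quot.mk _ (Sum.inl x))
        (fun y => Quot.mk _ (Sum.inr (Quot.mk _ (Sum.inl y))))) ?_)
      (fun z => Quot.mk _ (Sum.inr (Quot.mk _ (Sum.inr z))))) ?_)
    (Quot.lift (Sum.elim (fun x => Quot.mk _ (Sum.inl (Quot.mk _ (Sum.inl x))))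
      (Quot.lift (Sum.elim (fun y => Quot.mk _ (Sum.inl (Quot.mk _ (Sum.inr y))))
        (fun z => Quot.mk _ (Sum.inr z))) ?_)) ?_)
    ?_ ?_ ?_ ?_ ?_ ?_ ?_ ?_
  · rintro _ _ (p | i)
    · exact Quot.sound (Meets.pt (S := S) (T := T.comp U) p)
    · exact Quot.sound (Meets.circle (S := S) (T := T.comp U) i)
  · rintro _ _ (p | i)
    · exact (Quot.sound (Meets.pt (S := S) (T := T.comp U) p)).trans
        (congrArg (fun x => Quot.mk _ (Sum.inr x)) (Quot.sound (Meets.pt (S := T) (T := U) p)))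
    · exact congrArg (fun x => Quot.mk _ (Sum.inr x))
        (Quot.sound (Meets.circle (S := T) (T := U) i))
  · rintro _ _ (p | i)
    · exact (congrArg (fun x => Quot.mk _ (Sum.inl x))
        (Quot.sound (Meets.pt (S := S) (T := T) p)).symm).trans
        (Quot.sound (Meets.pt (S := S.comp T) (T := U) p))
    · exact Quot.sound (Meets.circle (S := S.comp T) (T := U) i)
  · rintro _ _ (p | i)
    · exact congrArg (fun x => Quot.mk _ (Sum.inl x)) (Quot.sound (Meets.pt (S := S) (T := T) p))
    · exact congrArg (fun x => Quot.mk _ (Sum.inl x))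
        (Quot.sound (Meets.circle (S := S) (T := T) i))
  · rintro ⟨x | x⟩
    · obtain ⟨x | x⟩ := x <;> rfl
    · rfl
  · rintro ⟨x | x⟩
    · rfl
    · obtain ⟨x | x⟩ := x <;> rfl
  · intro p; rfl
  · intro p; rfl
  · intro p; rfl
  · simp only [comp, Finsupp.mapDomain_add, ← Finsupp.mapDomain_comp, add_assoc]; rfl
  · simp only [comp, Finsupp.mapDomain_add, ← Finsupp.mapDomain_comp, add_assoc]; rfl
  · simp [comp, add_assoc]

theorem degree_cylinder (a : Diagram N) : (cylinder a).degree = 0 := by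
  have h1 : (cylinder a).dots.degree = 0 := map_zero Finsupp.degree
  have h2 : (cylinder a).euler.degree = 0 := map_zero Finsupp.degree
  have h3 : (cylinder a).alpha = 0 := rfl
  simp only [degree, h1, h2, h3]; simp

theorem degree_comp (S : Surface a b) (T : Surface b c) :
    (S.comp T).degree = S.degree + T.degree := by
  have h1 : (S.comp T).dots.degree = S.dots.degree + T.dots.degree :=
    (map_add Finsupp.degree _ _).trans
      (congrArg₂ _ (Finsupp.degree_mapDomain _ _) (Finsupp.degree_mapDomain _ _))
  have h2 : (S.comp T).euler.degree = S.euler.degree + T.euler.degree :=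
    (map_add Finsupp.degree _ _).trans
      (congrArg₂ _ (Finsupp.degree_mapDomain _ _) (Finsupp.degree_mapDomain _ _))
  have h3 : (S.comp T).alpha = S.alpha + T.alpha := rfl
  simp only [degree, h1, h2, h3]
  push_cast; ring

/-! #### Joining two boundary points by an arc -/

def CapRel (S : Surface a b) (s : Slot N M) (x y : S.Comp) : Prop :=
  x = S.pt s.left ∧ y = S.pt s.right

theorem capRel_joinMate_source (S : Surface a b) (s : Slot N M) (x : Fin N) :
    Quot.mk (S.CapRel s) (S.pt (s.joinMate a x)) = Quot.mk (S.CapRel s) (S.pt x) := by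
  have h : Quot.mk (S.CapRel s) (S.pt s.left) = Quot.mk (S.CapRel s) (S.pt s.right) :=
    Quot.sound ⟨rfl, rfl⟩
  unfold Slot.joinMate
  split_ifs with h1 h2
  · rw [S.pt_source, ← h, ← h1, S.pt_source]
  · rw [S.pt_source, h, ← h2, S.pt_source]
  · rw [S.pt_source]

theorem capRel_joinMate_target (S : Surface a b) (s : Slot N M) (x : Fin N) :
    Quot.mk (S.CapRel s) (S.pt (s.joinMate b x)) = Quot.mk (S.CapRel s) (S.pt x) := by
  have h : Quot.mk (S.CapRel s) (S.pt s.left) = Quot.mk (S.CapRel s) (S.pt s.right) :=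
    Quot.sound ⟨rfl, rfl⟩
  unfold Slot.joinMate
  split_ifs with h1 h2
  · rw [S.pt_target, ← h, ← h1, S.pt_target]
  · rw [S.pt_target, h, ← h2, S.pt_target]
  · rw [S.pt_target]

/-- Gluing the strip `arc × [0,1]` to `S` along the vertical segments over two adjacent points.
This does not change the relative Euler characteristic. -/
noncomputable def cap (s : Slot N M) (S : Surface a b) : Surface (a.cap s) (b.cap s) where
  Comp := Quot (S.CapRel s)
  finite_comp := by
    have := S.finite_comp
    infer_instance
  pt j := Quot.mk _ (S.pt (s.skip j))
  pt_source j := by rw [Diagram.skip_cap_mate]; exact S.capRel_joinMate_source s _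
  pt_target j := by rw [Diagram.skip_cap_mate]; exact S.capRel_joinMate_target s _
  source i := Quot.mk _ (if h : i.1 < a.circles then S.source ⟨i.1, h⟩ else S.pt s.left)
  target i := Quot.mk _ (if h : i.1 < b.circles then S.target ⟨i.1, h⟩ else S.pt s.left)
  euler := S.euler.mapDomain (Quot.mk _)
  dots := S.dots.mapDomain (Quot.mk _)
  alpha := S.alpha

theorem cap_source_of_lt (s : Slot N M) (S : Surface a b) (i : Fin (a.cap s).circles)
    (h : i.1 < a.circles) : (S.cap s).source i = Quot.mk _ (S.source ⟨i.1, h⟩) :=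
  congrArg (Quot.mk _) (dif_pos h)

theorem cap_source_of_not_lt (s : Slot N M) (S : Surface a b) (i : Fin (a.cap s).circles)
    (h : ¬ i.1 < a.circles) : (S.cap s).source i = Quot.mk _ (S.pt s.left) :=
  congrArg (Quot.mk _) (dif_neg h)

theorem cap_target_of_lt (s : Slot N M) (S : Surface a b) (i : Fin (b.cap s).circles)
    (h : i.1 < b.circles) : (S.cap s).target i = Quot.mk _ (S.target ⟨i.1, h⟩) :=
  congrArg (Quot.mk _) (dif_pos h)

theorem cap_target_of_not_lt (s : Slot N M) (S : Surface a b) (i : Fin (b.cap s).circles)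
    (h : ¬ i.1 < b.circles) : (S.cap s).target i = Quot.mk _ (S.pt s.left) :=
  congrArg (Quot.mk _) (dif_neg h)

theorem degree_cap (s : Slot N M) (S : Surface a b) : (S.cap s).degree = S.degree := by
  have h1 : (S.cap s).dots.degree = S.dots.degree := Finsupp.degree_mapDomain _ _
  have h2 : (S.cap s).euler.degree = S.euler.degree := Finsupp.degree_mapDomain _ _
  have h3 : (S.cap s).alpha = S.alpha := rfl
  simp only [degree, h1, h2, h3]

theorem cap_congr (s : Slot N M) {S T : Surface a b} (h : S.Homeo T) :
    (S.cap s).Homeo (T.cap s) := by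
  obtain ⟨e, h1, h2, h3, h4, h5, h6⟩ := h
  refine Homeo.of_maps (Quot.map e ?_) (Quot.map e.symm ?_) ?_ ?_ ?_ ?_ ?_ ?_ ?_ h6
  · rintro _ _ ⟨rfl, rfl⟩; exact ⟨h1 _, h1 _⟩
  · rintro _ _ ⟨rfl, rfl⟩; simp [CapRel, ← h1]
  · rintro ⟨x⟩; exact congrArg (Quot.mk _) (e.symm_apply_apply x)
  · rintro ⟨x⟩; exact congrArg (Quot.mk _) (e.apply_symm_apply x)
  · intro j; exact congrArg (Quot.mk _) (h1 _)
  · intro i; refine congrArg (Quot.mk _) ?_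
    split_ifs
    · exact h2 _
    · exact h1 _
  · intro i; refine congrArg (Quot.mk _) ?_
    split_ifs
    · exact h3 _
    · exact h1 _
  · simp only [cap, ← h4, ← Finsupp.mapDomain_comp]; rfl
  · simp only [cap, ← h5, ← Finsupp.mapDomain_comp]; rfl

/-- The component of the capped diagram that contains a given boundary point of `a`. -/
noncomputable def capPoint (s : Slot N M) (a : Diagram N) (x : Fin N) : (a.cap s).Component :=
  if h : x ≠ s.left ∧ x ≠ s.right then Sum.inl (Quot.mk _ (s.unskip x h.1 h.2))
  else if h : a.mate s.left = s.right then Sum.inr ⟨a.circles, by simp [Diagram.cap, h]⟩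
  else Sum.inl (Quot.mk _ (s.unskip (a.mate s.left) (a.mate_ne _) h))

theorem capPoint_skip (s : Slot N M) (a : Diagram N) (j : Fin M) :
    capPoint s a (s.skip j) = Sum.inl (Quot.mk _ j) := by
  rw [capPoint, dif_pos ⟨s.skip_ne_left j, s.skip_ne_right j⟩]
  congr 2
  exact s.skip_injective (s.skip_unskip _ _ _)

theorem capPoint_left (s : Slot N M) (a : Diagram N) :
    capPoint s a s.left = capPoint s a s.right := by
  simp [capPoint]

theorem capPoint_joinMate (s : Slot N M) (a : Diagram N) (j : Fin M) :
    capPoint s a (s.joinMate a (s.skip j)) = capPoint s a (s.skip j) := by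
  rw [← Diagram.skip_cap_mate, capPoint_skip, capPoint_skip]
  exact congrArg Sum.inl (Quot.sound (r := (a.cap s).ArcRel) rfl).symm

theorem capPoint_mate (s : Slot N M) (a : Diagram N) (x : Fin N) :
    capPoint s a (a.mate x) = capPoint s a x := by
  have key : a.mate s.left ≠ s.right → capPoint s a (a.mate s.left) = capPoint s a s.left := by
    intro h
    rw [capPoint, dif_pos ⟨a.mate_ne _, h⟩, capPoint, dif_neg (by simp), dif_neg h]
  have key' : a.mate s.left ≠ s.right → capPoint s a (a.mate s.right) = capPoint s a s.left := by
    intro h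
    have h' : a.mate s.right ≠ s.left := fun e => h (by rw [← e, a.mate_mate])
    rw [← key h]
    have := capPoint_joinMate s a (s.unskip (a.mate s.left) (a.mate_ne _) h)
    rw [s.skip_unskip, Slot.joinMate, if_pos (a.mate_mate _)] at this
    exact this
  by_cases hl : x = s.left
  · subst hl
    by_cases h : a.mate s.left = s.right
    · rw [h, capPoint_left]
    · exact key h
  by_cases hr : x = s.right
  · subst hr
    by_cases h : a.mate s.left = s.right
    · rw [← h, a.mate_mate, h, capPoint_left]
    · rw [key' h, capPoint_left]
  have hj := capPoint_joinMate s a (s.unskip x hl hr)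
  rw [s.skip_unskip] at hj
  by_cases h1 : a.mate x = s.left
  · have h : a.mate s.left ≠ s.right := by rw [← h1, a.mate_mate]; exact hr
    rw [h1, ← key h, ← h1, a.mate_mate]
  by_cases h2 : a.mate x = s.right
  · have h : a.mate s.left ≠ s.right := by
      intro e; apply hl; rw [← a.mate_mate x, h2, ← e, a.mate_mate]
    rw [h2, ← capPoint_left, ← key' h, ← h2, a.mate_mate]
  rw [Slot.joinMate, if_neg h1, if_neg h2] at hj
  exact hj

/-- The component of the capped cylinder over a given component of the capped diagram. -/
noncomputable def uncap (s : Slot N M) (a : Diagram N) :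
    (a.cap s).Component → ((cylinder a).cap s).Comp :=
  Sum.elim (Quot.lift (r := (a.cap s).ArcRel) ((cylinder a).cap s).pt (by
    rintro j _ rfl; exact (((cylinder a).cap s).pt_source j).symm)) ((cylinder a).cap s).source

theorem uncap_capPoint (s : Slot N M) (a : Diagram N) (x : Fin N) :
    uncap s a (capPoint s a x) = Quot.mk _ ((cylinder a).pt x) := by
  have key : uncap s a (capPoint s a s.left) = Quot.mk _ ((cylinder a).pt s.left) := by
    rw [capPoint, dif_neg (by simp)]
    split_ifs with h
    · exact congrArg (Quot.mk _) (dif_neg (lt_irrefl _))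
    · refine congrArg (Quot.mk _) ?_
      rw [s.skip_unskip, (cylinder a).pt_source]
  by_cases hl : x = s.left
  · rw [hl, key]
  by_cases hr : x = s.right
  · rw [hr, ← capPoint_left, key]
    exact Quot.sound ⟨rfl, rfl⟩
  · rw [capPoint, dif_pos ⟨hl, hr⟩]
    exact congrArg (fun y => Quot.mk _ ((cylinder a).pt y)) (s.skip_unskip x hl hr)

theorem cap_cylinder (s : Slot N M) (a : Diagram N) :
    ((cylinder a).cap s).Homeo (cylinder (a.cap s)) := by
  have hs : ∀ i : Fin (a.cap s).circles, ¬ i.1 < a.circles →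
      capPoint s a s.left = Sum.inr i := by
    intro i hi
    have h2 : i.1 < a.circles + if a.mate s.left = s.right then 1 else 0 := i.2
    rw [capPoint, dif_neg (by simp)]
    split_ifs at h2 ⊢ with h
    · exact congrArg Sum.inr (Fin.ext (by simp; omega))
    · omega
  let f : ((cylinder a).cap s).Comp → (a.cap s).Component :=
    Quot.lift (Sum.elim (Quot.lift (r := a.ArcRel) (capPoint s a) (by
        rintro p _ rfl; exact (capPoint_mate s a p).symm))
      (fun i => Sum.inr (Fin.castLE (Nat.le_add_right _ _) i))) (by
        rintro _ _ ⟨rfl, rfl⟩; exact capPoint_left s a)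
  have hf : ∀ i, f (((cylinder a).cap s).source i) = Sum.inr i := by
    intro i
    by_cases hi : i.1 < a.circles
    · have : ((cylinder a).cap s).source i = Quot.mk _ (Sum.inr ⟨i.1, hi⟩) :=
        congrArg (Quot.mk _) (dif_pos hi)
      rw [this]; rfl
    · have : ((cylinder a).cap s).source i = Quot.mk _ ((cylinder a).pt s.left) :=
        congrArg (Quot.mk _) (dif_neg hi)
      rw [this]; exact hs i hi
  refine Homeo.of_maps f (uncap s a) ?_ ?_ ?_ hf hf ?_ ?_ rfl
  · rintro ⟨x | i⟩
    · obtain ⟨x⟩ := x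
      exact uncap_capPoint s a x
    · exact congrArg (Quot.mk _) (dif_pos i.2)
  · rintro (j | i)
    · obtain ⟨j⟩ := j
      exact capPoint_skip s a j
    · exact hf i
  · intro j; exact capPoint_skip s a j
  · exact Finsupp.mapDomain_zero
  · exact Finsupp.mapDomain_zero

theorem cap_comp (s : Slot N M) (S : Surface a b) (T : Surface b c) :
    ((S.comp T).cap s).Homeo ((S.cap s).comp (T.cap s)) := by
  let i1 : S.Comp → ((S.cap s).comp (T.cap s)).Comp := fun x => Quot.mk _ (Sum.inl (Quot.mk _ x))
  let i2 : T.Comp → ((S.cap s).comp (T.cap s)).Comp := fun x => Quot.mk _ (Sum.inr (Quot.mk _ x))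
  have e1 : i1 (S.pt s.left) = i1 (S.pt s.right) :=
    congrArg (fun x => Quot.mk _ (Sum.inl x)) (Quot.sound ⟨rfl, rfl⟩)
  have e2 : i2 (T.pt s.left) = i2 (T.pt s.right) :=
    congrArg (fun x => Quot.mk _ (Sum.inr x)) (Quot.sound ⟨rfl, rfl⟩)
  have hj : ∀ p, p ≠ s.left → p ≠ s.right → i1 (S.pt p) = i2 (T.pt p) := by
    intro p hl hr
    have := Quot.sound (Meets.pt (S := S.cap s) (T := T.cap s) (s.unskip p hl hr))
    simp only [cap, s.skip_unskip] at this
    exact this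
  have hl : i1 (S.pt s.left) = i2 (T.pt s.left) := by
    by_cases h : b.mate s.left = s.right
    · have := Quot.sound (Meets.circle (S := S.cap s) (T := T.cap s)
        ⟨b.circles, by simp [Diagram.cap, h]⟩)
      simp only [cap, lt_irrefl, dite_false] at this
      exact this
    · rw [← S.pt_target, ← T.pt_source]
      exact hj _ (b.mate_ne _) h
  have hp : ∀ p, i1 (S.pt p) = i2 (T.pt p) := by
    intro p
    by_cases h1 : p = s.left
    · rw [h1, hl]
    by_cases h2 : p = s.right
    · rw [h2, ← e1, ← e2, hl]
    exact hj p h1 h2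
  have hc : ∀ i, i1 (S.target i) = i2 (T.source i) := by
    intro i
    let i' : Fin (b.cap s).circles := Fin.castLE (Nat.le_add_right _ _) i
    have t1 : (S.cap s).target i' = Quot.mk _ (S.target i) := congrArg (Quot.mk _) (dif_pos i.2)
    have t2 : (T.cap s).source i' = Quot.mk _ (T.source i) := congrArg (Quot.mk _) (dif_pos i.2)
    have := Quot.sound (Meets.circle (S := S.cap s) (T := T.cap s) i')
    rw [t1, t2] at this
    exact this
  let j1 : S.Comp → ((S.comp T).cap s).Comp := fun x => Quot.mk _ (Quot.mk _ (Sum.inl x))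
  let j2 : T.Comp → ((S.comp T).cap s).Comp := fun x => Quot.mk _ (Quot.mk _ (Sum.inr x))
  have k : ∀ p, j1 (S.pt p) = j2 (T.pt p) := fun p =>
    congrArg (Quot.mk _) (Quot.sound (Meets.pt (S := S) (T := T) p))
  have k1 : j1 (S.pt s.left) = j1 (S.pt s.right) :=
    Quot.sound (r := (S.comp T).CapRel s) ⟨rfl, rfl⟩
  have k2 : j2 (T.pt s.left) = j2 (T.pt s.right) := by rw [← k, ← k, k1]
  refine Homeo.of_maps
    (Quot.lift (Quot.lift (Sum.elim i1 i2) ?_) ?_)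
    (Quot.lift (Sum.elim (Quot.lift j1 ?_) (Quot.lift j2 ?_)) ?_) ?_ ?_ ?_ ?_ ?_ ?_ ?_ rfl
  · rintro _ _ (p | i)
    · exact hp p
    · exact hc i
  · rintro _ _ ⟨rfl, rfl⟩; exact e1
  · rintro _ _ ⟨rfl, rfl⟩; exact k1
  · rintro _ _ ⟨rfl, rfl⟩; exact k2
  · rintro _ _ (p | i)
    · exact k _
    · change j1 _ = j2 _
      split_ifs
      · exact congrArg (Quot.mk _) (Quot.sound (Meets.circle (S := S) (T := T) _))
      · exact k _
  · rintro ⟨x⟩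
    obtain ⟨x | x⟩ := x <;> rfl
  · rintro ⟨x | x⟩ <;> obtain ⟨x⟩ := x <;> rfl
  · intro p; rfl
  · intro i
    change _ = Quot.mk _ (Sum.inl ((S.cap s).source i))
    by_cases h : i.1 < a.circles
    · rw [cap_source_of_lt _ _ _ h, cap_source_of_lt _ _ _ h]; rfl
    · rw [cap_source_of_not_lt _ _ _ h, cap_source_of_not_lt _ _ _ h]; rfl
  · intro i
    change _ = Quot.mk _ (Sum.inr ((T.cap s).target i))
    by_cases h : i.1 < c.circles
    · rw [cap_target_of_lt _ _ _ h, cap_target_of_lt _ _ _ h]; rfl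
    · rw [cap_target_of_not_lt _ _ _ h, cap_target_of_not_lt _ _ _ h]; exact hp _
  · simp only [comp, cap, Finsupp.mapDomain_add, ← Finsupp.mapDomain_comp]; rfl
  · simp only [comp, cap, Finsupp.mapDomain_add, ← Finsupp.mapDomain_comp]; rfl

/-! #### Local modifications -/

/-- Put one more dot on the component `u`. -/
noncomputable def addDot (S : Surface a b) (u : S.Comp) : Surface a b :=
  { S with dots := S.dots + Finsupp.single u 1 }

/-- Attach a handle to the component `u`. -/
noncomputable def addHandle (S : Surface a b) (u : S.Comp) : Surface a b :=
  { S with euler := S.euler + Finsupp.single u (-2) }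

/-- Remove a disc from `u` and a disc from `v`, and connect the two holes by a tube.  If `u = v`,
these are two disjoint discs in the same component. -/
noncomputable def addTube (S : Surface a b) (u v : S.Comp) : Surface a b where
  Comp := Quot (fun x y => x = u ∧ y = v)
  finite_comp := by
    have := S.finite_comp
    infer_instance
  pt p := Quot.mk _ (S.pt p)
  pt_source p := by rw [S.pt_source]
  pt_target p := by rw [S.pt_target]
  source i := Quot.mk _ (S.source i)
  target i := Quot.mk _ (S.target i)
  euler := S.euler.mapDomain (Quot.mk _) + Finsupp.single (Quot.mk _ u) (-2)
  dots := S.dots.mapDomain (Quot.mk _)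
  alpha := S.alpha

/-- The disjoint union with a sphere that carries `k` dots. -/
noncomputable def addSphere (S : Surface a b) (k : ℕ) : Surface a b where
  Comp := Option S.Comp
  finite_comp := by
    have := S.finite_comp
    infer_instance
  pt p := some (S.pt p)
  pt_source p := by rw [S.pt_source]
  pt_target p := by rw [S.pt_target]
  source i := some (S.source i)
  target i := some (S.target i)
  euler := S.euler.mapDomain some + Finsupp.single none 2
  dots := S.dots.mapDomain some + Finsupp.single none k
  alpha := S.alpha

/-- Multiplication by `α`. -/
def mulAlpha (S : Surface a b) : Surface a b := { S with alpha := S.alpha + 1 }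

theorem cap_addDot (s : Slot N M) (S : Surface a b) (u : S.Comp) :
    ((S.addDot u).cap s).Homeo ((S.cap s).addDot (Quot.mk _ u)) := by
  refine Homeo.of_maps id id (fun _ => rfl) (fun _ => rfl) (fun _ => rfl) (fun _ => rfl)
    (fun _ => rfl) ?_ ?_ rfl
  · exact Finsupp.mapDomain_id
  · exact Finsupp.mapDomain_id.trans
      (Finsupp.mapDomain_add.trans (congrArg _ Finsupp.mapDomain_single))

theorem cap_addHandle (s : Slot N M) (S : Surface a b) (u : S.Comp) :
    ((S.addHandle u).cap s).Homeo ((S.cap s).addHandle (Quot.mk _ u)) := by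
  refine Homeo.of_maps id id (fun _ => rfl) (fun _ => rfl) (fun _ => rfl) (fun _ => rfl)
    (fun _ => rfl) ?_ ?_ rfl
  · exact Finsupp.mapDomain_id.trans
      (Finsupp.mapDomain_add.trans (congrArg _ Finsupp.mapDomain_single))
  · exact Finsupp.mapDomain_id

theorem cap_mulAlpha (s : Slot N M) (S : Surface a b) :
    (S.mulAlpha.cap s).Homeo (S.cap s).mulAlpha :=
  Homeo.of_maps id id (fun _ => rfl) (fun _ => rfl) (fun _ => rfl) (fun _ => rfl)
    (fun _ => rfl) Finsupp.mapDomain_id Finsupp.mapDomain_id rfl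

theorem cap_addTube (s : Slot N M) (S : Surface a b) (u v : S.Comp) :
    ((S.addTube u v).cap s).Homeo ((S.cap s).addTube (Quot.mk _ u) (Quot.mk _ v)) := by
  refine Homeo.of_maps
    (Quot.lift (Quot.lift (fun x => Quot.mk _ (Quot.mk _ x)) ?_) ?_)
    (Quot.lift (Quot.lift (fun x => Quot.mk _ (Quot.mk _ x)) ?_) ?_) ?_ ?_ ?_ ?_ ?_ ?_ ?_ rfl
  · rintro _ _ ⟨rfl, rfl⟩; exact Quot.sound ⟨rfl, rfl⟩
  · rintro _ _ ⟨rfl, rfl⟩; exact congrArg (Quot.mk _) (Quot.sound ⟨rfl, rfl⟩)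
  · rintro _ _ ⟨rfl, rfl⟩; exact Quot.sound (r := (S.addTube u v).CapRel s) ⟨rfl, rfl⟩
  · rintro _ _ ⟨rfl, rfl⟩; exact congrArg (Quot.mk _) (Quot.sound ⟨rfl, rfl⟩)
  · rintro ⟨x⟩; obtain ⟨x⟩ := x; rfl
  · rintro ⟨x⟩; obtain ⟨x⟩ := x; rfl
  · intro p; rfl
  · intro i
    change _ = Quot.mk _ ((S.cap s).source i)
    by_cases h : i.1 < a.circles
    · rw [cap_source_of_lt _ _ _ h, cap_source_of_lt _ _ _ h]; rfl
    · rw [cap_source_of_not_lt _ _ _ h, cap_source_of_not_lt _ _ _ h]; rfl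
  · intro i
    change _ = Quot.mk _ ((S.cap s).target i)
    by_cases h : i.1 < b.circles
    · rw [cap_target_of_lt _ _ _ h, cap_target_of_lt _ _ _ h]; rfl
    · rw [cap_target_of_not_lt _ _ _ h, cap_target_of_not_lt _ _ _ h]; rfl
  · simp only [addTube, cap, Finsupp.mapDomain_add, ← Finsupp.mapDomain_comp,
      Finsupp.mapDomain_single]
    rfl
  · simp only [addTube, cap, ← Finsupp.mapDomain_comp]; rfl

theorem cap_addSphere (s : Slot N M) (S : Surface a b) (k : ℕ) :
    ((S.addSphere k).cap s).Homeo ((S.cap s).addSphere k) := by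
  refine Homeo.of_maps
    (Quot.lift (Option.map (Quot.mk _)) ?_)
    (fun x => Option.elim x (Quot.mk _ none) (Quot.lift (fun y => Quot.mk _ (some y)) ?_))
    ?_ ?_ ?_ ?_ ?_ ?_ ?_ rfl
  · rintro _ _ ⟨rfl, rfl⟩; exact congrArg some (Quot.sound ⟨rfl, rfl⟩)
  · rintro _ _ ⟨rfl, rfl⟩; exact Quot.sound ⟨rfl, rfl⟩
  · rintro ⟨_ | x⟩ <;> rfl
  · rintro (_ | x)
    · rfl
    · obtain ⟨x⟩ := x; rfl
  · intro p; rfl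
  · intro i
    change _ = some ((S.cap s).source i)
    by_cases h : i.1 < a.circles
    · rw [cap_source_of_lt _ _ _ h, cap_source_of_lt _ _ _ h]; rfl
    · rw [cap_source_of_not_lt _ _ _ h, cap_source_of_not_lt _ _ _ h]; rfl
  · intro i
    change _ = some ((S.cap s).target i)
    by_cases h : i.1 < b.circles
    · rw [cap_target_of_lt _ _ _ h, cap_target_of_lt _ _ _ h]; rfl
    · rw [cap_target_of_not_lt _ _ _ h, cap_target_of_not_lt _ _ _ h]; rfl
  · simp only [addSphere, cap, Finsupp.mapDomain_add, ← Finsupp.mapDomain_comp,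
      Finsupp.mapDomain_single]
    rfl
  · simp only [addSphere, cap, Finsupp.mapDomain_add, ← Finsupp.mapDomain_comp,
      Finsupp.mapDomain_single]
    rfl

/-! #### Genuine surfaces -/

/-- The closed curves formed by the arcs of `a × {0}`, the arcs of `b × {1}` and the vertical
segments over the marked points, as equivalence classes of marked points. -/
def Loop (a b : Diagram N) : Type := Quot (fun p q => a.ArcRel p q ∨ b.ArcRel p q)

/-- The closed curves in the boundary of `S` on a given component. -/
def loop (S : Surface a b) : Loop a b → S.Comp :=
  Quot.lift S.pt (by
    rintro p _ (rfl | rfl)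
    · exact (S.pt_source p).symm
    · exact (S.pt_target p).symm)

/-- The number of boundary circles of a component. -/
noncomputable def boundaryCount (S : Surface a b) (x : S.Comp) : ℕ :=
  {l | S.loop l = x}.ncard + {i | S.source i = x}.ncard + {i | S.target i = x}.ncard

/-- The number of arcs of `a` on a component. -/
noncomputable def arcCount (S : Surface a b) (x : S.Comp) : ℕ :=
  {p | S.pt p = x ∧ p < a.mate p}.ncard

/-- `S` is a cobordism: each component is a compact connected oriented surface of some genus
`g ≥ 0`, so that its Euler characteristic is `2 - 2 g - (number of boundary circles)`.  The class
is written as the closure under cylinders and gluing of the surfaces that satisfy this condition;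
a surface obtained by gluing satisfies it again. -/
inductive IsCobordism : ∀ {N : ℕ} {a b : Diagram N}, Surface a b → Prop
  | of_genus {N : ℕ} {a b : Diagram N} (S : Surface a b)
      (h : ∀ x : S.Comp, ∃ g : ℕ,
        S.euler x + S.arcCount x = 2 - 2 * (g : ℤ) - S.boundaryCount x) : IsCobordism S
  | cylinder {N : ℕ} (a : Diagram N) : IsCobordism (cylinder a)
  | comp {N : ℕ} {a b c : Diagram N} {S : Surface a b} {T : Surface b c}
      (hS : IsCobordism S) (hT : IsCobordism T) : IsCobordism (S.comp T)
  | cap {N M : ℕ} (s : Slot N M) {a b : Diagram N} {S : Surface a b}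
      (hS : IsCobordism S) : IsCobordism (S.cap s)

end Surface

/-! ### The graded category of dotted cobordisms modulo local relations -/

/-- A diagram `q ^ shift • diagram` with a formal shift of the quantum degree. -/
structure GradedDiagram (N : ℕ) where
  diagram : Diagram N
  shift : ℤ

/-- A power of `α` times a dotted cobordism, of quantum degree zero as a map between shifted
diagrams. -/
structure Cobordism {N : ℕ} (X Y : GradedDiagram N) where
  surface : Surface X.diagram Y.diagram
  isCobordism : surface.IsCobordism
  degree_eq : surface.degree = X.shift - Y.shift

instance Cobordism.setoid {N : ℕ} (X Y : GradedDiagram N) : Setoid (Cobordism X Y) where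
  r F G := F.surface.Homeo G.surface
  iseqv := ⟨fun _ => .refl _, fun h => h.symm, fun h h' => h.trans h'⟩

noncomputable def Cobordism.comp {N : ℕ} {X Y Z : GradedDiagram N} (F : Cobordism X Y)
    (G : Cobordism Y Z) : Cobordism X Z where
  surface := F.surface.comp G.surface
  isCobordism := F.isCobordism.comp G.isCobordism
  degree_eq := by rw [Surface.degree_comp, F.degree_eq, G.degree_eq]; ring

noncomputable instance (N : ℕ) : Category (GradedDiagram N) where
  Hom X Y := _root_.Quotient (Cobordism.setoid X Y)
  id X := Quotient.mk _
    ⟨Surface.cylinder X.diagram, .cylinder _, by rw [Surface.degree_cylinder, sub_self]⟩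
  comp := Quotient.map₂ Cobordism.comp (fun _ _ h _ _ h' => Surface.comp_congr h h')
  id_comp := by rintro X Y ⟨F⟩; exact Quotient.sound (Surface.cylinder_comp F.surface)
  comp_id := by rintro X Y ⟨F⟩; exact Quotient.sound (Surface.comp_cylinder F.surface)
  assoc := by
    rintro X Y Z W ⟨F⟩ ⟨G⟩ ⟨H⟩
    exact Quotient.sound (Surface.comp_assoc F.surface G.surface H.surface)

/-- The category whose morphisms are formal linear combinations of cobordisms. -/
abbrev LinearCob (N : ℕ) : Type := Free ℤ (GradedDiagram N)

/-- A cobordism as a linear combination. -/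
noncomputable def Cobordism.toLinear {N : ℕ} {X Y : GradedDiagram N} (F : Cobordism X Y) :
    Free.of ℤ X ⟶ Free.of ℤ Y :=
  (Free.embedding ℤ (GradedDiagram N)).map (Quotient.mk _ F)

/-- The local relations, as elements that are set to zero: a sphere with `0`, `1`, `2` or `3` dots
equals `0`, `1`, `0` or `α`; a tube equals the sum of the two ways to cut it and to put a dot on one
of the two discs; a handle equals two dots. -/
inductive LocalRelation {N : ℕ} {X Y : GradedDiagram N} : (Free.of ℤ X ⟶ Free.of ℤ Y) → Prop
  | sphere_zero (S : Surface X.diagram Y.diagram) (F : Cobordism X Y)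
      (hF : F.surface.Homeo (S.addSphere 0)) : LocalRelation F.toLinear
  | sphere_one (S : Surface X.diagram Y.diagram) (F G : Cobordism X Y)
      (hF : F.surface.Homeo (S.addSphere 1)) (hG : G.surface.Homeo S) :
      LocalRelation (F.toLinear - G.toLinear)
  | sphere_two (S : Surface X.diagram Y.diagram) (F : Cobordism X Y)
      (hF : F.surface.Homeo (S.addSphere 2)) : LocalRelation F.toLinear
  | sphere_three (S : Surface X.diagram Y.diagram) (F G : Cobordism X Y)
      (hF : F.surface.Homeo (S.addSphere 3)) (hG : G.surface.Homeo S.mulAlpha) :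
      LocalRelation (F.toLinear - G.toLinear)
  | tube (S : Surface X.diagram Y.diagram) (u v : S.Comp) (F G H : Cobordism X Y)
      (hF : F.surface.Homeo (S.addTube u v)) (hG : G.surface.Homeo (S.addDot u))
      (hH : H.surface.Homeo (S.addDot v)) :
      LocalRelation (F.toLinear - (G.toLinear + H.toLinear))
  | handle (S : Surface X.diagram Y.diagram) (u : S.Comp) (F G : Cobordism X Y)
      (hF : F.surface.Homeo (S.addHandle u)) (hG : G.surface.Homeo (S.addDot u)) :
      LocalRelation (F.toLinear - (G.toLinear + G.toLinear))

/-- The two-sided ideal generated by the local relations. -/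
noncomputable def localIdeal {N : ℕ} (X Y : LinearCob N) : AddSubgroup (X ⟶ Y) :=
  AddSubgroup.closure {e | ∃ (X' Y' : GradedDiagram N) (f : X ⟶ Free.of ℤ X')
    (r : Free.of ℤ X' ⟶ Free.of ℤ Y') (g : Free.of ℤ Y' ⟶ Y), LocalRelation r ∧ e = f ≫ r ≫ g}

theorem comp_mem_localIdeal {N : ℕ} {X Y Z : LinearCob N} (f : X ⟶ Y) {e : Y ⟶ Z}
    (he : e ∈ localIdeal Y Z) : f ≫ e ∈ localIdeal X Z := by
  refine AddSubgroup.closure_induction (p := fun e _ => f ≫ e ∈ localIdeal X Z) ?_ ?_ ?_ ?_ he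
  · rintro _ ⟨X', Y', f', r, g, hr, rfl⟩
    exact AddSubgroup.subset_closure ⟨X', Y', f ≫ f', r, g, hr, (Category.assoc _ _ _).symm⟩
  · rw [comp_zero]; exact zero_mem _
  · intro x y _ _ hx hy; rw [Preadditive.comp_add]; exact add_mem hx hy
  · intro x _ hx; rw [Preadditive.comp_neg]; exact neg_mem hx

theorem localIdeal_comp_mem {N : ℕ} {X Y Z : LinearCob N} {e : X ⟶ Y} (f : Y ⟶ Z)
    (he : e ∈ localIdeal X Y) : e ≫ f ∈ localIdeal X Z := by
  refine AddSubgroup.closure_induction (p := fun e _ => e ≫ f ∈ localIdeal X Z) ?_ ?_ ?_ ?_ he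
  · rintro _ ⟨X', Y', f', r, g, hr, rfl⟩
    exact AddSubgroup.subset_closure ⟨X', Y', f', r, g ≫ f, hr, by simp only [Category.assoc]⟩
  · rw [zero_comp]; exact zero_mem _
  · intro x y _ _ hx hy; rw [Preadditive.add_comp]; exact add_mem hx hy
  · intro x _ hx; rw [Preadditive.neg_comp]; exact neg_mem hx

/-- Equality modulo the local relations. -/
noncomputable def localRel (N : ℕ) : HomRel (LinearCob N) := fun X Y f g => f - g ∈ localIdeal X Y

instance (N : ℕ) : Congruence (localRel N) where
  equivalence :=
    { refl := fun f => by simp only [localRel, sub_self]; exact zero_mem _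
      symm := fun h => by simpa [localRel] using neg_mem h
      trans := fun h h' => by simpa [localRel] using add_mem h h' }
  comp_left f g g' h := by
    simp only [localRel, ← Preadditive.comp_sub]; exact comp_mem_localIdeal f h
  comp_right f h := by
    simp only [localRel, ← Preadditive.sub_comp]; exact localIdeal_comp_mem f h

theorem localRel_add (N : ℕ) ⦃X Y : LinearCob N⦄ (f₁ f₂ g₁ g₂ : X ⟶ Y)
    (hf : localRel N f₁ f₂) (hg : localRel N g₁ g₂) : localRel N (f₁ + g₁) (f₂ + g₂) := by
  have := add_mem hf hg
  rwa [← add_sub_add_comm] at this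

/-- Shifted diagrams in the disc with `N` marked points, and combinations of dotted cobordisms of
quantum degree zero modulo the local relations. -/
abbrev DiscCob (N : ℕ) : Type := CategoryTheory.Quotient (localRel N)

noncomputable instance (N : ℕ) : Preadditive (DiscCob N) :=
  CategoryTheory.Quotient.preadditive (localRel N) (localRel_add N)

instance (N : ℕ) : (CategoryTheory.Quotient.functor (localRel N)).Additive :=
  CategoryTheory.Quotient.functor_additive (localRel N) (localRel_add N)

/-! ### Planar composition with a turnback -/

noncomputable def Cobordism.cap {N M : ℕ} (s : Slot N M) {X Y : GradedDiagram N}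
    (F : Cobordism X Y) :
    Cobordism (⟨X.diagram.cap s, X.shift⟩ : GradedDiagram M) ⟨Y.diagram.cap s, Y.shift⟩ where
  surface := F.surface.cap s
  isCobordism := .cap s F.isCobordism
  degree_eq := by rw [Surface.degree_cap, F.degree_eq]

/-- Joining two adjacent marked points by an arc, as a functor. -/
noncomputable def capGraded {N M : ℕ} (s : Slot N M) : GradedDiagram N ⥤ GradedDiagram M where
  obj X := ⟨X.diagram.cap s, X.shift⟩
  map := Quotient.map (Cobordism.cap s) (fun _ _ h => Surface.cap_congr s h)
  map_id X := Quotient.sound (Surface.cap_cylinder s X.diagram)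
  map_comp := by
    rintro X Y Z ⟨F⟩ ⟨G⟩
    exact Quotient.sound (Surface.cap_comp s F.surface G.surface)

noncomputable def capLinear {N M : ℕ} (s : Slot N M) : LinearCob N ⥤ LinearCob M :=
  Free.lift ℤ (capGraded s ⋙ Free.embedding ℤ (GradedDiagram M))

instance {N M : ℕ} (s : Slot N M) : (capLinear s).Additive :=
  inferInstanceAs (Free.lift ℤ (capGraded s ⋙ Free.embedding ℤ (GradedDiagram M))).Additive

theorem capLinear_map_toLinear {N M : ℕ} (s : Slot N M) {X Y : GradedDiagram N}
    (F : Cobordism X Y) : (capLinear s).map F.toLinear = (F.cap s).toLinear := by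
  refine (Free.lift_map_single ℤ _ _ _).trans ?_
  rw [one_smul]; rfl

theorem capLinear_map_localRelation {N M : ℕ} (s : Slot N M) {X Y : GradedDiagram N}
    {r : Free.of ℤ X ⟶ Free.of ℤ Y} (hr : LocalRelation r)
    {r' : Free.of ℤ ((capGraded s).obj X) ⟶ Free.of ℤ ((capGraded s).obj Y)}
    (h : r' = (capLinear s).map r) : LocalRelation r' := by
  have hF := fun F : Cobordism X Y => capLinear_map_toLinear s F
  cases hr with
  | sphere_zero S F hF' =>
    obtain rfl : r' = (F.cap s).toLinear := h.trans (hF F)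
    exact .sphere_zero (S.cap s) _ ((Surface.cap_congr s hF').trans (Surface.cap_addSphere s S 0))
  | sphere_one S F G hF' hG =>
    obtain rfl : r' = (F.cap s).toLinear - (G.cap s).toLinear :=
      (h.trans (capLinear s).map_sub).trans (congrArg₂ (fun x y => x - y) (hF F) (hF G))
    refine .sphere_one (S.cap s) _ _
      ((Surface.cap_congr s hF').trans (Surface.cap_addSphere s S 1)) ?_
    exact Surface.cap_congr s hG
  | sphere_two S F hF' =>
    obtain rfl : r' = (F.cap s).toLinear := h.trans (hF F)
    exact .sphere_two (S.cap s) _ ((Surface.cap_congr s hF').trans (Surface.cap_addSphere s S 2))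
  | sphere_three S F G hF' hG =>
    obtain rfl : r' = (F.cap s).toLinear - (G.cap s).toLinear :=
      (h.trans (capLinear s).map_sub).trans (congrArg₂ (fun x y => x - y) (hF F) (hF G))
    exact .sphere_three (S.cap s) _ _
      ((Surface.cap_congr s hF').trans (Surface.cap_addSphere s S 3))
      ((Surface.cap_congr s hG).trans (Surface.cap_mulAlpha s S))
  | tube S u v F G H hF' hG hH =>
    obtain rfl : r' = (F.cap s).toLinear - ((G.cap s).toLinear + (H.cap s).toLinear) :=
      (h.trans (capLinear s).map_sub).trans (congrArg₂ (fun x y => x - y) (hF F)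
        ((capLinear s).map_add.trans (congrArg₂ (fun x y => x + y) (hF G) (hF H))))
    exact .tube (S.cap s) _ _ _ _ _
      ((Surface.cap_congr s hF').trans (Surface.cap_addTube s S u v))
      ((Surface.cap_congr s hG).trans (Surface.cap_addDot s S u))
      ((Surface.cap_congr s hH).trans (Surface.cap_addDot s S v))
  | handle S u F G hF' hG =>
    obtain rfl : r' = (F.cap s).toLinear - ((G.cap s).toLinear + (G.cap s).toLinear) :=
      (h.trans (capLinear s).map_sub).trans (congrArg₂ (fun x y => x - y) (hF F)
        ((capLinear s).map_add.trans (congrArg₂ (fun x y => x + y) (hF G) (hF G))))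
    exact .handle (S.cap s) _ _ _
      ((Surface.cap_congr s hF').trans (Surface.cap_addHandle s S u))
      ((Surface.cap_congr s hG).trans (Surface.cap_addDot s S u))

theorem capLinear_map_mem {N M : ℕ} (s : Slot N M) {X Y : LinearCob N} {e : X ⟶ Y}
    (he : e ∈ localIdeal X Y) :
    (capLinear s).map e ∈ localIdeal ((capLinear s).obj X) ((capLinear s).obj Y) := by
  refine AddSubgroup.closure_induction
    (p := fun e _ => (capLinear s).map e ∈ localIdeal _ _) ?_ ?_ ?_ ?_ he
  · rintro _ ⟨X', Y', f', r, g, hr, rfl⟩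
    rw [Functor.map_comp, Functor.map_comp]
    exact AddSubgroup.subset_closure ⟨_, _, _, _, _, capLinear_map_localRelation s hr rfl, rfl⟩
  · rw [Functor.map_zero]; exact zero_mem _
  · intro x y _ _ hx hy; rw [Functor.map_add]; exact add_mem hx hy
  · intro x _ hx; rw [Functor.map_neg]; exact neg_mem hx

noncomputable def capDisc {N M : ℕ} (s : Slot N M) : DiscCob N ⥤ DiscCob M :=
  CategoryTheory.Quotient.lift (localRel N)
    (capLinear s ⋙ CategoryTheory.Quotient.functor (localRel M)) (by
      intro X Y f g h
      refine CategoryTheory.Quotient.sound _ ?_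
      have := capLinear_map_mem s h
      rwa [Functor.map_sub] at this)

instance {N M : ℕ} (s : Slot N M) : (capDisc s).Additive where
  map_add := by
    rintro X Y ⟨f⟩ ⟨g⟩
    exact (capLinear s ⋙ CategoryTheory.Quotient.functor (localRel M)).map_add (f := f) (g := g)

/-! ### The additive categories and universal projectors -/

/-- The category `BN^m_n`: finite direct sums of shifted diagrams with `m` points on the top and
`n` points on the bottom of the square, and matrices of morphisms of quantum degree zero. -/
abbrev BN (m n : ℕ) : Type 1 := Mat_ (DiscCob (m + n))

instance (m n : ℕ) : HasBinaryBiproducts (BN m n) :=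
  hasBinaryBiproducts_of_finite_biproducts _

/-- The functor `a_i ⊗ -` that puts on top of a diagram the diagram with `i` vertical strands, one
arc that joins the points `i` and `i + 1`, and `k - i` vertical strands. -/
noncomputable def turnbackAbove {m n k : ℕ} (h : k + 2 = m) (i : ℕ) (hi : i ≤ k) :
    BN m n ⥤ BN k n :=
  (capDisc ⟨by omega, i, by omega⟩ : DiscCob (m + n) ⥤ DiscCob (k + n)).mapMat_

/-- The functor `- ⊗ b_j` that puts below a diagram the diagram with `j` vertical strands, one
arc that joins the points `j` and `j + 1`, and `k - j` vertical strands. -/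
noncomputable def turnbackBelow {m n k : ℕ} (h : k + 2 = n) (j : ℕ) (hj : j ≤ k) :
    BN m n ⥤ BN m k :=
  (capDisc ⟨by omega, m + (k - j), by omega⟩ : DiscCob (m + n) ⥤ DiscCob (m + k)).mapMat_

instance {C D : Type} [Category.{1} C] [Category.{1} D] [Preadditive C] [Preadditive D]
    (F : C ⥤ D) [F.Additive] : F.mapMat_.Additive where
  map_add := by
    intro X Y f g
    ext i j
    exact F.map_add

instance {m n k : ℕ} (h : k + 2 = m) (i : ℕ) (hi : i ≤ k) :
    (turnbackAbove h i hi : BN m n ⥤ BN k n).Additive := by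
  unfold turnbackAbove; infer_instance

instance {m n k : ℕ} (h : k + 2 = n) (j : ℕ) (hj : j ≤ k) :
    (turnbackBelow h j hj : BN m n ⥤ BN m k).Additive := by
  unfold turnbackBelow; infer_instance

/-- A complex is contractible: it is homotopy equivalent to zero. -/
def IsContractible {m n : ℕ} (K : CochainComplex (BN m n) ℤ) : Prop :=
  Nonempty (Homotopy (𝟙 K) 0)

/-- `a_i ⊗ Q` and `Q ⊗ b_j` are contractible for all `i` and `j`. -/
structure KillsTurnbacks {m n : ℕ} (Q : CochainComplex (BN m n) ℤ) : Prop where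
  above : ∀ (k : ℕ) (h : k + 2 = m) (i : ℕ) (hi : i ≤ k),
    IsContractible (((turnbackAbove h i hi).mapHomologicalComplex _).obj Q)
  below : ∀ (k : ℕ) (h : k + 2 = n) (j : ℕ) (hj : j ≤ k),
    IsContractible (((turnbackBelow h j hj).mapHomologicalComplex _).obj Q)

/-- The shifted identity diagram `q ^ r • 1_n`. -/
noncomputable def BN.identity (n : ℕ) (r : ℤ) : BN n n :=
  (Mat_.embedding (DiscCob (n + n))).obj
    ((CategoryTheory.Quotient.functor (localRel (n + n))).obj
      (Free.of ℤ (⟨Diagram.identity n, r⟩ : GradedDiagram (n + n))))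

/-- A universal projector on `n` strands. -/
structure UniversalProjector (n : ℕ) where
  complex : CochainComplex (BN n n) ℤ
  /-- the complex lives in non-positive homological degrees -/
  isZero_of_pos : ∀ i : ℤ, 0 < i → IsZero (complex.X i)
  /-- the chain group in degree zero is `1_n` -/
  zeroIso : BN.identity n 0 ≅ complex.X 0
  /-- no shift of `1_n` is a direct summand of another chain group -/
  not_summand : ∀ i : ℤ, i ≠ 0 → ∀ (r : ℤ) (Z : BN n n),
    IsEmpty (complex.X i ≅ BN.identity n r ⊞ Z)
  killsTurnbacks : KillsTurnbacks complex

/-- The inclusion `ι_P : 1_n → P` of the chain group in degree zero. -/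
noncomputable def UniversalProjector.ι {n : ℕ} (P : UniversalProjector n) :
    (HomologicalComplex.single (BN n n) (ComplexShape.up ℤ) 0).obj (BN.identity n 0) ⟶ P.complex :=
  HomologicalComplex.mkHomFromSingle P.zeroIso.hom (fun k hk =>
    (P.isZero_of_pos k (by simp only [ComplexShape.up_Rel] at hk; omega)).eq_of_tgt _ _)

end BarNatan

namespace BarNatan

/-! ### Extension of chain maps and homotopies -/

section HomologicalAlgebra

/-! The projectors behave towards each other like projective resolutions. In degree $i\neq 0$ the
chain group $P^i$ is a sum of shifted diagrams, none of which has the arcs of $1_n$: delooping would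
turn its circles into shifts, and some $q^r 1_n$ would be a summand of $P^i$ (`isSummand_deloop`,
`UniversalProjector.mate_ne_rev`). A non-crossing matching other than that of $n$ parallel strands
joins two adjacent top points (`Diagram.mate_eq_rev`). Such an arc can be bent to the other side:
maps from this diagram to $Y$ are, naturally in $Y$, a retract of maps from the diagram without the
arc to $Y$ capped at these two points (`exists_bending_capDisc`). Capping $Q$ there gives a
contractible complex, so $\mathrm{Hom}(P^i,Q)$ is exact for $i<0$ (`Bending.homExact`,
`UniversalProjector.homExact`). The comparison argument for resolutions then extends each map
$P^0\to Q^0$ to a chain map, unique up to homotopy. Extending the identity of $1_n$ in both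
directions gives $\psi$ and its homotopy inverse.

For the sign, the degree-zero components of a homotopy equivalence and of its inverse are $k$ and
$l$ times the identity of $1_n$, because degree-zero endomorphisms of $1_n$ are integer multiples of
the identity (`disc_eq_zsmul_id`). The homotopy changes the composite in degree $0$ by a map through
$P^{-1}$, and such an endomorphism of $1_n$ vanishes (`disc_comp_eq_zero`). Hence $kl=1$, as the
multiples of the identity are distinct (`zsmul_id_injective`). Distinctness and vanishing come from
a state sum, the evaluation of cobordisms at $\alpha=1$ over $\mathbb C$, where the dot has the two
eigenvalues $\pm1$.

Both bending and the degree count need the genus formula for each component of a cobordism, so the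
formula must survive stacking and capping (`HasGenus.comp`, `HasGenus.cap`). Arcs join points of
opposite parity, so boundary loops are the cycles of permutations of the even-numbered marked
points. Stacking multiplies these permutations, and the genus comes from the Riemann-Hurwitz formula
`exists_genus`. Capping multiplies by two transpositions, which is handled in `cycleCount_join`. -/

theorem exists_dependent_seq {T : ℕ → Type*} (Inv : ∀ k, T k → Prop)
    (R : ∀ k, T k → T (k + 1) → Prop) (t₀ : T 0) (h₀ : Inv 0 t₀)
    (step : ∀ k t, Inv k t → ∃ t', R k t t' ∧ Inv (k + 1) t') :
    ∃ t : ∀ k, T k, t 0 = t₀ ∧ ∀ k, R k (t k) (t (k + 1)) := by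
  choose next hR hI using step
  let u : ∀ k, { t : T k // Inv k t } := fun k =>
    Nat.rec ⟨t₀, h₀⟩ (fun k t => ⟨next k t.1 t.2, hI k t.1 t.2⟩) k
  exact ⟨fun k => (u k).1, rfl, fun k => hR k (u k).1 (u k).2⟩

variable {C : Type*} [Category C] [Preadditive C]

theorem exists_int_family {A B : ℤ → C} (h : ∀ k : ℕ, A (-(k : ℤ)) ⟶ B (-(k : ℤ))) :
    ∃ H : ∀ i, A i ⟶ B i, ∀ k : ℕ, H (-(k : ℤ)) = h k := by
  classical
  refine ⟨fun i => if hi : ∃ k : ℕ, i = -(k : ℤ) then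
    eqToHom (congrArg A hi.choose_spec) ≫ h hi.choose ≫ eqToHom (congrArg B hi.choose_spec.symm)
    else 0, fun k => ?_⟩
  have hk : ∃ l : ℕ, -(k : ℤ) = -(l : ℤ) := ⟨k, rfl⟩
  refine (dif_pos hk).trans ?_
  have e : hk.choose = k := by have := hk.choose_spec; omega
  have : ∀ (l : ℕ) (hl : -(k : ℤ) = -(l : ℤ)), l = k →
      eqToHom (congrArg A hl) ≫ h l ≫ eqToHom (congrArg B hl.symm) = h k := by
    rintro l hl rfl; simp
  exact this _ hk.choose_spec e

theorem exists_int_family_shift {A B : ℤ → C}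
    (h : ∀ k : ℕ, A (-(k : ℤ)) ⟶ B (-((k + 1 : ℕ) : ℤ))) :
    ∃ H : ∀ i j, A i ⟶ B j, (∀ k : ℕ, H (-(k : ℤ)) (-((k + 1 : ℕ) : ℤ)) = h k) ∧
      ∀ i j, j + 1 ≠ i → H i j = 0 := by
  obtain ⟨H, hH⟩ := exists_int_family (A := A) (B := fun i => B (i - 1))
    (fun k => h k ≫ eqToHom (congrArg B (by push_cast; ring)))
  refine ⟨fun i j => if hij : j + 1 = i then H i ≫ eqToHom (congrArg B (by omega)) else 0,
    fun k => ?_, fun i j hij => dif_neg hij⟩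
  refine (dif_pos (by push_cast; ring)).trans ?_
  rw [hH]
  simp

/-- The complex of morphisms from `A` to `K` is exact. -/
def HomExact (A : C) (K : CochainComplex C ℤ) : Prop :=
  ∀ i j k : ℤ, i + 1 = j → j + 1 = k → ∀ x : A ⟶ K.X j, x ≫ K.d j k = 0 →
    ∃ y : A ⟶ K.X i, y ≫ K.d i j = x

variable {K L : CochainComplex C ℤ}

/-- The comparison argument for resolutions: exactness of `Hom(K.X i, L)` for `i < 0` replaces
projectivity of `K.X i` and acyclicity of `L`. Components are chosen in descending degree. The
invariant says that `d ≫ t` is a cycle, and it holds at the start because `L.X 1` is zero, so `f₀`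
is arbitrary. -/
theorem exists_chainMap_of_homExact
    (hL : ∀ i : ℤ, 0 < i → IsZero (L.X i)) (hex : ∀ i : ℤ, i < 0 → HomExact (K.X i) L)
    (f₀ : K.X 0 ⟶ L.X 0) : ∃ f : K ⟶ L, f.f 0 = f₀ := by
  obtain ⟨t, ht0, ht⟩ := exists_dependent_seq
    (T := fun k => K.X (-(k : ℤ)) ⟶ L.X (-(k : ℤ)))
    (fun k t => K.d (-((k + 1 : ℕ) : ℤ)) (-(k : ℤ)) ≫ t ≫ L.d (-(k : ℤ)) (-(k : ℤ) + 1) = 0)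
    (fun k t t' => t' ≫ L.d (-((k + 1 : ℕ) : ℤ)) (-(k : ℤ)) =
      K.d (-((k + 1 : ℕ) : ℤ)) (-(k : ℤ)) ≫ t)
    f₀ ((hL _ (by simp)).eq_of_tgt _ _) (by
      intro k t ht
      obtain ⟨y, hy⟩ := hex (-((k + 1 : ℕ) : ℤ)) (by omega) (-((k + 1 : ℕ) : ℤ)) (-(k : ℤ))
        (-(k : ℤ) + 1) (by omega) rfl (K.d (-((k + 1 : ℕ) : ℤ)) (-(k : ℤ)) ≫ t)
        (by rw [Category.assoc, ht])
      refine ⟨y, hy, ?_⟩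
      have e : -((k + 1 : ℕ) : ℤ) + 1 = -(k : ℤ) := by omega
      rw [e, hy, ← Category.assoc, K.d_comp_d, zero_comp])
  obtain ⟨H, hH⟩ := exists_int_family (A := K.X) (B := L.X) t
  refine ⟨⟨H, ?_⟩, (hH 0).trans ht0⟩
  rintro i j rfl
  by_cases hi : i + 1 ≤ 0
  · obtain ⟨k, hk⟩ : ∃ k : ℕ, i = -((k + 1 : ℕ) : ℤ) := ⟨(-i - 1).toNat, by omega⟩
    have e : i + 1 = -(k : ℤ) := by omega
    rw [e, hk, hH, hH, ht]
  · exact (hL _ (by omega)).eq_of_tgt _ _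

/-- The homotopy is built in descending degree, starting from the zero map `K.X 0 ⟶ L.X (-1)`; this
start is allowed because `f` vanishes in degree zero. The invariant makes the remaining error `f - d
≫ t` of the next degree a cycle. -/
theorem homotopy_zero_of_homExact (hK : ∀ i : ℤ, 0 < i → IsZero (K.X i))
    (hex : ∀ i : ℤ, i < 0 → HomExact (K.X i) L) (f : K ⟶ L) (hf : f.f 0 = 0) :
    Nonempty (Homotopy f 0) := by
  obtain ⟨t, ht0, ht⟩ := exists_dependent_seq
    (T := fun k => K.X (-(k : ℤ)) ⟶ L.X (-((k + 1 : ℕ) : ℤ)))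
    (fun k t => K.d (-((k + 1 : ℕ) : ℤ)) (-(k : ℤ)) ≫
      (f.f (-(k : ℤ)) - t ≫ L.d (-((k + 1 : ℕ) : ℤ)) (-(k : ℤ))) = 0)
    (fun k t t' => f.f (-((k + 1 : ℕ) : ℤ)) = K.d (-((k + 1 : ℕ) : ℤ)) (-(k : ℤ)) ≫ t +
      t' ≫ L.d (-((k + 1 + 1 : ℕ) : ℤ)) (-((k + 1 : ℕ) : ℤ)))
    0 (by
      have : f.f (-((0 : ℕ) : ℤ)) = 0 := hf
      rw [this]; simp) (by
      intro k t ht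
      obtain ⟨y, hy⟩ := hex (-((k + 1 : ℕ) : ℤ)) (by omega) (-((k + 1 + 1 : ℕ) : ℤ))
        (-((k + 1 : ℕ) : ℤ)) (-(k : ℤ)) (by omega) (by omega)
        (f.f (-((k + 1 : ℕ) : ℤ)) - K.d (-((k + 1 : ℕ) : ℤ)) (-(k : ℤ)) ≫ t) (by
          rw [← ht]; simp)
      refine ⟨y, by rw [hy]; abel, ?_⟩
      rw [hy]; simp)
  obtain ⟨H, hH, hH0⟩ := exists_int_family_shift (A := K.X) (B := L.X) t
  refine ⟨⟨H, fun i j hij => hH0 i j hij, ?_⟩⟩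
  intro i
  rw [HomologicalComplex.zero_f, add_zero]
  by_cases hi : i ≤ 0
  · obtain ⟨k, rfl⟩ : ∃ k : ℕ, i = -(k : ℤ) := ⟨(-i).toNat, by omega⟩
    rw [prevD_eq H (show (ComplexShape.up ℤ).Rel (-((k + 1 : ℕ) : ℤ)) (-(k : ℤ)) by simp), hH]
    cases k with
    -- In degree zero both terms of the homotopy vanish, one by the choice of the start and the
    -- other because `K.X 1` is zero.
    | zero =>
      rw [ht0, zero_comp, add_zero, dNext_eq H
        (show (ComplexShape.up ℤ).Rel (-((0 : ℕ) : ℤ)) 1 by simp),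
        (hK 1 (by simp)).eq_of_src (H 1 (-((0 : ℕ) : ℤ))) 0, comp_zero]
      exact hf
    | succ k =>
      rw [dNext_eq H (show (ComplexShape.up ℤ).Rel (-((k + 1 : ℕ) : ℤ)) (-(k : ℤ)) by simp),
        hH, ht]
  · exact (hK _ (by omega)).eq_of_src _ _

/-- Homotopic maps into a complex differ in degree zero by a map that factors through `L.d (-1) 0`,
if the source vanishes in degree one. -/
theorem exists_factor_of_homotopy (hK : IsZero (K.X 1)) {f g : K ⟶ L} (h : Homotopy f g) :
    ∃ y : K.X 0 ⟶ L.X (-1), f.f 0 = y ≫ L.d (-1) 0 + g.f 0 := by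
  refine ⟨h.hom 0 (-1), ?_⟩
  rw [h.comm 0, dNext_eq h.hom (show (ComplexShape.up ℤ).Rel 0 1 by simp),
    prevD_eq h.hom (show (ComplexShape.up ℤ).Rel (-1) 0 by simp),
    hK.eq_of_src (h.hom 1 0) 0, comp_zero, zero_add]

end HomologicalAlgebra


/-! ### Counting classes and cycles -/

section Counting

theorem card_quot_congr {α : Type*} {r r' : α → α → Prop}
    (h : ∀ p q, r p q → Quot.mk r' p = Quot.mk r' q)
    (h' : ∀ p q, r' p q → Quot.mk r p = Quot.mk r q) : Nat.card (Quot r) = Nat.card (Quot r') :=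
  Nat.card_congr
    { toFun := Quot.lift (Quot.mk r') h
      invFun := Quot.lift (Quot.mk r) h'
      left_inv := by rintro ⟨x⟩; rfl
      right_inv := by rintro ⟨x⟩; rfl }

/-- The relation `r` together with one more pair. -/
def addPair {α : Type*} (r : α → α → Prop) (x y : α) (p q : α) : Prop := r p q ∨ (p = x ∧ q = y)

theorem card_quot_addPair_of_eq {α : Type*} {r : α → α → Prop} {x y : α}
    (h : Quot.mk r x = Quot.mk r y) : Nat.card (Quot (addPair r x y)) = Nat.card (Quot r) := by
  refine card_quot_congr ?_ fun p q hpq => Quot.sound (Or.inl hpq)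
  rintro p q (hpq | ⟨rfl, rfl⟩)
  · exact Quot.sound hpq
  · exact h

/-- The class of `y` is absorbed by that of `x`, so the new classes correspond to the old ones other
than the class of `y`. -/
theorem card_quot_addPair_of_ne {α : Type*} [Finite α] {r : α → α → Prop} {x y : α}
    (h : Quot.mk r x ≠ Quot.mk r y) :
    Nat.card (Quot (addPair r x y)) + 1 = Nat.card (Quot r) := by
  classical
  let f : Quot (addPair r x y) → { z : Quot r // z ≠ Quot.mk r y } :=
    Quot.lift (fun p => if hp : Quot.mk r p = Quot.mk r y then ⟨Quot.mk r x, h⟩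
      else ⟨Quot.mk r p, hp⟩) (by
        rintro p q (hpq | ⟨rfl, rfl⟩)
        · simp only [Quot.sound hpq]
        · simp [h])
  let g : Quot r → Quot (addPair r x y) := Quot.lift (Quot.mk _) fun p q hpq =>
    Quot.sound (Or.inl hpq)
  have hxy : Quot.mk (addPair r x y) x = Quot.mk (addPair r x y) y := Quot.sound (Or.inr ⟨rfl, rfl⟩)
  have hg : ∀ p, Quot.mk r p = Quot.mk r y →
      Quot.mk (addPair r x y) p = Quot.mk (addPair r x y) y := fun p hp => congrArg g hp
  have e : Quot (addPair r x y) ≃ { z : Quot r // z ≠ Quot.mk r y } :=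
    { toFun := f
      invFun := fun z => g z.1
      left_inv := by
        rintro ⟨p⟩
        by_cases hp : Quot.mk r p = Quot.mk r y
        · simp only [f, hp, dite_true, g]; rw [hxy, hg p hp]
        · simp only [f, hp, dite_false, g]
      right_inv := by
        rintro ⟨⟨p⟩, hp⟩
        simp only [f, g]
        exact dif_neg hp }
  have := Fintype.ofFinite (Quot r)
  rw [Nat.card_congr e, Nat.card_eq_fintype_card, Nat.card_eq_fintype_card]
  have := Set.card_ne_eq (Quot.mk r y)
  have h1 : 0 < Fintype.card (Quot r) := Fintype.card_pos_iff.mpr ⟨Quot.mk r y⟩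
  have h2 : Fintype.card { z : Quot r // z ≠ Quot.mk r y } = Fintype.card (Quot r) - 1 := by
    rw [Fintype.card_subtype_compl, Fintype.card_subtype_eq]
  omega

/-- A graph with `V` as its vertices and `E` as its edges has at least `|V| - |E|` components. -/
theorem card_le_card_add_card_quot {V E : Type*} [Finite V] [Finite E] (s t : E → V) :
    Nat.card V ≤ Nat.card E + Nat.card (Quot fun p q => ∃ e, p = s e ∧ q = t e) := by
  classical
  have := Fintype.ofFinite E
  have key : ∀ F : Finset E,
      Nat.card V ≤ F.card + Nat.card (Quot fun p q => ∃ e ∈ F, p = s e ∧ q = t e) := by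
    intro F
    induction F using Finset.induction with
    | empty =>
      rw [Finset.card_empty, zero_add]
      exact Nat.card_le_card_of_injective (Quot.mk _) fun p q hpq => by
        have := congrArg (Quot.lift id (by simp)) hpq
        exact this
    -- One more edge lowers the number of components by at most one.
    | insert e F he ih =>
      rw [Finset.card_insert_of_notMem he]
      have : (fun p q => ∃ e' ∈ insert e F, p = s e' ∧ q = t e') =
          addPair (fun p q => ∃ e ∈ F, p = s e ∧ q = t e) (s e) (t e) := by
        funext p q
        simp only [addPair, Finset.mem_insert, exists_eq_or_imp, eq_iff_iff]
        exact or_comm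
      rw [this]
      by_cases h : Quot.mk (fun p q => ∃ e ∈ F, p = s e ∧ q = t e) (s e) =
          Quot.mk (fun p q => ∃ e ∈ F, p = s e ∧ q = t e) (t e)
      · rw [card_quot_addPair_of_eq h]; omega
      · have := card_quot_addPair_of_ne h; omega
  have := key Finset.univ
  rw [Finset.card_univ, ← Nat.card_eq_fintype_card] at this
  simpa using this

/-! ### Cycles of permutations and multiplication by transpositions. -/

open Equiv Equiv.Perm

variable {E : Type*}

/-- The number of cycles of a permutation, fixed points included. -/
noncomputable def cycleCount (σ : Perm E) : ℕ := Nat.card (Quot fun x y => σ x = y)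

theorem quot_mk_eq_iff_sameCycle {σ : Perm E} {x y : E} :
    Quot.mk (fun x y => σ x = y) x = Quot.mk (fun x y => σ x = y) y ↔ σ.SameCycle x y := by
  constructor
  · intro h
    have := congrArg (Quot.lift (fun z => (Quotient.mk (SameCycle.setoid σ) z)) (by
      rintro p _ rfl
      exact Quotient.sound (s := SameCycle.setoid σ) ⟨1, by simp⟩)) h
    exact Quotient.exact this
  · rintro ⟨n, rfl⟩
    induction n using Int.induction_on with
    | zero => rfl
    | succ n ih =>
      rw [ih]; exact Quot.sound (by rw [add_comm, zpow_add, zpow_one, mul_apply])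
    | pred n ih =>
      rw [ih]; exact (Quot.sound (by rw [← mul_apply, ← zpow_one_add]; ring_nf)).symm

/-- The two products are conjugate by `τ`. -/
theorem cycleCount_mul_comm (σ τ : Perm E) : cycleCount (σ * τ) = cycleCount (τ * σ) :=
  Nat.card_congr (Quot.congr τ (fun x y => by simp))

/-- The new permutation sends `y` to `ρ x`. From there it follows the `ρ`-cycle of `x` until it
returns to `x`, since the swap affects no point of this cycle except `x`. -/
theorem sameCycle_mul_swap_of_not [Finite E] [DecidableEq E] {ρ : Perm E} {x y : E}
    (h : ¬ ρ.SameCycle x y) : (ρ * swap x y).SameCycle x y := by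
  have hx : ∃ n : ℕ, 0 < n ∧ (ρ ^ n) x = x := by
    obtain ⟨n, hn, h⟩ := (SameCycle.refl ρ x).exists_pow_eq''
    exact ⟨n, hn, h.2⟩
  classical
  let n := Nat.find hx
  have hn : 0 < n ∧ (ρ ^ n) x = x := Nat.find_spec hx
  have hmin : ∀ m, 0 < m → m < n → (ρ ^ m) x ≠ x := fun m hm hmn e => Nat.find_min hx hmn ⟨hm, e⟩
  rw [← quot_mk_eq_iff_sameCycle]
  have step : ∀ m, m < n → Quot.mk (fun p q => (ρ * swap x y) p = q) (ρ x) =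
      Quot.mk (fun p q => (ρ * swap x y) p = q) ((ρ ^ (m + 1)) x) := by
    intro m
    induction m with
    | zero => intro _; simp
    | succ m ih =>
      intro hm
      rw [ih (by omega)]
      refine Quot.sound ?_
      have h1 : (ρ ^ (m + 1)) x ≠ x := hmin _ (by omega) hm
      have h2 : (ρ ^ (m + 1)) x ≠ y := fun e => h ⟨(m + 1 : ℕ), by rw [zpow_natCast]; exact e⟩
      rw [mul_apply, swap_apply_of_ne_of_ne h1 h2, ← mul_apply, ← pow_succ']
  have h3 := step (n - 1) (by omega)
  rw [show n - 1 + 1 = n by omega, hn.2] at h3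
  rw [← h3]
  exact (Quot.sound (by simp)).symm

/-- If `n` is the first positive time with `(ρ ^ n) x = y`, the new cycle of `y` is `ρ x, …, (ρ ^ n)
x = y`, and it closes up before `x` is reached. -/
theorem not_sameCycle_mul_swap [Finite E] [DecidableEq E] {ρ : Perm E} {x y : E} (hxy : x ≠ y)
    (h : ρ.SameCycle x y) : ¬ (ρ * swap x y).SameCycle x y := by
  have hx : ∃ n : ℕ, 0 < n ∧ (ρ ^ n) x = y := by
    obtain ⟨n, hn, h⟩ := h.exists_pow_eq''
    exact ⟨n, hn, h.2⟩
  classical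
  let n := Nat.find hx
  have hn : 0 < n ∧ (ρ ^ n) x = y := Nat.find_spec hx
  have hmin : ∀ m, 0 < m → m < n → (ρ ^ m) x ≠ y := fun m hm hmn e => Nat.find_min hx hmn ⟨hm, e⟩
  have hmin' : ∀ m, 0 < m → m ≤ n → (ρ ^ m) x ≠ x := by
    intro m hm hmn e
    rcases hmn.eq_or_lt with rfl | hlt
    · exact hxy (e.symm.trans hn.2)
    · refine hmin (n - m) (by omega) (by omega) ?_
      have := hn.2
      rw [show n = (n - m) + m by omega, pow_add, mul_apply, e] at this
      exact this
  intro hs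
  obtain ⟨k, -, -, hk⟩ := hs.symm.exists_pow_eq''
  have key : ∀ k : ℕ, ∃ m, 0 < m ∧ m ≤ n ∧ ((ρ * swap x y) ^ k) y = (ρ ^ m) x := by
    intro k
    induction k with
    | zero => exact ⟨n, hn.1, le_rfl, by simp [hn.2]⟩
    | succ k ih =>
      obtain ⟨m, hm, hmn, e⟩ := ih
      rw [pow_succ', mul_apply, e]
      rcases hmn.eq_or_lt with rfl | hlt
      · exact ⟨1, one_pos, hn.1, by rw [hn.2]; simp⟩
      · refine ⟨m + 1, by omega, hlt, ?_⟩
        rw [mul_apply, swap_apply_of_ne_of_ne (hmin' m hm hmn) (hmin m hm hlt), pow_succ',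
          mul_apply]
  obtain ⟨m, hm, hmn, e⟩ := key k
  exact hmin' m hm hmn (e.symm.trans hk)

/-- Once `x` and `y` are identified, `ρ` and `ρ * swap x y` have the same classes. For `ρ` this
identification merges two classes; for the product it changes nothing, because the two points
already share a cycle. -/
theorem cycleCount_mul_swap_of_not [Finite E] [DecidableEq E] {ρ : Perm E} {x y : E}
    (h : ¬ ρ.SameCycle x y) : cycleCount (ρ * swap x y) + 1 = cycleCount ρ := by
  have h1 := card_quot_addPair_of_ne (mt quot_mk_eq_iff_sameCycle.mp h)
  have h2 := card_quot_addPair_of_eq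
    (quot_mk_eq_iff_sameCycle.mpr (sameCycle_mul_swap_of_not h))
  have h3 : Nat.card (Quot (addPair (fun p q => ρ p = q) x y)) =
      Nat.card (Quot (addPair (fun p q => (ρ * swap x y) p = q) x y)) := by
    have gen : ∀ ρ : Perm E, ∀ p q, addPair (fun p q => (ρ * swap x y) p = q) x y p q →
        Quot.mk (addPair (fun p q => ρ p = q) x y) p =
          Quot.mk (addPair (fun p q => ρ p = q) x y) q := by
      intro ρ p q hpq
      have hxy : Quot.mk (addPair (fun p q => ρ p = q) x y) x =
          Quot.mk (addPair (fun p q => ρ p = q) x y) y := Quot.sound (Or.inr ⟨rfl, rfl⟩)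
      rcases hpq with rfl | ⟨rfl, rfl⟩
      · by_cases hp : p = x
        · subst hp
          rw [mul_apply, swap_apply_left, hxy]
          exact Quot.sound (Or.inl rfl)
        by_cases hq : p = y
        · subst hq
          rw [mul_apply, swap_apply_right, ← hxy]
          exact Quot.sound (Or.inl rfl)
        · rw [mul_apply, swap_apply_of_ne_of_ne hp hq]
          exact Quot.sound (Or.inl rfl)
      · exact hxy
    refine card_quot_congr ?_ (gen ρ)
    have := gen (ρ * swap x y)
    rwa [mul_assoc, swap_mul_self, mul_one] at this
  unfold cycleCount
  omega

theorem cycleCount_mul_swap_of_sameCycle [Finite E] [DecidableEq E] {ρ : Perm E} {x y : E}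
    (hxy : x ≠ y) (h : ρ.SameCycle x y) : cycleCount (ρ * swap x y) = cycleCount ρ + 1 := by
  have := cycleCount_mul_swap_of_not (not_sameCycle_mul_swap hxy h)
  rwa [mul_assoc, swap_mul_self, mul_one, eq_comm] at this

/-- The number of orbits of the group generated by two permutations. -/
noncomputable def orbitCount (σ τ : Perm E) : ℕ := Nat.card (Quot fun x y => σ x = y ∨ τ x = y)

/-- The Riemann-Hurwitz formula for the surface glued from the polygons given by the cycles of
`σ`, `τ` and `σ * τ`. -/
theorem exists_genus [Finite E] (σ τ : Perm E) :
    ∃ g : ℕ, cycleCount σ + cycleCount τ + cycleCount (σ * τ) + 2 * g =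
      Nat.card E + 2 * orbitCount σ τ := by
  classical
  have := Fintype.ofFinite E
  induction hN : τ.support.card using Nat.strong_induction_on generalizing τ with
  | _ N ih =>
  by_cases h1 : τ = 1
  · subst h1
    refine ⟨0, ?_⟩
    have h2 : cycleCount (1 : Perm E) = Nat.card E := by
      refine (Nat.card_eq_of_bijective (Quot.mk _) ⟨fun p q hpq => ?_, Quot.mk_surjective⟩).symm
      exact congrArg (Quot.lift id (by simp)) hpq
    have h3 : orbitCount σ 1 = cycleCount σ := by
      refine card_quot_congr ?_ fun p q h => Quot.sound (Or.inl h)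
      rintro p q (h | rfl)
      · exact Quot.sound h
      · rfl
    rw [h2, h3, mul_one]; omega
  · obtain ⟨x, hx⟩ : ∃ x, τ x ≠ x := by
      by_contra hc; push Not at hc; exact h1 (Equiv.ext hc)
    -- Splitting off a transposition makes `x` a fixed point, so the support shrinks and the
    -- induction applies to `τ'`.
    obtain ⟨τ', hτ'⟩ : ∃ τ', τ' = swap x (τ x) * τ := ⟨_, rfl⟩
    obtain ⟨y, hy⟩ : ∃ y, y = τ x := ⟨_, rfl⟩
    have hlt : τ'.support.card < N := by rw [hτ', ← hN]; exact card_support_swap_mul hx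
    obtain ⟨g, hg⟩ := ih _ hlt τ' rfl
    rw [← hy] at hτ' hx
    have hττ' : τ = swap x y * τ' := by rw [hτ', ← mul_assoc, swap_mul_self, one_mul]
    have hfix : τ' x = x := by rw [hτ', mul_apply, ← hy, swap_apply_right]
    have c1 : cycleCount τ + 1 = cycleCount τ' := by
      rw [hττ', cycleCount_mul_comm]
      refine cycleCount_mul_swap_of_not fun h => hx ?_
      exact (h.eq_of_left hfix).symm
    have c2 : cycleCount (σ * τ) = cycleCount (τ' * σ * swap x y) := by
      rw [hττ', ← mul_assoc, cycleCount_mul_comm, mul_assoc]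
    have c3 : cycleCount (σ * τ') = cycleCount (τ' * σ) := cycleCount_mul_comm _ _
    have c4 : orbitCount σ τ = Nat.card (Quot (addPair (fun p q => σ p = q ∨ τ' p = q) x y)) := by
      refine card_quot_congr ?_ ?_
      · have hxy : Quot.mk (addPair (fun p q => σ p = q ∨ τ' p = q) x y) x =
          Quot.mk (addPair (fun p q => σ p = q ∨ τ' p = q) x y) y :=
            Quot.sound (Or.inr ⟨rfl, rfl⟩)
        have hp' : ∀ p, Quot.mk (addPair (fun p q => σ p = q ∨ τ' p = q) x y) p =
          Quot.mk (addPair (fun p q => σ p = q ∨ τ' p = q) x y) (τ' p) := fun p =>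
            Quot.sound (Or.inl (Or.inr rfl))
        rintro p q (h | h)
        · exact Quot.sound (Or.inl (Or.inl h))
        · rw [hp', ← h, hττ', mul_apply]
          by_cases e1 : τ' p = x
          · rw [e1, swap_apply_left, hxy]
          by_cases e2 : τ' p = y
          · rw [e2, swap_apply_right, hxy]
          rw [swap_apply_of_ne_of_ne e1 e2]
      · have hxy : Quot.mk (fun p q => σ p = q ∨ τ p = q) x =
          Quot.mk (fun p q => σ p = q ∨ τ p = q) y := Quot.sound (Or.inr hy.symm)
        have hp' : ∀ p, Quot.mk (fun p q => σ p = q ∨ τ p = q) p =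
          Quot.mk (fun p q => σ p = q ∨ τ p = q) (τ p) := fun p => Quot.sound (Or.inr rfl)
        rintro p q ((h | h) | ⟨rfl, rfl⟩)
        · exact Quot.sound (Or.inl h)
        · rw [hp', ← h, hτ', mul_apply]
          by_cases e1 : τ p = x
          · rw [e1, swap_apply_left, hxy]
          by_cases e2 : τ p = y
          · rw [e2, swap_apply_right, hxy]
          rw [swap_apply_of_ne_of_ne e1 e2]
        · exact hxy
    -- The transposition joins two orbits, or splits a cycle of `τ' * σ` inside one orbit, or merges
    -- two cycles inside one orbit. Only the last case raises the genus.
    by_cases h : Quot.mk (fun p q => σ p = q ∨ τ' p = q) x =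
        Quot.mk (fun p q => σ p = q ∨ τ' p = q) y
    · have c5 := card_quot_addPair_of_eq h
      change _ = orbitCount σ τ' at c5
      by_cases hs : (τ' * σ).SameCycle x y
      · have c6 := cycleCount_mul_swap_of_sameCycle hx.symm hs
        exact ⟨g, by omega⟩
      · have c6 := cycleCount_mul_swap_of_not hs
        exact ⟨g + 1, by omega⟩
    · have c5 := card_quot_addPair_of_ne h
      change _ = orbitCount σ τ' at c5
      have hs : ¬ (τ' * σ).SameCycle x y := by
        rw [← quot_mk_eq_iff_sameCycle]
        refine mt (fun e => ?_) h
        refine congrArg (Quot.lift (Quot.mk (fun p q => σ p = q ∨ τ' p = q)) ?_) e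
        rintro p _ rfl
        exact (Quot.sound (r := fun p q => σ p = q ∨ τ' p = q) (Or.inl rfl)).trans
          (Quot.sound (Or.inr rfl))
      have c6 := cycleCount_mul_swap_of_not hs
      exact ⟨g, by omega⟩

end Counting


/-! ### Parity and loops -/

/-- A fixed point free involution of the marked points that changes their parity. -/
structure ParityMatching (N : ℕ) where
  mate : Fin N → Fin N
  mate_mate : ∀ p, mate (mate p) = p
  even_mate : ∀ p, Even (mate p).1 ↔ ¬ Even p.1

/-- Arcs do not cross, so `a.mate` acts without fixed points on the open interval between `p` and
its mate, which therefore has even size. If the mate comes first, the interval is empty and the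
truncated difference is zero. -/
theorem Diagram.even_mate_sub {N : ℕ} (a : Diagram N) (p : Fin N) :
    Even ((a.mate p).1 - p.1 - 1) := by
  have h1 := Finset.sum_involution (s := Finset.Ioo p (a.mate p)) (f := fun _ => (1 : ZMod 2))
    (fun q _ => a.mate q) (fun _ _ => by decide) (fun q _ _ => a.mate_ne q)
    (fun q hq => by
      rw [Finset.mem_Ioo] at hq ⊢
      exact a.noncrossing p q hq.1 hq.2) (fun q _ => a.mate_mate q)
  rw [Finset.sum_const, nsmul_one, Fin.card_Ioo, ZMod.natCast_eq_zero_iff_even] at h1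
  exact h1

/-- The other end of an arc has the opposite parity, because arcs do not cross. -/
def Diagram.toParityMatching {N : ℕ} (a : Diagram N) : ParityMatching N where
  mate := a.mate
  mate_mate := a.mate_mate
  even_mate p := by
    rcases lt_or_gt_of_ne (a.mate_ne p) with h | h
    · have h1 := a.even_mate_sub (a.mate p)
      rw [a.mate_mate] at h1
      rw [Fin.lt_def] at h
      simp only [Nat.even_iff] at *; omega
    · have h1 := a.even_mate_sub p
      rw [Fin.lt_def] at h
      simp only [Nat.even_iff] at *; omega

/-- The marked points with even number in a given fibre. -/
abbrev EvenFiber {N : ℕ} {Z : Type*} (f : Fin N → Z) (z : Z) : Type :=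
  { p : Fin N // Even p.1 ∧ f p = z }

namespace ParityMatching

variable {N : ℕ} {Z : Type*} (u v w : ParityMatching N) (f : Fin N → Z)

/-- The composition of two matchings as a permutation of the points with even number. -/
def halfPerm (hu : ∀ p, f (u.mate p) = f p) (hv : ∀ p, f (v.mate p) = f p) (z : Z) :
    Equiv.Perm (EvenFiber f z) where
  toFun p := ⟨u.mate (v.mate p), by
    rw [u.even_mate, v.even_mate, not_not, hu, hv]; exact p.2⟩
  invFun p := ⟨v.mate (u.mate p), by
    rw [v.even_mate, u.even_mate, not_not, hv, hu]; exact p.2⟩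
  left_inv p := by simp [u.mate_mate, v.mate_mate]
  right_inv p := by simp [u.mate_mate, v.mate_mate]

variable {u v w f}

/-- The middle matching cancels. This turns stacking of surfaces into multiplication of
permutations, as `exists_genus` requires. -/
theorem halfPerm_mul (hu : ∀ p, f (u.mate p) = f p) (hv : ∀ p, f (v.mate p) = f p)
    (hw : ∀ p, f (w.mate p) = f p) (z : Z) :
    u.halfPerm v f hu hv z * v.halfPerm w f hv hw z = u.halfPerm w f hu hw z := by
  ext p
  simp [halfPerm, v.mate_mate]

/-- A loop runs alternately along arcs of `u` and of `v`, so its even points form one cycle of the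
half permutation. An odd point is represented by its `u`-mate, which is even and lies on the same
loop. -/
theorem card_loop (hu : ∀ p, f (u.mate p) = f p) (hv : ∀ p, f (v.mate p) = f p) (z : Z)
    (F : Quot (fun p q => q = u.mate p ∨ q = v.mate p) → Z) (hF : ∀ p, F (Quot.mk _ p) = f p) :
    Nat.card { l // F l = z } = cycleCount (u.halfPerm v f hu hv z) := by
  classical
  let g : Quot (fun x y => u.halfPerm v f hu hv z x = y) → { l // F l = z } :=
    Quot.lift (fun p => ⟨Quot.mk _ p.1, (hF _).trans p.2.2⟩) (by
      rintro p _ rfl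
      have h1 : Quot.mk (fun p q => q = u.mate p ∨ q = v.mate p) p.1 = Quot.mk _ (v.mate p.1) :=
        Quot.sound (Or.inr rfl)
      exact Subtype.ext (h1.trans (Quot.sound (Or.inl rfl))))
  let h : Fin N → Option (Quot (fun x y => u.halfPerm v f hu hv z x = y)) := fun p =>
    if hz : f p = z then
      if hp : Even p.1 then some (Quot.mk _ ⟨p, hp, hz⟩)
      else some (Quot.mk _ ⟨u.mate p, by rw [u.even_mate, hu]; exact ⟨hp, hz⟩⟩)
    else none
  have hmem : ∀ p, h p = h (u.mate p) := by
    intro p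
    simp only [h, hu, u.even_mate]
    by_cases hz : f p = z
    · by_cases hp : Even p.1 <;> simp [hz, hp, u.mate_mate]
    · simp [hz]
  have hodd : ∀ p, Even p.1 → h p = h (v.mate p) := by
    intro p hp
    simp only [h, hv, v.even_mate]
    by_cases hz : f p = z
    · simp only [hz, hp, dite_true, not_true_eq_false, dite_false]
      exact congrArg some (Quot.sound rfl)
    · simp [hz]
  have hmem' : ∀ p, h p = h (v.mate p) := by
    intro p
    by_cases hp : Even p.1
    · exact hodd p hp
    · have := hodd (v.mate p) (by rw [v.even_mate]; exact hp)
      rw [this, v.mate_mate]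
  let H : Quot (fun p q => q = u.mate p ∨ q = v.mate p) →
      Option (Quot (fun x y => u.halfPerm v f hu hv z x = y)) := Quot.lift h (by
    rintro p _ (rfl | rfl)
    · exact hmem p
    · exact hmem' p)
  have hHg : ∀ x, H (g x).1 = some x := by
    rintro ⟨p⟩
    simp only [H, g, h, p.2, dite_true]
  refine (Nat.card_eq_of_bijective g ⟨fun x y hxy => ?_, ?_⟩).symm
  · have := hHg x
    rw [hxy, hHg] at this
    exact (Option.some_injective _ this).symm
  · rintro ⟨⟨p⟩, hp⟩
    have hp' : f p = z := (hF p).symm.trans hp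
    by_cases he : Even p.1
    · exact ⟨Quot.mk _ ⟨p, he, hp'⟩, rfl⟩
    · exact ⟨Quot.mk _ ⟨u.mate p, by rw [u.even_mate, hu]; exact ⟨he, hp'⟩⟩,
        Subtype.ext (Quot.sound (r := fun p q => q = u.mate p ∨ q = v.mate p) (Or.inl rfl)).symm⟩

/-- Each arc has exactly one even end. -/
theorem ncard_arcs (hu : ∀ p, f (u.mate p) = f p) (z : Z) :
    {p | f p = z ∧ p < u.mate p}.ncard = Nat.card (EvenFiber f z) := by
  classical
  rw [← Nat.card_coe_set_eq]
  have hne : ∀ p, u.mate p ≠ p := fun p h => by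
    have := u.even_mate p
    rw [h] at this
    tauto
  refine (Nat.card_eq_of_bijective (fun p : EvenFiber f z =>
    (⟨if p.1 < u.mate p.1 then p.1 else u.mate p.1, ?_⟩ :
      {p | f p = z ∧ p < u.mate p})) ⟨?_, ?_⟩).symm
  · have := p.2.2
    have := hne p.1
    split_ifs with h
    · exact ⟨p.2.2, h⟩
    · refine ⟨(hu _).trans p.2.2, ?_⟩
      rw [u.mate_mate]
      exact lt_of_le_of_ne (not_lt.mp h) (hne _)
  · intro p q hpq
    have h1 := congrArg Subtype.val hpq
    apply Subtype.ext
    have h2 := u.even_mate p.1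
    have h3 := u.even_mate q.1
    have h4 := p.2.1
    have h5 := q.2.1
    simp only at h1
    split_ifs at h1 with h6 h7 h7
    · exact h1
    · rw [← h1] at h3; tauto
    · rw [h1] at h2; tauto
    · rw [← u.mate_mate p.1, h1, u.mate_mate]
  · rintro ⟨p, hp, hlt⟩
    by_cases he : Even p.1
    · exact ⟨⟨p, he, hp⟩, Subtype.ext (if_pos hlt)⟩
    · refine ⟨⟨u.mate p, by rw [u.even_mate, hu]; exact ⟨he, hp⟩⟩, Subtype.ext ?_⟩
      simp only [u.mate_mate]
      exact if_neg (not_lt.mpr hlt.le)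

/-- The matching obtained by joining `e` and `o`, and joining their former mates. -/
def reconnect (u : ParityMatching N) (e o : Fin N) (he : Even e.1) (ho : ¬ Even o.1) :
    ParityMatching N where
  mate x := if x = e then o else if x = o then e else if u.mate x = e then u.mate o
    else if u.mate x = o then u.mate e else u.mate x
  mate_mate x := by
    have := u.mate_mate
    have hne : ∀ p, u.mate p ≠ p := fun p h => by
      have := u.even_mate p
      rw [h] at this
      tauto
    have heo : e ≠ o := by rintro rfl; exact ho he
    grind
  even_mate x := by
    have := u.even_mate
    have := u.mate_mate
    grind

theorem apply_reconnect {e o : Fin N} (he : Even e.1) (ho : ¬ Even o.1)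
    (hu : ∀ p, f (u.mate p) = f p) (h : f e = f o) (p : Fin N) :
    f ((u.reconnect e o he ho).mate p) = f p := by
  have := u.mate_mate
  simp only [reconnect]
  grind

end ParityMatching


/-! ### The loops of a capped diagram -/

section Counting

open Equiv Equiv.Perm

variable {E E' : Type*} {σ : Perm E} {σ' : Perm E'}

theorem cycleCount_congr (i : E' → E) (hi : Function.Bijective i)
    (h : ∀ j, i (σ' j) = σ (i j)) : cycleCount σ' = cycleCount σ :=
  Nat.card_congr (Quot.congr (Equiv.ofBijective i hi) (fun x y => by
    simp [← h, hi.1.eq_iff]))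

theorem cycleCount_eq_add_one [Finite E] (i : E' → E) (hi : Function.Injective i)
    (h : ∀ j, i (σ' j) = σ (i j)) {e : E} (he : σ e = e) (hr : ∀ x, x ≠ e → x ∈ Set.range i)
    (hne : ∀ j, i j ≠ e) : cycleCount σ = cycleCount σ' + 1 := by
  classical
  have : Finite E' := Finite.of_injective i hi
  have hre : ¬ ∃ j, i j = e := fun ⟨j, hj⟩ => hne j hj
  let g : Option (Quot fun x y => σ' x = y) → Quot fun x y => σ x = y := fun x =>
    Option.elim x (Quot.mk _ e) (Quot.map i (fun x y hxy => by rw [← h, hxy]))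
  let k : E → Option (Quot fun x y => σ' x = y) :=
    Function.extend i (fun j => some (Quot.mk _ j)) (fun _ => none)
  have hk : ∀ j, k (i j) = some (Quot.mk _ j) := fun j => hi.extend_apply _ _ j
  let K : (Quot fun x y => σ x = y) → Option (Quot fun x y => σ' x = y) :=
    Quot.lift k (by
      rintro x _ rfl
      by_cases hx : x = e
      · rw [hx, he]
      · obtain ⟨j, rfl⟩ := hr x hx
        rw [← h, hk, hk]
        exact congrArg some (Quot.sound rfl))
  have hKg : ∀ x, K (g x) = x := by
    rintro (_ | j)
    · exact Function.extend_apply' _ _ _ hre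
    · rcases j with ⟨j⟩
      exact hk j
  have hg : Function.Bijective g := by
    refine ⟨Function.LeftInverse.injective hKg, ?_⟩
    rintro ⟨x⟩
    by_cases hx : x = e
    · exact ⟨none, by rw [hx]; rfl⟩
    · obtain ⟨j, rfl⟩ := hr x hx
      exact ⟨some (Quot.mk _ j), rfl⟩
  rw [cycleCount, ← Nat.card_eq_of_bijective g hg, Finite.card_option, cycleCount]

end Counting

/-! ### Parity of the two points of a slot. -/

namespace Slot

variable {N M : ℕ} (s : Slot N M)

/-- The one of the two points of the slot that has an even number. -/
def evenEnd : Fin N := if Even s.pos then s.left else s.right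

/-- The one of the two points of the slot that has an odd number. -/
def oddEnd : Fin N := if Even s.pos then s.right else s.left

theorem even_evenEnd : Even s.evenEnd.1 := by
  unfold evenEnd
  split_ifs with h
  · exact h
  · exact (Nat.even_add_one).mpr h

theorem not_even_oddEnd : ¬ Even s.oddEnd.1 := by
  unfold oddEnd
  split_ifs with h
  · exact fun h' => (Nat.even_add_one).mp h' h
  · exact h

theorem ends_eq : (s.evenEnd = s.left ∧ s.oddEnd = s.right) ∨
    (s.evenEnd = s.right ∧ s.oddEnd = s.left) := by
  unfold evenEnd oddEnd
  split_ifs <;> simp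

theorem even_skip (j : Fin M) : Even (s.skip j).1 ↔ Even j.1 := by
  simp only [skip]
  split_ifs
  · rfl
  · simp [Nat.even_add]

theorem exists_skip {x : Fin N} (he : x ≠ s.evenEnd) (ho : x ≠ s.oddEnd) :
    ∃ j, s.skip j = x := by
  rcases s.ends_eq with ⟨h1, h2⟩ | ⟨h1, h2⟩ <;> rw [h1] at he <;> rw [h2] at ho
  · exact ⟨_, s.skip_unskip x he ho⟩
  · exact ⟨_, s.skip_unskip x ho he⟩

theorem skip_ne_evenEnd (j : Fin M) : s.skip j ≠ s.evenEnd := by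
  unfold evenEnd
  split_ifs
  · exact s.skip_ne_left j
  · exact s.skip_ne_right j

theorem skip_ne_oddEnd (j : Fin M) : s.skip j ≠ s.oddEnd := by
  unfold oddEnd
  split_ifs
  · exact s.skip_ne_right j
  · exact s.skip_ne_left j

theorem mate_evenEnd_iff (a : Diagram N) :
    a.mate s.evenEnd = s.oddEnd ↔ a.mate s.left = s.right := by
  have := a.mate_mate
  rcases s.ends_eq with ⟨h1, h2⟩ | ⟨h1, h2⟩ <;> rw [h1, h2]
  grind

theorem apply_evenEnd {Z : Type*} {f : Fin N → Z} (h : f s.left = f s.right) :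
    f s.evenEnd = f s.left ∧ f s.oddEnd = f s.left := by
  rcases s.ends_eq with ⟨h1, h2⟩ | ⟨h1, h2⟩ <;> rw [h1, h2] <;> simp [h]

end Slot

namespace ParityMatching

variable {N M : ℕ} {Z : Type*} (s : Slot N M) (u v : ParityMatching N) (u' v' : ParityMatching M)
  (f : Fin N → Z)

/-- Join the two points of a slot, and join their former mates. -/
def join : ParityMatching N := u.reconnect s.evenEnd s.oddEnd s.even_evenEnd s.not_even_oddEnd

theorem join_mate_evenEnd : (u.join s).mate s.evenEnd = s.oddEnd := by
  simp [join, reconnect]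

/-- Capping is carried out in two stages: join the two points of the slot while keeping all marked
points, then forget the slot. The first stage only multiplies permutations, and the second deletes a
fixed point. -/
theorem skip_cap_mate_eq_join (a : Diagram N) (j : Fin M) :
    s.skip ((a.cap s).mate j) = (a.toParityMatching.join s).mate (s.skip j) := by
  rw [Diagram.skip_cap_mate]
  have h1 := s.skip_ne_evenEnd j
  have h2 := s.skip_ne_oddEnd j
  have h3 := s.left_ne_right
  have := a.mate_mate
  simp only [join, reconnect, Slot.joinMate, h1, h2, if_false, Diagram.toParityMatching]
  rcases s.ends_eq with ⟨e1, e2⟩ | ⟨e1, e2⟩ <;> rw [e1, e2] <;> grind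

variable {s u v u' v' f}

theorem apply_join (hu : ∀ p, f (u.mate p) = f p) (h : f s.left = f s.right) (p : Fin N) :
    f ((u.join s).mate p) = f p :=
  apply_reconnect _ _ hu (by rw [(s.apply_evenEnd h).1, (s.apply_evenEnd h).2]) p

theorem skip_mem_evenFiber {z : Z} (j : EvenFiber (fun j => f (s.skip j)) z) :
    Even (s.skip j.1).1 ∧ f (s.skip j.1) = z := ⟨(s.even_skip _).mpr j.2.1, j.2.2⟩

theorem exists_skip_of_ne {z : Z} (x : EvenFiber f z) (hx : x.1 ≠ s.evenEnd) :
    ∃ j : EvenFiber (fun j => f (s.skip j)) z, s.skip j.1 = x.1 := by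
  obtain ⟨j, hj⟩ := s.exists_skip hx (fun h => s.not_even_oddEnd (by rw [← h]; exact x.2.1))
  exact ⟨⟨j, by rw [← s.even_skip, hj]; exact x.2.1, (congrArg f hj).trans x.2.2⟩, hj⟩

theorem bijective_skip {z : Z} (hz : f s.evenEnd ≠ z) : Function.Bijective
    (fun j : EvenFiber (fun j => f (s.skip j)) z =>
      (⟨s.skip j.1, skip_mem_evenFiber j⟩ : EvenFiber f z)) := by
  refine ⟨fun i j hij => Subtype.ext (s.skip_injective (congrArg Subtype.val hij)), fun x => ?_⟩
  obtain ⟨j, hj⟩ := exists_skip_of_ne x (fun e => hz (by rw [← e]; exact x.2.2))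
  exact ⟨j, Subtype.ext hj⟩

theorem card_evenFiber_skip (z : Z) [Decidable (f s.evenEnd = z)] :
    Nat.card (EvenFiber f z) = Nat.card (EvenFiber (fun j => f (s.skip j)) z) +
      if f s.evenEnd = z then 1 else 0 := by
  classical
  split_ifs with hz
  · rw [← Finite.card_option]
    let e : EvenFiber f z := ⟨s.evenEnd, s.even_evenEnd, hz⟩
    refine (Nat.card_eq_of_bijective (fun x : Option (EvenFiber (fun j => f (s.skip j)) z) =>
      (Option.elim x e (fun j => ⟨s.skip j.1, skip_mem_evenFiber j⟩) : EvenFiber f z))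
      ⟨?_, fun x => ?_⟩).symm
    · rintro (_ | i) (_ | j) hij
      · rfl
      · exact absurd (congrArg Subtype.val hij).symm (s.skip_ne_evenEnd _)
      · exact absurd (congrArg Subtype.val hij) (s.skip_ne_evenEnd _)
      · exact congrArg some (Subtype.ext (s.skip_injective (congrArg Subtype.val hij)))
    · by_cases hx : x.1 = s.evenEnd
      · exact ⟨none, Subtype.ext hx.symm⟩
      · obtain ⟨j, hj⟩ := exists_skip_of_ne x hx
        exact ⟨some j, Subtype.ext hj⟩
  · exact (Nat.card_eq_of_bijective _ (bijective_skip hz)).symm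

/-- Both matchings join the two points of the slot, so its even point is fixed by the half
permutation. Deleting it removes one cycle from its own fibre and none from the others. -/
theorem cycleCount_halfPerm_skip (hu : ∀ p, f (u.mate p) = f p) (hv : ∀ p, f (v.mate p) = f p)
    (hu' : ∀ j, s.skip (u'.mate j) = u.mate (s.skip j))
    (hv' : ∀ j, s.skip (v'.mate j) = v.mate (s.skip j))
    (hue : u.mate s.evenEnd = s.oddEnd) (hve : v.mate s.evenEnd = s.oddEnd)
    (z : Z) [Decidable (f s.evenEnd = z)] :
    cycleCount (u.halfPerm v f hu hv z) =
      cycleCount (u'.halfPerm v' (fun j => f (s.skip j)) (fun j => by rw [hu', hu])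
        (fun j => by rw [hv', hv]) z) + if f s.evenEnd = z then 1 else 0 := by
  have hc : ∀ j : EvenFiber (fun j => f (s.skip j)) z,
      s.skip (u'.mate (v'.mate j.1)) = u.mate (v.mate (s.skip j.1)) := fun j => by rw [hu', hv']
  split_ifs with hz
  · refine cycleCount_eq_add_one (e := ⟨s.evenEnd, s.even_evenEnd, hz⟩)
      (fun j => (⟨s.skip j.1, skip_mem_evenFiber j⟩ : EvenFiber f z))
      (fun i j hij => Subtype.ext (s.skip_injective (congrArg Subtype.val hij)))
      (fun j => Subtype.ext (hc j)) ?_ ?_ (fun j h => s.skip_ne_evenEnd _ (congrArg Subtype.val h))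
    · apply Subtype.ext
      simp only [halfPerm, Equiv.coe_fn_mk]
      rw [hve, ← hue, u.mate_mate]
    · intro x hx
      obtain ⟨j, hj⟩ := exists_skip_of_ne x (fun e => hx (Subtype.ext e))
      exact ⟨j, Subtype.ext hj⟩
  · exact (cycleCount_congr _ (bijective_skip hz) (fun j => Subtype.ext (hc j))).symm

theorem halfPerm_join_of_ne (hu : ∀ p, f (u.mate p) = f p) (hv : ∀ p, f (v.mate p) = f p)
    (h : f s.left = f s.right) {z : Z} (hz : f s.evenEnd ≠ z) :
    (u.join s).halfPerm (v.join s) f (apply_join hu h) (apply_join hv h) z =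
      u.halfPerm v f hu hv z := by
  have ho : f s.oddEnd = f s.evenEnd := by rw [(s.apply_evenEnd h).1, (s.apply_evenEnd h).2]
  ext x
  have hx := x.2.2
  have hu1 := u.mate_mate
  have hv1 := v.mate_mate
  simp only [halfPerm, Equiv.coe_fn_mk, join, reconnect]
  grind

open Equiv Equiv.Perm in
theorem join_mate_of_even {p : Fin N} (hp : Even p.1) :
    (v.join s).mate p = v.mate (swap s.evenEnd (v.mate s.oddEnd) p) := by
  have hv1 := v.mate_mate
  have hv2 := v.even_mate p
  have he' := s.even_evenEnd
  have ho' := s.not_even_oddEnd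
  simp only [join, reconnect, swap_apply_def]
  grind

open Equiv Equiv.Perm in
theorem join_mate_of_odd {q : Fin N} (hq : ¬ Even q.1) :
    (u.join s).mate q = swap s.evenEnd (u.mate s.oddEnd) (u.mate q) := by
  have hu1 := u.mate_mate
  have hu2 := u.even_mate q
  have he' := s.even_evenEnd
  have ho' := s.not_even_oddEnd
  simp only [join, reconnect, swap_apply_def]
  grind

-- On even points, `v.join s` is `v` preceded by the swap of the even end with the mate of the odd
-- end; on odd points, `u.join s` is `u` followed by such a swap. So joining multiplies the half
-- permutation by a transposition on each side.
open Equiv Equiv.Perm in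
theorem halfPerm_join (hu : ∀ p, f (u.mate p) = f p) (hv : ∀ p, f (v.mate p) = f p)
    (h : f s.left = f s.right) {z : Z} (e x y : EvenFiber f z)
    (he : e.1 = s.evenEnd) (hx : x.1 = u.mate s.oddEnd) (hy : y.1 = v.mate s.oddEnd) :
    (u.join s).halfPerm (v.join s) f (apply_join hu h) (apply_join hv h) z =
      swap e x * u.halfPerm v f hu hv z * swap e y := by
  ext p
  have h1 : ¬ Even ((v.join s).mate p.1).1 := by rw [(v.join s).even_mate, not_not]; exact p.2.1
  have h2 : ∀ x y z : EvenFiber f z, (swap x y z).1 = swap x.1 y.1 z.1 := fun x y z =>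
    (Subtype.val_injective.swap_apply x y z).symm
  simp only [mul_apply, h2, he, hx, hy, halfPerm, Equiv.coe_fn_mk]
  rw [join_mate_of_odd h1, join_mate_of_even p.2.1]

open Equiv Equiv.Perm in
/-- Joining two points either splits a loop or merges two loops.  An arc between these two points
counts as another loop, because it becomes a circle. -/
theorem cycleCount_join (hu : ∀ p, f (u.mate p) = f p) (hv : ∀ p, f (v.mate p) = f p)
    (h : f s.left = f s.right) {z : Z} (hz : f s.evenEnd = z)
    (c : ℕ) (hc : c = cycleCount ((u.join s).halfPerm (v.join s) f (apply_join hu h)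
      (apply_join hv h) z) + (if u.mate s.evenEnd = s.oddEnd then 1 else 0) +
      (if v.mate s.evenEnd = s.oddEnd then 1 else 0)) :
    (c = cycleCount (u.halfPerm v f hu hv z) + 2 ∧
      ∀ (Y : Type) (g : Fin N → Y), (∀ p, g (u.mate p) = g p) → (∀ p, g (v.mate p) = g p) →
        g s.evenEnd = g s.oddEnd) ∨
      (c = cycleCount (u.halfPerm v f hu hv z) ∧ u.mate s.evenEnd ≠ s.oddEnd) := by
  classical
  have ho : f s.oddEnd = z := by rw [← hz, (s.apply_evenEnd h).1, (s.apply_evenEnd h).2]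
  obtain ⟨e, he⟩ : ∃ e : EvenFiber f z, e.1 = s.evenEnd := ⟨⟨_, s.even_evenEnd, hz⟩, rfl⟩
  obtain ⟨x, hx⟩ : ∃ x : EvenFiber f z, x.1 = u.mate s.oddEnd :=
    ⟨⟨_, (u.even_mate _).mpr s.not_even_oddEnd, (hu _).trans ho⟩, rfl⟩
  obtain ⟨y, hy⟩ : ∃ y : EvenFiber f z, y.1 = v.mate s.oddEnd :=
    ⟨⟨_, (v.even_mate _).mpr s.not_even_oddEnd, (hv _).trans ho⟩, rfl⟩
  rw [halfPerm_join hu hv h e x y he hx hy] at hc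
  obtain ⟨π, hπ⟩ : ∃ π, π = u.halfPerm v f hu hv z := ⟨_, rfl⟩
  rw [← hπ] at hc ⊢
  have hxe : x = e ↔ u.mate s.evenEnd = s.oddEnd := by
    rw [Subtype.ext_iff, hx, he]
    exact ⟨fun h => by rw [← h, u.mate_mate], fun h => by rw [← h, u.mate_mate]⟩
  have hye : y = e ↔ v.mate s.evenEnd = s.oddEnd := by
    rw [Subtype.ext_iff, hy, he]
    exact ⟨fun h => by rw [← h, v.mate_mate], fun h => by rw [← h, v.mate_mate]⟩
  have hπy : π y = x := by
    apply Subtype.ext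
    rw [hπ, hx]
    simp only [halfPerm, Equiv.coe_fn_mk]
    rw [hy, v.mate_mate]
  -- Since `π y = x`, the product `π * swap e y` sends `e` to `x`. The second transposition is
  -- therefore either trivial or splits a cycle; in the trivial case the arc between the ends
  -- supplies the missing one.
  have h1 : cycleCount (swap e x * π * swap e y) + (if x = e then 1 else 0) =
      cycleCount (π * swap e y) + 1 := by
    split_ifs with h
    · rw [h, swap_self]
      rfl
    · rw [mul_assoc, cycleCount_mul_comm, cycleCount_mul_swap_of_sameCycle (Ne.symm h)]
      exact ⟨1, by rw [zpow_one, mul_apply, swap_apply_left, hπy]⟩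
  -- The first transposition can split or merge. If it is trivial or splits, then `e` and `y` lie on
  -- one loop, and anything constant along loops agrees at both ends of the slot.
  have h2 : cycleCount (π * swap e y) + (if y = e then 1 else 0) = cycleCount π + 1 ∧
      (∀ (Y : Type) (g : Fin N → Y), (∀ p, g (u.mate p) = g p) → (∀ p, g (v.mate p) = g p) →
        g s.evenEnd = g s.oddEnd) ∨
      cycleCount (π * swap e y) + (if y = e then 1 else 0) + 1 = cycleCount π ∧ x ≠ e := by
    by_cases hy' : y = e
    · left
      rw [if_pos hy', hy', swap_self]
      refine ⟨rfl, fun Y g _ hg => ?_⟩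
      rw [← hye.mp hy', hg]
    · rw [if_neg hy', add_zero]
      by_cases hs : π.SameCycle e y
      · refine Or.inl ⟨cycleCount_mul_swap_of_sameCycle (Ne.symm hy') hs, fun Y g hgu hgv => ?_⟩
        have := congrArg (Quot.lift (fun p : EvenFiber f z => g p.1) (by
          rintro p _ rfl
          rw [hπ]
          simp only [halfPerm, Equiv.coe_fn_mk]
          rw [hgu, hgv])) (quot_mk_eq_iff_sameCycle.mpr hs)
        simp only [he, hy] at this
        rw [this, hgv]
      · refine Or.inr ⟨cycleCount_mul_swap_of_not hs, fun hxe => hs (SameCycle.symm ⟨1, ?_⟩)⟩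
        rw [zpow_one, hπy, hxe]
  simp only [ne_eq, hxe] at h1 h2
  simp only [hye] at h2
  rcases h2 with ⟨h2, h3⟩ | ⟨h2, h3⟩
  · exact Or.inl ⟨by omega, h3⟩
  · exact Or.inr ⟨by omega, h3⟩

end ParityMatching


/-! ### The genus of the components of a cobordism -/

theorem card_fiber_eq_sum {A X Z : Type*} [Finite A] [Finite X] (l : A → X) (q : X → Z) (z : Z)
    [Fintype { x // q x = z }] :
    Nat.card { a // q (l a) = z } = ∑ x : { x // q x = z }, Nat.card { a // l a = x.1 } := by
  rw [← Nat.card_sigma]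
  exact Nat.card_congr
    { toFun := fun a => ⟨⟨l a.1, a.2⟩, ⟨a.1, rfl⟩⟩
      invFun := fun y => ⟨y.2.1, by rw [y.2.2]; exact y.1.2⟩
      left_inv := fun a => rfl
      right_inv := by
        rintro ⟨⟨x, hx⟩, ⟨a, ha⟩⟩
        change l a = x at ha
        subst ha
        rfl }

theorem card_evenFiber {N : ℕ} {Z : Type*} (f : Fin N → Z) (z : Z) : Nat.card (EvenFiber f z) =
    Nat.card { p : { p : Fin N // Even p.1 } // f p.1 = z } :=
  Nat.card_congr (Equiv.subtypeSubtypeEquivSubtypeInter _ (fun p => f p = z)).symm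

theorem mapDomain_apply_eq_sum {X Z R : Type*} [AddCommMonoid R] (q : X → Z) (e : X →₀ R) (z : Z)
    [Fintype { x // q x = z }] : e.mapDomain q z = ∑ x : { x // q x = z }, e x.1 := by
  classical
  induction e using Finsupp.induction_linear with
  | zero => simp
  | add e e' h h' => simp [Finsupp.mapDomain_add, h, h', Finset.sum_add_distrib]
  | single x c =>
    rw [Finsupp.mapDomain_single, Finsupp.single_apply]
    split_ifs with h
    · rw [Finset.sum_eq_single ⟨x, h⟩]
      · simp
      · intro y _ hy
        exact Finsupp.single_eq_of_ne fun e => hy (Subtype.ext e)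
      · simp
    · refine (Finset.sum_eq_zero fun y _ => Finsupp.single_eq_of_ne fun e => h ?_).symm
      rw [← e]; exact y.2

namespace Surface

variable {N M : ℕ} {a b c : Diagram N}

/-- Each component is a compact connected oriented surface. -/
def HasGenus (S : Surface a b) : Prop :=
  ∀ x : S.Comp, ∃ g : ℕ, S.euler x + S.arcCount x = 2 - 2 * (g : ℤ) - S.boundaryCount x

theorem arcCount_eq (S : Surface a b) (x : S.Comp) : S.arcCount x = Nat.card (EvenFiber S.pt x) :=
  ParityMatching.ncard_arcs (u := a.toParityMatching) S.pt_source x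

instance : Finite (Loop a b) := inferInstanceAs (Finite (Quot _))

theorem boundaryCount_eq (S : Surface a b) (x : S.Comp) :
    S.boundaryCount x = Nat.card { l // S.loop l = x } + Nat.card { i // S.source i = x } +
      Nat.card { i // S.target i = x } := rfl

theorem card_loop_fiber (S : Surface a b) {Z : Type*} (q : S.Comp → Z) (z : Z)
    (f : Fin N → Z) (hf : ∀ p, f p = q (S.pt p))
    (hu : ∀ p, f (a.toParityMatching.mate p) = f p)
    (hv : ∀ p, f (b.toParityMatching.mate p) = f p) :
    Nat.card { l // q (S.loop l) = z } =
      cycleCount (a.toParityMatching.halfPerm b.toParityMatching f hu hv z) :=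
  ParityMatching.card_loop hu hv z (fun l => q (S.loop l)) fun p => (hf p).symm

/-- The genus formulas of all components in one fibre of `q`, added up. With `q` the map to the
components of a glued surface, this is the balance before the boundary circles are glued. -/
theorem HasGenus.exists_fiber {S : Surface a b} (hS : S.HasGenus) {Z : Type*} (q : S.Comp → Z)
    (z : Z) (f : Fin N → Z) (hf : ∀ p, f p = q (S.pt p))
    (hu : ∀ p, f (a.toParityMatching.mate p) = f p)
    (hv : ∀ p, f (b.toParityMatching.mate p) = f p) : ∃ g : ℕ,
    S.euler.mapDomain q z + Nat.card (EvenFiber f z) = 2 * Nat.card { x // q x = z } - 2 * g -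
      (cycleCount (a.toParityMatching.halfPerm b.toParityMatching f hu hv z) +
        Nat.card { i // q (S.source i) = z } + Nat.card { i // q (S.target i) = z }) := by
  classical
  have := S.finite_comp
  have := Fintype.ofFinite { x // q x = z }
  choose g hg using hS
  refine ⟨∑ x : { x // q x = z }, g x.1, ?_⟩
  have h1 : Nat.card (EvenFiber f z) = ∑ x : { x // q x = z }, Nat.card (EvenFiber S.pt x.1) := by
    have h := card_fiber_eq_sum (fun p : { p : Fin N // Even p.1 } => S.pt p.1) q z
    have hf' : f = fun p => q (S.pt p) := funext hf
    rw [card_evenFiber, hf', h]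
    exact Finset.sum_congr rfl fun x _ => (card_evenFiber _ _).symm
  rw [mapDomain_apply_eq_sum, h1, ← S.card_loop_fiber q z f hf hu hv,
    card_fiber_eq_sum S.loop, card_fiber_eq_sum S.source, card_fiber_eq_sum S.target]
  have h2 : (2 * Nat.card { x // q x = z } : ℤ) = ∑ x : { x // q x = z }, 2 := by
    rw [Finset.sum_const, Finset.card_univ, Nat.card_eq_fintype_card]; simp [mul_comm]
  rw [h2]
  push_cast
  rw [Finset.mul_sum, ← Finset.sum_add_distrib, ← Finset.sum_add_distrib, ← Finset.sum_add_distrib,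
    ← Finset.sum_sub_distrib, ← Finset.sum_sub_distrib]
  refine Finset.sum_congr rfl fun x _ => ?_
  have := hg x.1
  rw [arcCount_eq, boundaryCount_eq] at this
  push_cast at this
  exact this

/-- The genus condition in terms of permutations: arcs become even marked points, and boundary loops
become cycles. -/
theorem hasGenus_iff (S : Surface a b) : S.HasGenus ↔ ∀ x, ∃ g : ℕ,
    S.euler x + Nat.card (EvenFiber S.pt x) = 2 - 2 * (g : ℤ) -
      (cycleCount (a.toParityMatching.halfPerm b.toParityMatching S.pt S.pt_source S.pt_target x) +
        Nat.card { i // S.source i = x } + Nat.card { i // S.target i = x }) := by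
  refine forall_congr' fun x => exists_congr fun g => ?_
  rw [arcCount_eq, boundaryCount_eq,
    ← S.card_loop_fiber id x S.pt (fun _ => rfl) S.pt_source S.pt_target]
  push_cast
  rfl

theorem arcRel_quot_eq {p q : Fin N} (h : Quot.mk a.ArcRel p = Quot.mk a.ArcRel q) :
    q = p ∨ q = a.mate p := by
  have := congrArg (Quot.lift (fun p => ({p, a.mate p} : Set (Fin N))) (by
    rintro p _ rfl
    simp only [a.mate_mate]
    exact Set.pair_comm _ _)) h
  have h2 : q ∈ ({p, a.mate p} : Set (Fin N)) := by
    simp only at this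
    rw [this]; exact Set.mem_insert _ _
  simpa using h2

-- The half permutation of a matching with itself is the identity: each arc and its copy bound one
-- loop.
open ParityMatching in
theorem cycleCount_halfPerm_self {Z : Type*} (u : ParityMatching N) (f : Fin N → Z)
    (hu hu' : ∀ p, f (u.mate p) = f p) (z : Z) :
    cycleCount (u.halfPerm u f hu hu' z) = Nat.card (EvenFiber f z) := by
  refine (Nat.card_eq_of_bijective (Quot.mk _) ⟨fun p q hpq => ?_, Quot.mk_surjective⟩).symm
  refine congrArg (Quot.lift id ?_) hpq
  rintro p _ rfl
  apply Subtype.ext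
  simp [ParityMatching.halfPerm, u.mate_mate]

/-- An arc times the interval is a disc, and a circle times the interval is an annulus, so the genus
is zero. -/
theorem hasGenus_cylinder (a : Diagram N) : (cylinder a).HasGenus := by
  rw [hasGenus_iff]
  intro x
  refine ⟨0, ?_⟩
  have h1 := cycleCount_halfPerm_self a.toParityMatching (cylinder a).pt (cylinder a).pt_source
    (cylinder a).pt_target x
  have h0 : (cylinder a).euler x = 0 := rfl
  rw [h1, h0]
  rcases x with x | i
  · obtain ⟨p, rfl⟩ := Quot.exists_rep x
    have h2 : IsEmpty { i // (cylinder a).source i = Sum.inl (Quot.mk _ p) } :=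
      ⟨fun i => by have := i.2; simp [cylinder] at this⟩
    have h3 : IsEmpty { i // (cylinder a).target i = Sum.inl (Quot.mk _ p) } :=
      ⟨fun i => by have := i.2; simp [cylinder] at this⟩
    have h4 : Nat.card (EvenFiber (cylinder a).pt (Sum.inl (Quot.mk _ p))) = 1 := by
      have hp : ∀ q, (cylinder a).pt q = Sum.inl (Quot.mk _ p) → q = p ∨ q = a.mate p :=
        fun q hq => arcRel_quot_eq (Sum.inl_injective hq).symm
      have hm := a.toParityMatching.even_mate p
      change Even (a.mate p).1 ↔ _ at hm
      rw [Nat.card_eq_one_iff_unique]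
      constructor
      · refine ⟨fun q r => Subtype.ext ?_⟩
        have h5 := q.2.1
        have h6 := r.2.1
        rcases hp _ q.2.2 with h | h <;> rcases hp _ r.2.2 with h' | h' <;> rw [h] at h5 ⊢ <;>
          rw [h'] at h6 ⊢ <;> tauto
      · by_cases he : Even p.1
        · exact ⟨⟨p, he, rfl⟩⟩
        · exact ⟨⟨a.mate p, hm.mpr he, (cylinder a).pt_source p⟩⟩
    rw [h4, Nat.card_of_isEmpty, Nat.card_of_isEmpty]
    norm_num
  · have h2 : IsEmpty (EvenFiber (cylinder a).pt (Sum.inr i)) :=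
      ⟨fun p => by have := p.2.2; simp [cylinder] at this⟩
    have h3 : Nat.card { j // (cylinder a).source j = Sum.inr i } = 1 := by
      rw [Nat.card_eq_one_iff_unique]
      exact ⟨⟨fun j k => Subtype.ext (Sum.inr_injective (j.2.trans k.2.symm))⟩, ⟨i, rfl⟩⟩
    have h4 : Nat.card { j // (cylinder a).target j = Sum.inr i } = 1 := h3
    rw [h3, h4, Nat.card_of_isEmpty]
    norm_num

-- The contributions to the genus of a glued component are the genera of the pieces above and below,
-- the genus of the gluing pattern along the middle arcs given by `exists_genus`, and the first
-- Betti number of the graph that records how the pieces are connected.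
open ParityMatching in
theorem HasGenus.comp {S : Surface a b} {T : Surface b c} (hS : S.HasGenus) (hT : T.HasGenus) :
    (S.comp T).HasGenus := by
  classical
  have := S.finite_comp
  have := T.finite_comp
  rw [hasGenus_iff]
  intro X
  let q₁ : S.Comp → (S.comp T).Comp := fun x => Quot.mk _ (Sum.inl x)
  let q₂ : T.Comp → (S.comp T).Comp := fun x => Quot.mk _ (Sum.inr x)
  have hpt : ∀ p, (S.comp T).pt p = q₂ (T.pt p) := S.comp_pt T
  have hb : ∀ p, (S.comp T).pt (b.toParityMatching.mate p) = (S.comp T).pt p := fun p => by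
    rw [hpt, hpt]; exact congrArg q₂ (T.pt_source p)
  have ha := (S.comp T).pt_source
  have hc := (S.comp T).pt_target
  obtain ⟨g₁, h₁⟩ := hS.exists_fiber q₁ X (S.comp T).pt (fun _ => rfl) ha hb
  obtain ⟨g₂, h₂⟩ := hT.exists_fiber q₂ X (S.comp T).pt hpt hb hc
  let σ := a.toParityMatching.halfPerm b.toParityMatching _ ha hb X
  let τ := b.toParityMatching.halfPerm c.toParityMatching _ hb hc X
  obtain ⟨g, hg⟩ := exists_genus σ τ
  have hst : σ * τ = a.toParityMatching.halfPerm c.toParityMatching _ ha hc X :=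
    halfPerm_mul ha hb hc X
  rw [hst] at hg
  have hcirc : ∀ i, q₁ (S.target i) = q₂ (T.source i) := fun i =>
    Quot.sound (Meets.circle (S := S) (T := T) i)
  have hcard : Nat.card { i // q₂ (T.source i) = X } = Nat.card { i // q₁ (S.target i) = X } :=
    Nat.card_congr (Equiv.subtypeEquivRight fun i => by rw [hcirc])
  -- the graph whose vertices are the components and the orbits of marked points
  let V := ({ x // q₁ x = X } ⊕ { y // q₂ y = X }) ⊕ Quot (fun x y => σ x = y ∨ τ x = y)
  let Edge := (Quot (fun x y => σ x = y) ⊕ Quot (fun x y => τ x = y)) ⊕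
    { i // q₁ (S.target i) = X }
  let s : Edge → V := Sum.elim (Sum.elim
    (Quot.lift (fun p => Sum.inl (Sum.inl ⟨S.pt p.1, p.2.2⟩)) (by
      rintro p _ rfl
      refine congrArg (fun x => Sum.inl (Sum.inl x)) (Subtype.ext ?_)
      exact ((S.pt_source _).trans (S.pt_target _)).symm))
    (Quot.lift (fun p => Sum.inl (Sum.inr ⟨T.pt p.1, (hpt _).symm.trans p.2.2⟩)) (by
      rintro p _ rfl
      refine congrArg (fun x => Sum.inl (Sum.inr x)) (Subtype.ext ?_)
      exact ((T.pt_source _).trans (T.pt_target _)).symm)))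
    (fun i => Sum.inl (Sum.inl ⟨S.target i.1, i.2⟩))
  let t : Edge → V := Sum.elim (Sum.elim
    (Quot.lift (fun p => Sum.inr (Quot.mk _ p)) (fun p q h =>
      congrArg Sum.inr (Quot.sound (Or.inl h))))
    (Quot.lift (fun p => Sum.inr (Quot.mk _ p)) (fun p q h =>
      congrArg Sum.inr (Quot.sound (Or.inr h)))))
    (fun i => Sum.inl (Sum.inr ⟨T.source i.1, (hcirc _).symm.trans i.2⟩))
  have hgraph := card_le_card_add_card_quot s t
  let R : V → V → Prop := fun p q => ∃ e, p = s e ∧ q = t e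
  have hR : ∀ e, Quot.mk R (s e) = Quot.mk R (t e) := fun e => Quot.sound ⟨e, rfl, rfl⟩
  have hlink₁ : ∀ p : EvenFiber (S.comp T).pt X,
      Quot.mk R (Sum.inl (Sum.inl ⟨S.pt p.1, p.2.2⟩)) = Quot.mk R (Sum.inr (Quot.mk _ p)) :=
    fun p => hR (Sum.inl (Sum.inl (Quot.mk _ p)))
  have hlink₂ : ∀ p : EvenFiber (S.comp T).pt X,
      Quot.mk R (Sum.inl (Sum.inr ⟨T.pt p.1, (hpt _).symm.trans p.2.2⟩)) =
        Quot.mk R (Sum.inr (Quot.mk _ p)) :=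
    fun p => hR (Sum.inl (Sum.inr (Quot.mk _ p)))
  -- The graph contains only even marked points; an odd point is replaced by its mate in the middle
  -- diagram, which lies on the same components.
  have hlink : ∀ (p : Fin N) (h1 : q₁ (S.pt p) = X) (h2 : q₂ (T.pt p) = X),
      Quot.mk R (Sum.inl (Sum.inl ⟨S.pt p, h1⟩)) = Quot.mk R (Sum.inl (Sum.inr ⟨T.pt p, h2⟩)) := by
    intro p h1 h2
    by_cases he : Even p.1
    · exact (hlink₁ ⟨p, he, h1⟩).trans (hlink₂ ⟨p, he, h1⟩).symm
    · have h3 : Even (b.mate p).1 := (b.toParityMatching.even_mate p).mpr he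
      have := (hlink₁ ⟨b.mate p, h3, (hb p).trans h1⟩).trans
        (hlink₂ ⟨b.mate p, h3, (hb p).trans h1⟩).symm
      simpa only [S.pt_target, T.pt_source] using this
  let k : S.Comp ⊕ T.Comp → Option (Quot R) := Sum.elim
    (fun x => if hx : q₁ x = X then some (Quot.mk _ (Sum.inl (Sum.inl ⟨x, hx⟩))) else none)
    (fun x => if hx : q₂ x = X then some (Quot.mk _ (Sum.inl (Sum.inr ⟨x, hx⟩))) else none)
  let K : (S.comp T).Comp → Option (Quot R) := Quot.lift k (by
    rintro _ _ (p | i)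
    · have : q₁ (S.pt p) = q₂ (T.pt p) := hpt p
      by_cases h : q₁ (S.pt p) = X
      · simp only [k, Sum.elim_inl, Sum.elim_inr, dif_pos h, dif_pos (this.symm.trans h)]
        exact congrArg some (hlink p _ _)
      · simp only [k, Sum.elim_inl, Sum.elim_inr, dif_neg h, dif_neg (this ▸ h)]
    · by_cases h : q₁ (S.target i) = X
      · simp only [k, Sum.elim_inl, Sum.elim_inr, dif_pos h, dif_pos ((hcirc i).symm.trans h)]
        exact congrArg some (hR (Sum.inr ⟨i, h⟩))
      · simp only [k, Sum.elim_inl, Sum.elim_inr, dif_neg h, dif_neg (hcirc i ▸ h)])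
  have hK : ∀ v : V, K X = some (Quot.mk R v) := by
    have h1 : ∀ x (hx : q₁ x = X), K X = some (Quot.mk R (Sum.inl (Sum.inl ⟨x, hx⟩))) := by
      rintro x rfl; exact dif_pos rfl
    rintro ((⟨x, hx⟩ | ⟨x, hx⟩) | p)
    · exact h1 x hx
    · have : ∀ (Y) (hY : X = Y) (hx : q₂ x = X), K Y = some (Quot.mk R (Sum.inl (Sum.inr ⟨x, hx⟩))) := by
        rintro Y rfl hx
        have e : K X = K (q₂ x) := by rw [hx]
        rw [e]
        exact dif_pos hx
      exact this X rfl hx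
    · rcases p with ⟨p⟩
      exact (h1 _ p.2.2).trans (congrArg some (hlink₁ p))
  -- The graph is connected because `X` is a single component: all its vertices lie in the class
  -- that `K` assigns to `X`.
  have hsub : Nat.card (Quot R) ≤ 1 := by
    rw [Finite.card_le_one_iff_subsingleton]
    refine ⟨?_⟩
    rintro ⟨v⟩ ⟨w⟩
    exact Option.some_injective _ ((hK v).symm.trans (hK w))
  have hV : Nat.card V = Nat.card { x // q₁ x = X } + Nat.card { y // q₂ y = X } +
      orbitCount σ τ := by
    rw [Nat.card_sum, Nat.card_sum]; rfl
  have hE : Nat.card Edge = cycleCount σ + cycleCount τ + Nat.card { i // q₁ (S.target i) = X } := by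
    rw [Nat.card_sum, Nat.card_sum]; rfl
  have he : (S.comp T).euler X = S.euler.mapDomain q₁ X + T.euler.mapDomain q₂ X := rfl
  change Nat.card V ≤ Nat.card Edge + Nat.card (Quot R) at hgraph
  rw [hV, hE] at hgraph
  -- `δ` is the first Betti number of this connected graph: edges minus vertices plus one.
  obtain ⟨δ, hδ⟩ : ∃ δ : ℕ, δ + (Nat.card { x // q₁ x = X } + Nat.card { y // q₂ y = X } +
      orbitCount σ τ) = cycleCount σ + cycleCount τ +
      Nat.card { i // q₁ (S.target i) = X } + 1 := ⟨_, Nat.sub_add_cancel (by omega)⟩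
  have hs : Nat.card { i // (S.comp T).source i = X } = Nat.card { i // q₁ (S.source i) = X } := rfl
  have ht : Nat.card { i // (S.comp T).target i = X } = Nat.card { i // q₂ (T.target i) = X } := rfl
  refine ⟨δ + g₁ + g₂ + g, ?_⟩
  rw [he, hs, ht]
  change _ = _ - ((cycleCount σ : ℤ) + _ + _) at h₁
  change _ = _ - ((cycleCount τ : ℤ) + _ + _) at h₂
  rw [hcard] at h₂
  push_cast
  omega

end Surface


/-! ### Genus under capping and bending. -/

open Classical in
theorem card_option_fiber {A Z : Type*} [Finite A] (F : Option A → Z) (z : Z) :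
    Nat.card { x // F x = z } = Nat.card { x // F (some x) = z } + if F none = z then 1 else 0 := by
  split_ifs with h
  · rw [← Finite.card_option]
    exact Nat.card_congr
      { toFun := fun x => match x with
          | ⟨none, _⟩ => none
          | ⟨some a, h⟩ => some ⟨a, h⟩
        invFun := fun x => match x with
          | none => ⟨none, h⟩
          | some a => ⟨some a.1, a.2⟩
        left_inv := by rintro ⟨_ | a, h⟩ <;> rfl
        right_inv := by rintro (_ | a) <;> rfl }
  · exact Nat.card_congr
      { toFun := fun x => match x with
          | ⟨none, h'⟩ => absurd h' h
          | ⟨some a, h⟩ => ⟨a, h⟩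
        invFun := fun a => ⟨some a.1, a.2⟩
        left_inv := by
          rintro ⟨_ | a, h'⟩
          · exact absurd h' h
          · rfl
        right_inv := fun a => rfl }

/-- Capping a diagram creates at most one circle. It is the last one, and it lies on the component
`z₀` of the slot. -/
theorem card_fin_fiber {Z : Type*} {m k : ℕ} {P : Prop} [Decidable P]
    (hk : k = m + if P then 1 else 0) (F : Fin k → Z) (g : Fin m → Z) (z₀ z : Z)
    (h1 : ∀ (i : Fin k) (h : i.1 < m), F i = g ⟨i.1, h⟩) (h2 : ∀ i : Fin k, ¬ i.1 < m → F i = z₀) :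
    (z₀ = z → Nat.card { i // F i = z } = Nat.card { i // g i = z } + if P then 1 else 0) ∧
      (z₀ ≠ z → Nat.card { i // F i = z } = Nat.card { i // g i = z }) := by
  classical
  by_cases hP : P
  · simp only [hP, if_true] at hk ⊢
    subst hk
    have e := card_option_fiber (fun x => F (finSuccEquivLast.symm x)) z
    have e1 : ∀ i, F (finSuccEquivLast.symm (some i)) = g i := fun i => by
      rw [finSuccEquivLast_symm_some]; exact h1 _ i.2
    have e2 : F (finSuccEquivLast.symm none) = z₀ := by
      rw [finSuccEquivLast_symm_none]; exact h2 _ (by simp)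
    simp only [e1, e2] at e
    have e3 : Nat.card { i // F i = z } =
        Nat.card { x // F (finSuccEquivLast.symm x) = z } :=
      Nat.card_congr (finSuccEquivLast.subtypeEquiv fun i => by simp)
    exact ⟨fun h => by rw [e3, e, if_pos h], fun h => by rw [e3, e, if_neg h, add_zero]⟩
  · simp only [hP, if_false, add_zero] at hk ⊢
    subst hk
    have : Nat.card { i // F i = z } = Nat.card { i // g i = z } :=
      Nat.card_congr (Equiv.subtypeEquivRight fun i => by rw [h1 i i.2])
    exact ⟨fun _ => this, fun _ => this⟩

namespace Surface

variable {N M : ℕ} {a b : Diagram N}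

theorem capRel_quot_eq {S : Surface a b} {s : Slot N M} {x y : S.Comp}
    (h : Quot.mk (S.CapRel s) x = Quot.mk (S.CapRel s) y) :
    x = y ∨ ((x = S.pt s.left ∨ x = S.pt s.right) ∧ (y = S.pt s.left ∨ y = S.pt s.right)) := by
  classical
  have := congrArg (Quot.lift (fun x => if x = S.pt s.right then S.pt s.left else x) (by
    rintro _ _ ⟨rfl, rfl⟩
    simp)) h
  simp only at this
  grind

/-- Gluing the strip can only merge the component of the left point with that of the right point. -/
theorem card_capRel_fiber (S : Surface a b) (s : Slot N M) (X : Quot (S.CapRel s)) :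
    Nat.card { x // Quot.mk (S.CapRel s) x = X } = 1 ∨
    (Nat.card { x // Quot.mk (S.CapRel s) x = X } = 2 ∧ S.pt s.left ≠ S.pt s.right ∧
      X = Quot.mk _ (S.pt s.left)) := by
  classical
  have := S.finite_comp
  obtain ⟨x, rfl⟩ := Quot.exists_rep X
  by_cases h : (x = S.pt s.left ∨ x = S.pt s.right) ∧ S.pt s.left ≠ S.pt s.right
  · right
    have hlr : Quot.mk (S.CapRel s) (S.pt s.left) = Quot.mk _ (S.pt s.right) :=
      Quot.sound ⟨rfl, rfl⟩
    have hx : Quot.mk (S.CapRel s) x = Quot.mk _ (S.pt s.left) := by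
      rcases h.1 with h | h <;> rw [h]
      exact hlr.symm
    refine ⟨?_, h.2, hx⟩
    rw [hx, ← Nat.card_coe_set_eq {S.pt s.left, S.pt s.right} |>.trans (Set.ncard_pair h.2)]
    refine Nat.card_congr (Equiv.subtypeEquivRight fun y => ?_)
    constructor
    · intro hy
      rcases capRel_quot_eq hy with h | h
      · exact Or.inl h
      · exact h.1
    · rintro (h | h) <;> rw [h]
      exact hlr.symm
  · left
    rw [Nat.card_eq_one_iff_unique]
    have key : ∀ y : { y // Quot.mk (S.CapRel s) y = Quot.mk (S.CapRel s) x }, y.1 = x := by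
      rintro ⟨y, hy⟩
      rcases capRel_quot_eq hy with h | h
      · exact h
      · grind
    exact ⟨⟨fun y z => Subtype.ext ((key y).trans (key z).symm)⟩, ⟨⟨x, rfl⟩⟩⟩

-- The strip is glued along two vertical segments. If it splits a boundary loop, the genus stays the
-- same. If it merges two loops, it either connects two components or raises the genus of one
-- component by one. Other components are unaffected.
open ParityMatching Classical in
theorem HasGenus.cap {S : Surface a b} (hS : S.HasGenus) (s : Slot N M) : (S.cap s).HasGenus := by
  rw [hasGenus_iff]
  intro (X : Quot (S.CapRel s))
  let q : S.Comp → Quot (S.CapRel s) := Quot.mk _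
  let f : Fin N → Quot (S.CapRel s) := fun p => q (S.pt p)
  have hu : ∀ p, f (a.toParityMatching.mate p) = f p := fun p => congrArg q (S.pt_source p)
  have hv : ∀ p, f (b.toParityMatching.mate p) = f p := fun p => congrArg q (S.pt_target p)
  have hlr : f s.left = f s.right := Quot.sound ⟨rfl, rfl⟩
  obtain ⟨g, hg⟩ := hS.exists_fiber q X f (fun _ => rfl) hu hv
  have hcyc := cycleCount_halfPerm_skip (s := s) (u' := (a.cap s).toParityMatching)
    (v' := (b.cap s).toParityMatching) (apply_join hu hlr) (apply_join hv hlr)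
    (skip_cap_mate_eq_join s a) (skip_cap_mate_eq_join s b) (join_mate_evenEnd s _)
    (join_mate_evenEnd s _) X
  have harc := card_evenFiber_skip (s := s) (f := f) X
  obtain ⟨sA, hsA⟩ : ∃ n, n = Nat.card { i // q (S.source i) = X } := ⟨_, rfl⟩
  obtain ⟨tB, htB⟩ : ∃ n, n = Nat.card { i // q (S.target i) = X } := ⟨_, rfl⟩
  obtain ⟨sA', hsA'⟩ : ∃ n, n = Nat.card { i // (S.cap s).source i = X } := ⟨_, rfl⟩
  obtain ⟨tB', htB'⟩ : ∃ n, n = Nat.card { i // (S.cap s).target i = X } := ⟨_, rfl⟩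
  have hsrc : (f s.left = X → sA' = sA + if a.mate s.left = s.right then 1 else 0) ∧
      (f s.left ≠ X → sA' = sA) := by
    rw [hsA, hsA']
    exact card_fin_fiber (k := (a.cap s).circles) rfl _ _ _ _ (S.cap_source_of_lt s)
      (S.cap_source_of_not_lt s)
  have htgt : (f s.left = X → tB' = tB + if b.mate s.left = s.right then 1 else 0) ∧
      (f s.left ≠ X → tB' = tB) := by
    rw [htB, htB']
    exact card_fin_fiber (k := (b.cap s).circles) rfl _ _ _ _ (S.cap_target_of_lt s)
      (S.cap_target_of_not_lt s)
  have he : (S.cap s).euler X = S.euler.mapDomain q X := rfl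
  have hel : f s.evenEnd = f s.left := (s.apply_evenEnd hlr).1
  obtain ⟨k', hk'⟩ : ∃ k', k' = Nat.card (EvenFiber (S.cap s).pt X) := ⟨_, rfl⟩
  obtain ⟨c', hc'⟩ : ∃ c', c' = cycleCount ((a.cap s).toParityMatching.halfPerm
    (b.cap s).toParityMatching (S.cap s).pt (S.cap s).pt_source (S.cap s).pt_target X) := ⟨_, rfl⟩
  rw [he, ← hk', ← hc', ← hsA', ← htB']
  rw [← hsA, ← htB] at hg
  change _ = Nat.card (EvenFiber (S.cap s).pt X) + _ at harc
  rw [← hk'] at harc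
  change _ = cycleCount ((a.cap s).toParityMatching.halfPerm
    (b.cap s).toParityMatching (S.cap s).pt (S.cap s).pt_source (S.cap s).pt_target X) + _ at hcyc
  rw [← hc'] at hcyc
  have hn := S.card_capRel_fiber s X
  obtain ⟨n, hn'⟩ : ∃ n, n = Nat.card { x // q x = X } := ⟨_, rfl⟩
  change (Nat.card { x // q x = X } = 1) ∨ (Nat.card { x // q x = X } = 2 ∧ _) at hn
  rw [← hn'] at hn hg
  by_cases hX : f s.evenEnd = X
  · have hX' : f s.left = X := hel.symm.trans hX
    have hs := hsrc.1 hX'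
    have ht := htgt.1 hX'
    rw [if_pos hX] at hcyc harc
    rcases cycleCount_join hu hv hlr hX _ rfl with ⟨h, h'⟩ | ⟨h, -⟩
    · have hS' := h' _ S.pt S.pt_source S.pt_target
      -- A loop is split only when both points of the slot already lie on one component, so no
      -- components are merged.
      have h1 : n = 1 := hn.resolve_right fun h2 => h2.2.1 (by
        rcases s.ends_eq with ⟨e1, e2⟩ | ⟨e1, e2⟩ <;> rw [e1, e2] at hS'
        · exact hS'
        · exact hS'.symm)
      change _ + (if a.mate s.evenEnd = s.oddEnd then 1 else 0) +
        (if b.mate s.evenEnd = s.oddEnd then 1 else 0) = _ at h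
      simp only [s.mate_evenEnd_iff] at h
      refine ⟨g, ?_⟩
      omega
    · change _ + (if a.mate s.evenEnd = s.oddEnd then 1 else 0) +
        (if b.mate s.evenEnd = s.oddEnd then 1 else 0) = _ at h
      simp only [s.mate_evenEnd_iff] at h
      -- Here `n` is the number of components that the strip touches: with `n = 2` it connects them,
      -- and with `n = 1` it adds a handle.
      refine ⟨g + (2 - n), ?_⟩
      have : n ≤ 2 := by omega
      push_cast [this]
      omega
  · have hX' : ¬ f s.left = X := fun h => hX (hel.trans h)
    have hs := hsrc.2 hX'
    have ht := htgt.2 hX'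
    rw [if_neg hX] at hcyc harc
    rw [halfPerm_join_of_ne hu hv hlr hX] at hcyc
    have h1 : n = 1 := hn.resolve_right fun h2 => hX' h2.2.2.symm
    exact ⟨g, by omega⟩

/-- Thus the closure under gluing adds nothing to the surfaces that satisfy the genus formula, and
`of_genus` suffices to construct any cobordism. -/
theorem IsCobordism.hasGenus {N : ℕ} {a b : Diagram N} {S : Surface a b} (hS : S.IsCobordism) :
    S.HasGenus := by
  induction hS with
  | of_genus S h => exact h
  | cylinder a => exact hasGenus_cylinder a
  | comp _ _ h h' => exact h.comp h'
  | cap s _ h => exact h.cap s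

/-! ### Removing a cap on the target -/

/-- `a` without its arc between the two points of a slot. -/
def _root_.BarNatan.Diagram.removeArc (s : Slot N M) (a : Diagram N) : Diagram M :=
  { a.cap s with circles := a.circles }

/-- The component of a surface that contains a given component of its target. -/
def targetComp (T : Surface a b) : b.Component → T.Comp :=
  Sum.elim (Quot.lift T.pt (by rintro p _ rfl; exact (T.pt_target p).symm)) T.target

theorem capPoint_mate_of_arc (s : Slot N M) {a : Diagram N} (h : a.mate s.left = s.right)
    (T : Surface (a.removeArc s) (b.cap s)) (p : Fin N) :
    T.targetComp (capPoint s b (a.mate p)) = T.targetComp (capPoint s b p) := by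
  by_cases hl : p = s.left
  · rw [hl, h, capPoint_left]
  by_cases hr : p = s.right
  · rw [hr, ← h, a.mate_mate, h, capPoint_left]
  obtain ⟨j, rfl⟩ : ∃ j, s.skip j = p := ⟨_, s.skip_unskip p hl hr⟩
  have h1 : a.mate (s.skip j) = s.skip ((a.cap s).mate j) := by
    have := a.mate_mate
    rw [Diagram.skip_cap_mate, Slot.joinMate, if_neg, if_neg]
    · grind
    · grind
  rw [h1, capPoint_skip, capPoint_skip]
  exact T.pt_source j

/-- A cobordism to a capped diagram as a cobordism from the diagram with one more arc: glue a strip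
along the cap of the target. -/
noncomputable def bend (s : Slot N M) {a : Diagram N} (h : a.mate s.left = s.right)
    (T : Surface (a.removeArc s) (b.cap s)) : Surface a b where
  Comp := T.Comp
  finite_comp := T.finite_comp
  pt p := T.targetComp (capPoint s b p)
  pt_source p := T.capPoint_mate_of_arc s h p
  pt_target p := by rw [capPoint_mate]
  source := T.source
  target i := T.target (Fin.castLE (Nat.le_add_right _ _) i)
  euler := T.euler - Finsupp.single (T.targetComp (capPoint s b s.left)) 1
  dots := T.dots
  alpha := T.alpha

theorem bend_pt_skip (s : Slot N M) {a : Diagram N} (h : a.mate s.left = s.right)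
    (T : Surface (a.removeArc s) (b.cap s)) (j : Fin M) : (T.bend s h).pt (s.skip j) = T.pt j := by
  change T.targetComp (capPoint s b (s.skip j)) = _
  rw [capPoint_skip]
  rfl

-- The capping count is read backwards. The loss of one in the Euler characteristic is balanced by
-- the additional arc of the source, and the genus does not change.
open ParityMatching Classical in
theorem HasGenus.bend (s : Slot N M) {a : Diagram N} (h : a.mate s.left = s.right)
    {T : Surface (a.removeArc s) (b.cap s)} (hT : T.HasGenus) : (T.bend s h).HasGenus := by
  rw [hasGenus_iff] at hT ⊢
  intro (X : T.Comp)
  obtain ⟨g, hg⟩ := hT X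
  refine ⟨g, ?_⟩
  let f : Fin N → T.Comp := (T.bend s h).pt
  have hu : ∀ p, f (a.toParityMatching.mate p) = f p := (T.bend s h).pt_source
  have hv : ∀ p, f (b.toParityMatching.mate p) = f p := (T.bend s h).pt_target
  have hlr : f s.left = f s.right := by
    have := (T.bend s h).pt_source s.left
    rw [h] at this
    exact this.symm
  have hel : f s.evenEnd = f s.left := (s.apply_evenEnd hlr).1
  have hpt : T.pt = fun j => f (s.skip j) := funext fun j => (T.bend_pt_skip s h j).symm
  have hcyc := cycleCount_halfPerm_skip (s := s) (u' := (a.cap s).toParityMatching)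
    (v' := (b.cap s).toParityMatching) (apply_join hu hlr) (apply_join hv hlr)
    (skip_cap_mate_eq_join s a) (skip_cap_mate_eq_join s b) (join_mate_evenEnd s _)
    (join_mate_evenEnd s _) X
  have harc := card_evenFiber_skip (s := s) (f := f) X
  have hb : ∀ i : Fin (b.cap s).circles, ¬ i.1 < b.circles → T.target i = f s.left := by
    intro i hi
    have h2 : i.1 < b.circles + if b.mate s.left = s.right then 1 else 0 := i.2
    change _ = T.targetComp (capPoint s b s.left)
    rw [capPoint, dif_neg (by simp)]
    split_ifs at h2 ⊢ with h
    · exact congrArg T.target (Fin.ext (by simp; omega))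
    · omega
  obtain ⟨tB, htB⟩ : ∃ n, n = Nat.card { i // (T.bend s h).target i = X } := ⟨_, rfl⟩
  obtain ⟨tB', htB'⟩ : ∃ n, n = Nat.card { i // T.target i = X } := ⟨_, rfl⟩
  have htgt : (f s.left = X → tB' = tB + if b.mate s.left = s.right then 1 else 0) ∧
      (f s.left ≠ X → tB' = tB) := by
    rw [htB, htB']
    exact card_fin_fiber (k := (b.cap s).circles) rfl _ _ _ _ (fun i hi => rfl) hb
  obtain ⟨k', hk'⟩ : ∃ k', k' = Nat.card (EvenFiber T.pt X) := ⟨_, rfl⟩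
  obtain ⟨c', hc'⟩ : ∃ c', c' = cycleCount ((a.removeArc s).toParityMatching.halfPerm
    (b.cap s).toParityMatching T.pt T.pt_source T.pt_target X) := ⟨_, rfl⟩
  have hc2 : ∀ (f' : Fin M → T.Comp) (_ : T.pt = f')
      (h₁ : ∀ j, f' ((a.cap s).toParityMatching.mate j) = f' j)
      (h₂ : ∀ j, f' ((b.cap s).toParityMatching.mate j) = f' j),
      c' = cycleCount ((a.cap s).toParityMatching.halfPerm
        (b.cap s).toParityMatching f' h₁ h₂ X) := by
    rintro _ rfl _ _
    exact hc'
  rw [← hpt, ← hk'] at harc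
  rw [← hc2 _ hpt] at hcyc
  rw [← hk', ← hc', ← htB'] at hg
  rw [← htB]
  change _ + (Nat.card (EvenFiber f X) : ℤ) = 2 - 2 * (g : ℤ) -
    ((cycleCount (a.toParityMatching.halfPerm b.toParityMatching f hu hv X) : ℤ) +
      (Nat.card { i // T.source i = X } : ℤ) + _)
  change T.euler X - (Finsupp.single (f s.left) 1 : T.Comp →₀ ℤ) X + _ = _
  by_cases hX : f s.evenEnd = X
  · have hX' : f s.left = X := hel.symm.trans hX
    have ht := htgt.1 hX'
    rw [if_pos hX] at hcyc harc
    have he : (Finsupp.single (f s.left) 1 : T.Comp →₀ ℤ) X = 1 := by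
      rw [← hX']; exact Finsupp.single_eq_same
    rw [he]
    have hae : a.mate s.evenEnd = s.oddEnd := (s.mate_evenEnd_iff a).mpr h
    -- The source has an arc across the slot, so the merging case cannot occur.
    rcases cycleCount_join hu hv hlr hX _ rfl with ⟨h, -⟩ | ⟨-, h⟩
    · change _ + (if a.mate s.evenEnd = s.oddEnd then 1 else 0) +
        (if b.mate s.evenEnd = s.oddEnd then 1 else 0) = _ at h
      rw [if_pos hae] at h
      simp only [s.mate_evenEnd_iff] at h
      omega
    · exact absurd hae h
  · have hX' : ¬ f s.left = X := fun h => hX (hel.trans h)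
    have ht := htgt.2 hX'
    rw [if_neg hX] at hcyc harc
    have he : (Finsupp.single (f s.left) 1 : T.Comp →₀ ℤ) X = 0 :=
      Finsupp.single_eq_of_ne (Ne.symm hX')
    rw [he]
    rw [halfPerm_join_of_ne hu hv hlr hX] at hcyc
    omega

end Surface


/-! ### Local modifications and stacking -/

namespace Surface

variable {N : ℕ} {a b c : Diagram N}

theorem addDot_comp (S : Surface a b) (T : Surface b c) (u : S.Comp) :
    ((S.addDot u).comp T).Homeo ((S.comp T).addDot (Quot.mk _ (Sum.inl u))) := by
  refine Homeo.of_maps (Quot.map (ra := Meets (S.addDot u) T) (rb := Meets S T) id ?_)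
    (Quot.map (ra := Meets S T) (rb := Meets (S.addDot u) T) id ?_) ?_ ?_ (fun _ => rfl)
    (fun _ => rfl) (fun _ => rfl) ?_ ?_ rfl
  · rintro _ _ (p | i)
    · exact Meets.pt (S := S) (T := T) p
    · exact Meets.circle (S := S) (T := T) i
  · rintro _ _ (p | i)
    · exact Meets.pt (S := (S.addDot u)) (T := T) p
    · exact Meets.circle (S := (S.addDot u)) (T := T) i
  · rintro ⟨x⟩; rfl
  · rintro ⟨x⟩; rfl
  · simp only [addDot, comp, Finsupp.mapDomain_add, ← Finsupp.mapDomain_comp]; rfl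
  · simp only [addDot, comp, Finsupp.mapDomain_add, ← Finsupp.mapDomain_comp,
      Finsupp.mapDomain_single]
    exact add_right_comm _ _ _

theorem comp_addDot (S : Surface a b) (T : Surface b c) (u : T.Comp) :
    (S.comp (T.addDot u)).Homeo ((S.comp T).addDot (Quot.mk _ (Sum.inr u))) := by
  refine Homeo.of_maps (Quot.map (ra := Meets S (T.addDot u)) (rb := Meets S T) id ?_)
    (Quot.map (ra := Meets S T) (rb := Meets S (T.addDot u)) id ?_) ?_ ?_ (fun _ => rfl)
    (fun _ => rfl) (fun _ => rfl) ?_ ?_ rfl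
  · rintro _ _ (p | i)
    · exact Meets.pt (S := S) (T := T) p
    · exact Meets.circle (S := S) (T := T) i
  · rintro _ _ (p | i)
    · exact Meets.pt (S := S) (T := (T.addDot u)) p
    · exact Meets.circle (S := S) (T := (T.addDot u)) i
  · rintro ⟨x⟩; rfl
  · rintro ⟨x⟩; rfl
  · simp only [addDot, comp, Finsupp.mapDomain_add, ← Finsupp.mapDomain_comp]; rfl
  · simp only [addDot, comp, Finsupp.mapDomain_add, ← Finsupp.mapDomain_comp,
      Finsupp.mapDomain_single]
    exact (add_assoc _ _ _).symm

theorem addHandle_comp (S : Surface a b) (T : Surface b c) (u : S.Comp) :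
    ((S.addHandle u).comp T).Homeo ((S.comp T).addHandle (Quot.mk _ (Sum.inl u))) := by
  refine Homeo.of_maps (Quot.map (ra := Meets (S.addHandle u) T) (rb := Meets S T) id ?_)
    (Quot.map (ra := Meets S T) (rb := Meets (S.addHandle u) T) id ?_) ?_ ?_ (fun _ => rfl)
    (fun _ => rfl) (fun _ => rfl) ?_ ?_ rfl
  · rintro _ _ (p | i)
    · exact Meets.pt (S := S) (T := T) p
    · exact Meets.circle (S := S) (T := T) i
  · rintro _ _ (p | i)
    · exact Meets.pt (S := (S.addHandle u)) (T := T) p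
    · exact Meets.circle (S := (S.addHandle u)) (T := T) i
  · rintro ⟨x⟩; rfl
  · rintro ⟨x⟩; rfl
  · simp only [addHandle, comp, Finsupp.mapDomain_add, ← Finsupp.mapDomain_comp,
      Finsupp.mapDomain_single]
    exact add_right_comm _ _ _
  · simp only [addHandle, comp, Finsupp.mapDomain_add, ← Finsupp.mapDomain_comp]; rfl

theorem comp_addHandle (S : Surface a b) (T : Surface b c) (u : T.Comp) :
    (S.comp (T.addHandle u)).Homeo ((S.comp T).addHandle (Quot.mk _ (Sum.inr u))) := by
  refine Homeo.of_maps (Quot.map (ra := Meets S (T.addHandle u)) (rb := Meets S T) id ?_)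
    (Quot.map (ra := Meets S T) (rb := Meets S (T.addHandle u)) id ?_) ?_ ?_ (fun _ => rfl)
    (fun _ => rfl) (fun _ => rfl) ?_ ?_ rfl
  · rintro _ _ (p | i)
    · exact Meets.pt (S := S) (T := T) p
    · exact Meets.circle (S := S) (T := T) i
  · rintro _ _ (p | i)
    · exact Meets.pt (S := S) (T := (T.addHandle u)) p
    · exact Meets.circle (S := S) (T := (T.addHandle u)) i
  · rintro ⟨x⟩; rfl
  · rintro ⟨x⟩; rfl
  · simp only [addHandle, comp, Finsupp.mapDomain_add, ← Finsupp.mapDomain_comp,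
      Finsupp.mapDomain_single]
    exact (add_assoc _ _ _).symm
  · simp only [addHandle, comp, Finsupp.mapDomain_add, ← Finsupp.mapDomain_comp]; rfl

theorem mulAlpha_comp (S : Surface a b) (T : Surface b c) :
    (S.mulAlpha.comp T).Homeo (S.comp T).mulAlpha := by
  refine Homeo.of_maps (Quot.map (ra := Meets S.mulAlpha T) (rb := Meets S T) id ?_)
    (Quot.map (ra := Meets S T) (rb := Meets S.mulAlpha T) id ?_) ?_ ?_ (fun _ => rfl)
    (fun _ => rfl) (fun _ => rfl) ?_ ?_ (add_right_comm S.alpha 1 T.alpha)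
  · rintro _ _ (p | i)
    · exact Meets.pt (S := S) (T := T) p
    · exact Meets.circle (S := S) (T := T) i
  · rintro _ _ (p | i)
    · exact Meets.pt (S := S.mulAlpha) (T := T) p
    · exact Meets.circle (S := S.mulAlpha) (T := T) i
  · rintro ⟨x⟩; rfl
  · rintro ⟨x⟩; rfl
  · simp only [mulAlpha, comp, Finsupp.mapDomain_add, ← Finsupp.mapDomain_comp]; rfl
  · simp only [mulAlpha, comp, Finsupp.mapDomain_add, ← Finsupp.mapDomain_comp]; rfl

theorem comp_mulAlpha (S : Surface a b) (T : Surface b c) :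
    (S.comp T.mulAlpha).Homeo (S.comp T).mulAlpha := by
  refine Homeo.of_maps (Quot.map (ra := Meets S T.mulAlpha) (rb := Meets S T) id ?_)
    (Quot.map (ra := Meets S T) (rb := Meets S T.mulAlpha) id ?_) ?_ ?_ (fun _ => rfl)
    (fun _ => rfl) (fun _ => rfl) ?_ ?_ rfl
  · rintro _ _ (p | i)
    · exact Meets.pt (S := S) (T := T) p
    · exact Meets.circle (S := S) (T := T) i
  · rintro _ _ (p | i)
    · exact Meets.pt (S := S) (T := T.mulAlpha) p
    · exact Meets.circle (S := S) (T := T.mulAlpha) i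
  · rintro ⟨x⟩; rfl
  · rintro ⟨x⟩; rfl
  · simp only [mulAlpha, comp, Finsupp.mapDomain_add, ← Finsupp.mapDomain_comp]; rfl
  · simp only [mulAlpha, comp, Finsupp.mapDomain_add, ← Finsupp.mapDomain_comp]; rfl

theorem addTube_comp (S : Surface a b) (T : Surface b c) (u v : S.Comp) :
    ((S.addTube u v).comp T).Homeo
      ((S.comp T).addTube (Quot.mk _ (Sum.inl u)) (Quot.mk _ (Sum.inl v))) := by
  refine Homeo.of_maps
    (Quot.lift (Sum.elim (Quot.lift (fun x => Quot.mk _ (Quot.mk _ (Sum.inl x))) ?_)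
      (fun y => Quot.mk _ (Quot.mk _ (Sum.inr y)))) ?_)
    (Quot.lift (Quot.lift (Sum.elim (fun x => Quot.mk _ (Sum.inl (Quot.mk _ x)))
      (fun y => Quot.mk _ (Sum.inr y))) ?_) ?_) ?_ ?_ ?_ ?_ ?_ ?_ ?_ rfl
  · rintro _ _ ⟨rfl, rfl⟩; exact Quot.sound ⟨rfl, rfl⟩
  · rintro _ _ (p | i)
    · exact congrArg (Quot.mk _) (Quot.sound (Meets.pt (S := S) (T := T) p))
    · exact congrArg (Quot.mk _) (Quot.sound (Meets.circle (S := S) (T := T) i))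
  · rintro _ _ (p | i)
    · exact Quot.sound (Meets.pt (S := S.addTube u v) (T := T) p)
    · exact Quot.sound (Meets.circle (S := S.addTube u v) (T := T) i)
  · rintro _ _ ⟨rfl, rfl⟩
    exact congrArg (fun x => Quot.mk _ (Sum.inl x)) (Quot.sound ⟨rfl, rfl⟩)
  · rintro ⟨x | x⟩
    · obtain ⟨x⟩ := x; rfl
    · rfl
  · rintro ⟨x⟩; obtain ⟨x | x⟩ := x <;> rfl
  · intro p; rfl
  · intro i; rfl
  · intro i; rfl
  · simp only [addTube, comp, Finsupp.mapDomain_add, ← Finsupp.mapDomain_comp,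
      Finsupp.mapDomain_single]
    exact add_right_comm _ _ _
  · simp only [addTube, comp, Finsupp.mapDomain_add, ← Finsupp.mapDomain_comp]; rfl

theorem comp_addTube (S : Surface a b) (T : Surface b c) (u v : T.Comp) :
    (S.comp (T.addTube u v)).Homeo
      ((S.comp T).addTube (Quot.mk _ (Sum.inr u)) (Quot.mk _ (Sum.inr v))) := by
  refine Homeo.of_maps
    (Quot.lift (Sum.elim (fun y => Quot.mk _ (Quot.mk _ (Sum.inl y)))
      (Quot.lift (fun x => Quot.mk _ (Quot.mk _ (Sum.inr x))) ?_)) ?_)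
    (Quot.lift (Quot.lift (Sum.elim (fun y => Quot.mk _ (Sum.inl y))
      (fun x => Quot.mk _ (Sum.inr (Quot.mk _ x)))) ?_) ?_) ?_ ?_ ?_ ?_ ?_ ?_ ?_ rfl
  · rintro _ _ ⟨rfl, rfl⟩; exact Quot.sound ⟨rfl, rfl⟩
  · rintro _ _ (p | i)
    · exact congrArg (Quot.mk _) (Quot.sound (Meets.pt (S := S) (T := T) p))
    · exact congrArg (Quot.mk _) (Quot.sound (Meets.circle (S := S) (T := T) i))
  · rintro _ _ (p | i)
    · exact Quot.sound (Meets.pt (S := S) (T := T.addTube u v) p)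
    · exact Quot.sound (Meets.circle (S := S) (T := T.addTube u v) i)
  · rintro _ _ ⟨rfl, rfl⟩
    exact congrArg (fun x => Quot.mk _ (Sum.inr x)) (Quot.sound ⟨rfl, rfl⟩)
  · rintro ⟨x | x⟩
    · rfl
    · obtain ⟨x⟩ := x; rfl
  · rintro ⟨x⟩; obtain ⟨x | x⟩ := x <;> rfl
  · intro p; rfl
  · intro i; rfl
  · intro i; rfl
  · simp only [addTube, comp, Finsupp.mapDomain_add, ← Finsupp.mapDomain_comp,
      Finsupp.mapDomain_single]
    exact (add_assoc _ _ _).symm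
  · simp only [addTube, comp, Finsupp.mapDomain_add, ← Finsupp.mapDomain_comp]; rfl

theorem addSphere_comp (S : Surface a b) (T : Surface b c) (k : ℕ) :
    ((S.addSphere k).comp T).Homeo ((S.comp T).addSphere k) := by
  refine Homeo.of_maps
    (Quot.lift (Sum.elim (Option.map (fun x => Quot.mk _ (Sum.inl x)))
      (fun y => some (Quot.mk _ (Sum.inr y)))) ?_)
    (fun x => Option.elim x (Quot.mk _ (Sum.inl none)) (Quot.lift
      (Sum.elim (fun x => Quot.mk _ (Sum.inl (some x))) (fun y => Quot.mk _ (Sum.inr y))) ?_))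
    ?_ ?_ ?_ ?_ ?_ ?_ ?_ rfl
  · rintro _ _ (p | i)
    · exact congrArg some (Quot.sound (Meets.pt (S := S) (T := T) p))
    · exact congrArg some (Quot.sound (Meets.circle (S := S) (T := T) i))
  · rintro _ _ (p | i)
    · exact Quot.sound (Meets.pt (S := S.addSphere k) (T := T) p)
    · exact Quot.sound (Meets.circle (S := S.addSphere k) (T := T) i)
  · rintro ⟨(_ | x) | x⟩ <;> rfl
  · rintro (_ | x)
    · rfl
    · obtain ⟨x | x⟩ := x <;> rfl
  · intro p; rfl
  · intro i; rfl
  · intro i; rfl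
  · simp only [addSphere, comp, Finsupp.mapDomain_add, ← Finsupp.mapDomain_comp,
      Finsupp.mapDomain_single]
    exact add_right_comm _ _ _
  · simp only [addSphere, comp, Finsupp.mapDomain_add, ← Finsupp.mapDomain_comp,
      Finsupp.mapDomain_single]
    exact add_right_comm _ _ _

theorem comp_addSphere (S : Surface a b) (T : Surface b c) (k : ℕ) :
    (S.comp (T.addSphere k)).Homeo ((S.comp T).addSphere k) := by
  refine Homeo.of_maps
    (Quot.lift (Sum.elim (fun y => some (Quot.mk _ (Sum.inl y)))
      (Option.map (fun x => Quot.mk _ (Sum.inr x)))) ?_)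
    (fun x => Option.elim x (Quot.mk _ (Sum.inr none)) (Quot.lift
      (Sum.elim (fun y => Quot.mk _ (Sum.inl y)) (fun x => Quot.mk _ (Sum.inr (some x)))) ?_))
    ?_ ?_ ?_ ?_ ?_ ?_ ?_ rfl
  · rintro _ _ (p | i)
    · exact congrArg some (Quot.sound (Meets.pt (S := S) (T := T) p))
    · exact congrArg some (Quot.sound (Meets.circle (S := S) (T := T) i))
  · rintro _ _ (p | i)
    · exact Quot.sound (Meets.pt (S := S) (T := T.addSphere k) p)
    · exact Quot.sound (Meets.circle (S := S) (T := T.addSphere k) i)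
  · rintro ⟨x | (_ | x)⟩ <;> rfl
  · rintro (_ | x)
    · rfl
    · obtain ⟨x | x⟩ := x <;> rfl
  · intro p; rfl
  · intro i; rfl
  · intro i; rfl
  · simp only [addSphere, comp, Finsupp.mapDomain_add, ← Finsupp.mapDomain_comp,
      Finsupp.mapDomain_single]
    exact (add_assoc _ _ _).symm
  · simp only [addSphere, comp, Finsupp.mapDomain_add, ← Finsupp.mapDomain_comp,
      Finsupp.mapDomain_single]
    exact (add_assoc _ _ _).symm

end Surface

/-! ### Morphisms as classes of linear combinations of cobordisms -/

variable {N : ℕ}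

theorem Cobordism.toLinear_congr {X Y : GradedDiagram N} {F G : Cobordism X Y}
    (h : F.surface.Homeo G.surface) : F.toLinear = G.toLinear :=
  congrArg (Free.embedding ℤ (GradedDiagram N)).map (Quotient.sound h)

theorem Cobordism.toLinear_comp {X Y Z : GradedDiagram N} (F : Cobordism X Y)
    (G : Cobordism Y Z) : (F.comp G).toLinear = F.toLinear ≫ G.toLinear :=
  (Free.embedding ℤ (GradedDiagram N)).map_comp (Quotient.mk _ F) (Quotient.mk _ G)

/-- An additive property of combinations of cobordisms has to be checked for cobordisms only. -/
theorem linear_induction {X Y : GradedDiagram N} {p : (Free.of ℤ X ⟶ Free.of ℤ Y) → Prop}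
    (h0 : p 0) (hadd : ∀ f g, p f → p g → p (f + g)) (hneg : ∀ f, p f → p (-f))
    (hcob : ∀ F : Cobordism X Y, p F.toLinear) (f : Free.of ℤ X ⟶ Free.of ℤ Y) : p f := by
  refine Finsupp.induction_linear f h0 hadd ?_
  rintro ⟨F⟩ k
  have h1 : ∀ k : ℕ, p (k • F.toLinear) := by
    intro k
    induction k with
    | zero => rw [zero_nsmul]; exact h0
    | succ k ih => rw [succ_nsmul]; exact hadd _ _ ih (hcob F)
  have h2 : ∀ k : ℤ, p (k • F.toLinear) := by
    intro k
    obtain ⟨k, rfl | rfl⟩ := k.eq_nat_or_neg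
    · rw [natCast_zsmul]; exact h1 k
    · rw [neg_zsmul, natCast_zsmul]; exact hneg _ (h1 k)
  have h3 := map_zsmul (Finsupp.singleAddHom (Quotient.mk (Cobordism.setoid X Y) F)) k (1 : ℤ)
  rw [smul_eq_mul, mul_one] at h3
  exact (congrArg p h3).mpr (h2 k)

/-- Local modifications commute with stacking, so a local relation followed by a single cobordism is
an instance of the same relation. Hence the ideal is merely the additive span of the relations. -/
theorem localRelation_comp {X Y Z : GradedDiagram N} {r : Free.of ℤ X ⟶ Free.of ℤ Y}
    (hr : LocalRelation r) (K : Cobordism Y Z) {r' : Free.of ℤ X ⟶ Free.of ℤ Z}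
    (h : r' = r ≫ K.toLinear) : LocalRelation r' := by
  have hK : ∀ {T : Surface X.diagram Y.diagram} {F : Cobordism X Y}, F.surface.Homeo T →
      (F.comp K).surface.Homeo (T.comp K.surface) := fun h => Surface.comp_congr h (.refl _)
  cases hr with
  | sphere_zero S F hF =>
    obtain rfl : r' = (F.comp K).toLinear := by rw [h, Cobordism.toLinear_comp]
    exact .sphere_zero _ _ ((hK hF).trans (Surface.addSphere_comp _ _ _))
  | sphere_one S F G hF hG =>
    obtain rfl : r' = (F.comp K).toLinear - (G.comp K).toLinear := by
      rw [h, Preadditive.sub_comp, Cobordism.toLinear_comp, Cobordism.toLinear_comp]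
    exact .sphere_one _ _ _ ((hK hF).trans (Surface.addSphere_comp _ _ _)) (hK hG)
  | sphere_two S F hF =>
    obtain rfl : r' = (F.comp K).toLinear := by rw [h, Cobordism.toLinear_comp]
    exact .sphere_two _ _ ((hK hF).trans (Surface.addSphere_comp _ _ _))
  | sphere_three S F G hF hG =>
    obtain rfl : r' = (F.comp K).toLinear - (G.comp K).toLinear := by
      rw [h, Preadditive.sub_comp, Cobordism.toLinear_comp, Cobordism.toLinear_comp]
    exact .sphere_three _ _ _ ((hK hF).trans (Surface.addSphere_comp _ _ _))
      ((hK hG).trans (Surface.mulAlpha_comp _ _))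
  | tube S u v F G H hF hG hH =>
    obtain rfl : r' = (F.comp K).toLinear - ((G.comp K).toLinear + (H.comp K).toLinear) := by
      rw [h, Preadditive.sub_comp, Preadditive.add_comp]
      simp only [Cobordism.toLinear_comp]
    exact .tube _ _ _ _ _ _ ((hK hF).trans (Surface.addTube_comp _ _ _ _))
      ((hK hG).trans (Surface.addDot_comp _ _ _)) ((hK hH).trans (Surface.addDot_comp _ _ _))
  | handle S u F G hF hG =>
    obtain rfl : r' = (F.comp K).toLinear - ((G.comp K).toLinear + (G.comp K).toLinear) := by
      rw [h, Preadditive.sub_comp, Preadditive.add_comp]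
      simp only [Cobordism.toLinear_comp]
    exact .handle _ _ _ _ ((hK hF).trans (Surface.addHandle_comp _ _ _))
      ((hK hG).trans (Surface.addDot_comp _ _ _))

theorem comp_localRelation {X Y Z : GradedDiagram N} (K : Cobordism X Y)
    {r : Free.of ℤ Y ⟶ Free.of ℤ Z} (hr : LocalRelation r) {r' : Free.of ℤ X ⟶ Free.of ℤ Z}
    (h : r' = K.toLinear ≫ r) : LocalRelation r' := by
  have hK : ∀ {T : Surface Y.diagram Z.diagram} {F : Cobordism Y Z}, F.surface.Homeo T →
      (K.comp F).surface.Homeo (K.surface.comp T) := fun h => Surface.comp_congr (.refl _) h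
  cases hr with
  | sphere_zero S F hF =>
    obtain rfl : r' = (K.comp F).toLinear := by rw [h, Cobordism.toLinear_comp]
    exact .sphere_zero _ _ ((hK hF).trans (Surface.comp_addSphere _ _ _))
  | sphere_one S F G hF hG =>
    obtain rfl : r' = (K.comp F).toLinear - (K.comp G).toLinear := by
      rw [h, Preadditive.comp_sub, Cobordism.toLinear_comp, Cobordism.toLinear_comp]
    exact .sphere_one _ _ _ ((hK hF).trans (Surface.comp_addSphere _ _ _)) (hK hG)
  | sphere_two S F hF =>
    obtain rfl : r' = (K.comp F).toLinear := by rw [h, Cobordism.toLinear_comp]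
    exact .sphere_two _ _ ((hK hF).trans (Surface.comp_addSphere _ _ _))
  | sphere_three S F G hF hG =>
    obtain rfl : r' = (K.comp F).toLinear - (K.comp G).toLinear := by
      rw [h, Preadditive.comp_sub, Cobordism.toLinear_comp, Cobordism.toLinear_comp]
    exact .sphere_three _ _ _ ((hK hF).trans (Surface.comp_addSphere _ _ _))
      ((hK hG).trans (Surface.comp_mulAlpha _ _))
  | tube S u v F G H hF hG hH =>
    obtain rfl : r' = (K.comp F).toLinear - ((K.comp G).toLinear + (K.comp H).toLinear) := by
      rw [h, Preadditive.comp_sub, Preadditive.comp_add]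
      simp only [Cobordism.toLinear_comp]
    exact .tube _ _ _ _ _ _ ((hK hF).trans (Surface.comp_addTube _ _ _ _))
      ((hK hG).trans (Surface.comp_addDot _ _ _)) ((hK hH).trans (Surface.comp_addDot _ _ _))
  | handle S u F G hF hG =>
    obtain rfl : r' = (K.comp F).toLinear - ((K.comp G).toLinear + (K.comp G).toLinear) := by
      rw [h, Preadditive.comp_sub, Preadditive.comp_add]
      simp only [Cobordism.toLinear_comp]
    exact .handle _ _ _ _ ((hK hF).trans (Surface.comp_addHandle _ _ _))
      ((hK hG).trans (Surface.comp_addDot _ _ _))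

/-- The ideal of local relations is generated by them as an additive group. -/
theorem localIdeal_le_closure (X Y : GradedDiagram N) :
    localIdeal (Free.of ℤ X) (Free.of ℤ Y) ≤
      AddSubgroup.closure { r : Free.of ℤ X ⟶ Free.of ℤ Y | LocalRelation r } := by
  refine (AddSubgroup.closure_le _).mpr ?_
  rintro _ ⟨X', Y', f, r, g, hr, rfl⟩
  have hg : ∀ g : Free.of ℤ Y' ⟶ Free.of ℤ Y,
      r ≫ g ∈ AddSubgroup.closure { r : Free.of ℤ X' ⟶ Free.of ℤ Y | LocalRelation r } := by
    intro g
    refine linear_induction (p := fun g => r ≫ g ∈ AddSubgroup.closure _) ?_ ?_ ?_ ?_ g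
    · rw [comp_zero]; exact zero_mem _
    · intro f g hf hg; rw [Preadditive.comp_add]; exact add_mem hf hg
    · intro f hf; rw [Preadditive.comp_neg]; exact neg_mem hf
    · intro F; exact AddSubgroup.subset_closure (localRelation_comp hr F rfl)
  refine linear_induction (p := fun f => f ≫ r ≫ g ∈ AddSubgroup.closure _) ?_ ?_ ?_ ?_ f
  · rw [zero_comp]; exact zero_mem _
  · intro f g hf hg; rw [Preadditive.add_comp]; exact add_mem hf hg
  · intro f hf; rw [Preadditive.neg_comp]; exact neg_mem hf
  · intro F
    refine AddSubgroup.closure_induction (p := fun e _ => F.toLinear ≫ e ∈ AddSubgroup.closure _)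
      ?_ ?_ ?_ ?_ (hg g)
    · intro e he; exact AddSubgroup.subset_closure (comp_localRelation F he rfl)
    · rw [comp_zero]; exact zero_mem _
    · intro f g _ _ hf hg; rw [Preadditive.comp_add]; exact add_mem hf hg
    · intro f _ hf; rw [Preadditive.comp_neg]; exact neg_mem hf

/-- A shifted diagram as an object of the category modulo local relations. -/
noncomputable abbrev GradedDiagram.toDisc (X : GradedDiagram N) : DiscCob N :=
  (CategoryTheory.Quotient.functor (localRel N)).obj (Free.of ℤ X)

/-- The class of a cobordism modulo local relations. -/
noncomputable def Cobordism.toDisc {X Y : GradedDiagram N} (F : Cobordism X Y) :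
    X.toDisc ⟶ Y.toDisc :=
  (CategoryTheory.Quotient.functor (localRel N)).map F.toLinear

theorem Cobordism.toDisc_congr {X Y : GradedDiagram N} {F G : Cobordism X Y}
    (h : F.surface.Homeo G.surface) : F.toDisc = G.toDisc :=
  congrArg (CategoryTheory.Quotient.functor (localRel N)).map (toLinear_congr h)

theorem Cobordism.toDisc_comp {X Y Z : GradedDiagram N} (F : Cobordism X Y)
    (G : Cobordism Y Z) : (F.comp G).toDisc = F.toDisc ≫ G.toDisc := by
  unfold toDisc
  rw [toLinear_comp, Functor.map_comp]

theorem Cobordism.toDisc_of_homeo_cylinder {X : GradedDiagram N} {F : Cobordism X X}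
    (h : F.surface.Homeo (Surface.cylinder X.diagram)) : F.toDisc = 𝟙 X.toDisc := by
  have : F.toLinear = 𝟙 _ := by
    refine (congrArg (Free.embedding ℤ (GradedDiagram N)).map ?_).trans
      ((Free.embedding ℤ (GradedDiagram N)).map_id X)
    exact Quotient.sound h
  rw [toDisc, this, CategoryTheory.Functor.map_id]

theorem map_eq_zero_of_localRelation {X Y : GradedDiagram N} {r : Free.of ℤ X ⟶ Free.of ℤ Y}
    (hr : LocalRelation r) : (CategoryTheory.Quotient.functor (localRel N)).map r = 0 := by
  rw [← CategoryTheory.Functor.map_zero, CategoryTheory.Quotient.functor_map_eq_iff]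
  change r - 0 ∈ _
  rw [sub_zero]
  exact AddSubgroup.subset_closure ⟨X, Y, 𝟙 _, r, 𝟙 _, hr, by simp⟩

theorem disc_induction {X Y : GradedDiagram N} {p : (X.toDisc ⟶ Y.toDisc) → Prop}
    (h0 : p 0) (hadd : ∀ f g, p f → p g → p (f + g)) (hneg : ∀ f, p f → p (-f))
    (hcob : ∀ F : Cobordism X Y, p F.toDisc) (f : X.toDisc ⟶ Y.toDisc) : p f := by
  obtain ⟨f, rfl⟩ := (CategoryTheory.Quotient.functor (localRel N)).map_surjective f
  refine linear_induction (p := fun f => p ((CategoryTheory.Quotient.functor (localRel N)).map f))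
    ?_ ?_ ?_ hcob f
  · rw [Functor.map_zero]; exact h0
  · intro f g hf hg; rw [Functor.map_add]; exact hadd _ _ hf hg
  · intro f hf; rw [Functor.map_neg]; exact hneg _ hf

/-- An additive invariant of cobordisms that satisfies the local relations is defined modulo local
relations. -/
theorem exists_disc_addHom {A : Type*} [AddCommGroup A] {X Y : GradedDiagram N}
    (φ : Cobordism X Y → A) (hφ : ∀ F G, F.surface.Homeo G.surface → φ F = φ G)
    (hrel : ∀ ψ : (Free.of ℤ X ⟶ Free.of ℤ Y) →+ A, (∀ F, ψ F.toLinear = φ F) →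
      ∀ r, LocalRelation r → ψ r = 0) :
    ∃ ψ : (X.toDisc ⟶ Y.toDisc) →+ A, ∀ F : Cobordism X Y, ψ F.toDisc = φ F := by
  let φ' : (X ⟶ Y) → A := Quotient.lift φ hφ
  let ψ : (Free.of ℤ X ⟶ Free.of ℤ Y) →+ A :=
    (Finsupp.liftAddHom fun x => (zmultiplesHom A (φ' x)) : ((X ⟶ Y) →₀ ℤ) →+ A)
  have hψ : ∀ F : Cobordism X Y, ψ F.toLinear = φ F := fun F => by
    change Finsupp.liftAddHom (fun x => (zmultiplesHom A (φ' x)))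
      (Finsupp.single (Quotient.mk _ F) 1 : (X ⟶ Y) →₀ ℤ) = _
    rw [Finsupp.liftAddHom_apply_single, zmultiplesHom_apply, one_zsmul]
    rfl
  have hker : ∀ e ∈ localIdeal (Free.of ℤ X) (Free.of ℤ Y), ψ e = 0 := by
    intro e he
    have := localIdeal_le_closure X Y he
    refine (AddSubgroup.closure_le (K := ψ.ker)).mpr ?_ this
    exact fun r hr => hrel ψ hψ r hr
  let Q := CategoryTheory.Quotient.functor (localRel N)
  -- `Q.preimage` is an arbitrary choice; it does not matter, because `ψ` vanishes on the ideal.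
  have hpre : ∀ f : Free.of ℤ X ⟶ Free.of ℤ Y, ψ (Q.preimage (Q.map f)) = ψ f := fun f => by
    have h1 : Q.map (Q.preimage (Q.map f)) = Q.map f := Q.map_preimage _
    rw [CategoryTheory.Quotient.functor_map_eq_iff] at h1
    have := hker _ h1
    rwa [map_sub, sub_eq_zero] at this
  refine ⟨AddMonoidHom.mk' (fun f => ψ (Q.preimage f)) fun f g => ?_, fun F => ?_⟩
  · rw [← map_add, ← hpre (Q.preimage f + Q.preimage g), Functor.map_add, Q.map_preimage,
      Q.map_preimage]
  · exact (hpre _).trans (hψ F)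


/-! ### Bending is natural -/

namespace Surface

variable {N M : ℕ} {a b c : Diagram N}

/-- In a capped diagram the arc at a slot point becomes either the new circle or part of the arc
through the former mate of `left`. The hypotheses cover the two cases, so a map on components can be
checked at remaining points and at the last circle. -/
theorem targetComp_capPoint {s : Slot N M} {a₀ : Diagram M} {T : Surface a₀ (b.cap s)} {Z : Type*}
    {f : T.Comp → Z} {g : Fin N → Z} (hpt : ∀ j, f (T.pt j) = g (s.skip j))
    (hb : ∀ p, g (b.mate p) = g p) (hlr : g s.left = g s.right)
    (hlast : ∀ i : Fin (b.cap s).circles, ¬ i.1 < b.circles → f (T.target i) = g s.left)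
    (p : Fin N) : f (T.targetComp (capPoint s b p)) = g p := by
  have hl : f (T.targetComp (capPoint s b s.left)) = g s.left := by
    rw [capPoint, dif_neg (by simp)]
    split_ifs with h
    · exact hlast _ (lt_irrefl _)
    · refine (hpt _).trans ?_
      rw [s.skip_unskip, hb]
  by_cases h1 : p = s.left
  · rw [h1, hl]
  by_cases h2 : p = s.right
  · rw [h2, ← capPoint_left, hl, hlr]
  rw [capPoint, dif_pos ⟨h1, h2⟩]
  refine (hpt _).trans ?_
  rw [s.skip_unskip]

theorem mapDomain_sub {X Y : Type*} (f : X → Y) (e e' : X →₀ ℤ) :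
    (e - e').mapDomain f = e.mapDomain f - e'.mapDomain f :=
  map_sub (Finsupp.mapDomain.addMonoidHom f) e e'

theorem mapDomain_add_mapDomain {X Y Z V W R : Type*} [AddCommMonoid R] (f : Z → W) (g : X → Z)
    (g' : V → Z) (k : Y → V) (e : X →₀ R) (e' : Y →₀ R) :
    (e.mapDomain g + (e'.mapDomain k).mapDomain g').mapDomain f =
      e.mapDomain (fun x => f (g x)) + e'.mapDomain (fun y => f (g' (k y))) := by
  simp only [Finsupp.mapDomain_add, ← Finsupp.mapDomain_comp]
  rfl

variable (s : Slot N M) (h : a.mate s.left = s.right)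

theorem bend_pt_left (T : Surface (a.removeArc s) (b.cap s)) :
    (T.bend s h).pt s.left = (T.bend s h).pt s.right := congrArg T.targetComp (capPoint_left s b)

theorem bend_target_last (T : Surface (a.removeArc s) (b.cap s)) (i : Fin (b.cap s).circles)
    (hi : ¬ i.1 < b.circles) : T.target i = (T.bend s h).pt s.left := by
  have h2 : i.1 < b.circles + if b.mate s.left = s.right then 1 else 0 := i.2
  change _ = T.targetComp (capPoint s b s.left)
  rw [capPoint, dif_neg (by simp)]
  split_ifs at h2 ⊢ with h
  · exact congrArg T.target (Fin.ext (by simp; omega))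
  · omega

theorem degree_bend (T : Surface (a.removeArc s) (b.cap s)) :
    (T.bend s h).degree = T.degree + 1 := by
  have h1 : (T.bend s h).euler.degree = T.euler.degree - 1 :=
    (map_sub (Finsupp.degree : (T.Comp →₀ ℤ) →+ ℤ) _ _).trans
      (congrArg _ (Finsupp.degree_single _ _))
  have h2 : (T.bend s h).dots.degree = T.dots.degree := rfl
  have h3 : (T.bend s h).alpha = T.alpha := rfl
  simp only [degree, h1, h2, h3]
  ring

theorem bend_congr {T T' : Surface (a.removeArc s) (b.cap s)} (hT : T.Homeo T') :
    (T.bend s h).Homeo (T'.bend s h) := by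
  obtain ⟨e, h1, h2, h3, h4, h5, h6⟩ := hT
  have key : ∀ p, e (T.targetComp (capPoint s b p)) = T'.targetComp (capPoint s b p) := fun p =>
    targetComp_capPoint (f := e) (g := (T'.bend s h).pt)
      (fun j => (h1 j).trans (T'.bend_pt_skip s h j).symm) (T'.bend s h).pt_target
      (bend_pt_left s h T') (fun i hi => (h3 i).trans (bend_target_last s h T' i hi)) p
  exact ⟨e, key, h2, fun i => h3 _, (mapDomain_sub _ _ _).trans (congrArg₂ _ h4
    (Finsupp.mapDomain_single.trans (congrArg (fun x => Finsupp.single x 1) (key _)))), h5, h6⟩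

theorem bend_addDot (T : Surface (a.removeArc s) (b.cap s)) (u : T.Comp) :
    ((T.addDot u).bend s h).Homeo ((T.bend s h).addDot u) := .refl _

theorem bend_mulAlpha (T : Surface (a.removeArc s) (b.cap s)) :
    (T.mulAlpha.bend s h).Homeo (T.bend s h).mulAlpha := .refl _

theorem bend_addHandle (T : Surface (a.removeArc s) (b.cap s)) (u : T.Comp) :
    ((T.addHandle u).bend s h).Homeo ((T.bend s h).addHandle u) := by
  refine ⟨Equiv.refl _, fun _ => rfl, fun _ => rfl, fun _ => rfl, ?_, ?_, rfl⟩
  · exact Finsupp.mapDomain_id.trans (add_sub_right_comm _ _ _)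
  · exact Finsupp.mapDomain_id

theorem bend_addTube (T : Surface (a.removeArc s) (b.cap s)) (u v : T.Comp) :
    ((T.addTube u v).bend s h).Homeo ((T.bend s h).addTube u v) := by
  have key : ∀ p, (T.addTube u v).targetComp (capPoint s b p) =
      ((T.bend s h).addTube u v).pt p := fun p =>
    targetComp_capPoint (T := T.addTube u v) (f := id)
      (g := ((T.bend s h).addTube u v).pt) (fun j => congrArg (Quot.mk _)
      (T.bend_pt_skip s h j).symm) ((T.bend s h).addTube u v).pt_target
      (congrArg (Quot.mk _) (bend_pt_left s h T))
      (fun i hi => congrArg (Quot.mk _) (bend_target_last s h T i hi)) p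
  refine ⟨Equiv.refl _, key, fun _ => rfl, fun _ => rfl, ?_, Finsupp.mapDomain_id, rfl⟩
  refine Finsupp.mapDomain_id.trans ((congrArg (fun x => _ - Finsupp.single x 1)
    (key s.left)).trans ((add_sub_right_comm _ _ _).trans (congrArg₂ _ ?_ rfl)))
  exact ((mapDomain_sub _ _ _).trans (congrArg _ Finsupp.mapDomain_single)).symm

theorem bend_addSphere (T : Surface (a.removeArc s) (b.cap s)) (k : ℕ) :
    ((T.addSphere k).bend s h).Homeo ((T.bend s h).addSphere k) := by
  have key : ∀ p, (T.addSphere k).targetComp (capPoint s b p) =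
      ((T.bend s h).addSphere k).pt p := fun p =>
    targetComp_capPoint (T := T.addSphere k) (f := id)
      (g := ((T.bend s h).addSphere k).pt) (fun j => congrArg some
      (T.bend_pt_skip s h j).symm) ((T.bend s h).addSphere k).pt_target
      (congrArg some (bend_pt_left s h T))
      (fun i hi => congrArg some (bend_target_last s h T i hi)) p
  refine ⟨Equiv.refl _, key, fun _ => rfl, fun _ => rfl, ?_, Finsupp.mapDomain_id, rfl⟩
  refine Finsupp.mapDomain_id.trans ((congrArg (fun x => _ - Finsupp.single x 1)
    (key s.left)).trans ((add_sub_right_comm _ _ _).trans (congrArg₂ _ ?_ rfl)))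
  exact ((mapDomain_sub _ _ _).trans (congrArg _ Finsupp.mapDomain_single)).symm

/-- The strip contained in `F.cap s` merely prolongs the strip of the bending and can be absorbed.
This is the naturality required in `Bending`. -/
theorem bend_comp (T : Surface (a.removeArc s) (b.cap s)) (F : Surface b c) :
    ((T.comp (F.cap s)).bend s h).Homeo ((T.bend s h).comp F) := by
  let j₁ : T.Comp → ((T.bend s h).comp F).Comp := fun x => Quot.mk _ (Sum.inl x)
  let j₂ : F.Comp → ((T.bend s h).comp F).Comp := fun x => Quot.mk _ (Sum.inr x)
  have hj : ∀ p, j₁ ((T.bend s h).pt p) = j₂ (F.pt p) := fun p => Quot.sound (Meets.pt p)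
  let i₁ : T.Comp → (T.comp (F.cap s)).Comp := fun x => Quot.mk _ (Sum.inl x)
  let i₂ : F.Comp → (T.comp (F.cap s)).Comp := fun x => Quot.mk _ (Sum.inr (Quot.mk _ x))
  have hc : ∀ i, i₁ (T.target i) = Quot.mk _ (Sum.inr ((F.cap s).source i)) := fun i =>
    Quot.sound (Meets.circle i)
  have hi : ∀ p, i₁ ((T.bend s h).pt p) = i₂ (F.pt p) := by
    refine targetComp_capPoint (f := i₁) (g := fun p => i₂ (F.pt p)) ?_ ?_ ?_ ?_
    · exact fun j => Quot.sound (Meets.pt (S := T) (T := F.cap s) j)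
    · exact fun p => congrArg i₂ (F.pt_source p)
    · exact congrArg (fun x => Quot.mk _ (Sum.inr x)) (Quot.sound ⟨rfl, rfl⟩)
    · intro i hi
      rw [hc, cap_source_of_not_lt _ _ _ hi]
  let f : (T.comp (F.cap s)).Comp → ((T.bend s h).comp F).Comp :=
    Quot.lift (Sum.elim j₁ (Quot.lift j₂ (by
      rintro _ _ ⟨rfl, rfl⟩
      rw [← hj, ← hj, bend_pt_left]))) (by
      rintro _ _ (j | i)
      · change j₁ (T.pt j) = j₂ (F.pt (s.skip j))
        rw [← hj, bend_pt_skip]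
      · by_cases hi : i.1 < b.circles
        · rw [cap_source_of_lt _ _ _ hi]
          exact Quot.sound (Meets.circle (S := T.bend s h) (T := F) ⟨i.1, hi⟩)
        · rw [cap_source_of_not_lt _ _ _ hi]
          change j₁ (T.target i) = j₂ (F.pt s.left)
          rw [bend_target_last s h T i hi, hj])
  have hf : ∀ p, f ((T.comp (F.cap s)).targetComp (capPoint s c p)) =
      ((T.bend s h).comp F).pt p := by
    refine targetComp_capPoint (f := f) ?_ ((T.bend s h).comp F).pt_target ?_ ?_
    · intro j
      exact congrArg j₁ (T.bend_pt_skip s h j).symm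
    · exact congrArg j₁ (bend_pt_left s h T)
    · intro i hi
      change f (Quot.mk _ (Sum.inr ((F.cap s).target i))) = _
      rw [cap_target_of_not_lt _ _ _ hi, comp_pt]
      rfl
  refine Homeo.of_maps f
    (Quot.lift (Sum.elim i₁ i₂) ?_) ?_ ?_ hf ?_ ?_ ?_ ?_ rfl
  · rintro _ _ (p | i)
    · exact hi p
    · change i₁ (T.target (Fin.castLE _ i)) = _
      rw [hc]
      exact congrArg (fun x => Quot.mk _ (Sum.inr x)) (cap_source_of_lt _ _ _ i.2)
  · rintro ⟨x | x⟩
    · rfl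
    · obtain ⟨x⟩ := x; rfl
  · rintro ⟨x | x⟩ <;> rfl
  · intro i; rfl
  · intro i
    change f (Quot.mk _ (Sum.inr ((F.cap s).target (Fin.castLE _ i)))) = _
    rw [cap_target_of_lt _ _ _ i.2]
    rfl
  · have h1 : (T.comp (F.cap s)).euler.mapDomain f = T.euler.mapDomain j₁ + F.euler.mapDomain j₂ :=
      mapDomain_add_mapDomain _ _ _ _ _ _
    have h2 : ((T.bend s h).comp F).euler = T.euler.mapDomain j₁ -
        Finsupp.single (j₁ ((T.bend s h).pt s.left)) 1 + F.euler.mapDomain j₂ :=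
      congrArg (· + _) ((mapDomain_sub _ _ _).trans (congrArg _ Finsupp.mapDomain_single))
    rw [h2, sub_add_eq_add_sub, ← h1]
    exact (mapDomain_sub _ _ _).trans (congrArg _ (Finsupp.mapDomain_single.trans
      (congrArg (fun x => Finsupp.single x 1) (hf _))))
  · exact mapDomain_add_mapDomain _ _ _ _ _ _

/-! ### The birth and the death of a circle -/

/-- The cylinder over `a` together with a disc that is bounded by a new circle of the target and
carries `k` dots. -/
noncomputable def birth (a b : Diagram N) (hm : ∀ p, b.mate p = a.mate p) (k : ℕ) :
    Surface a b where
  Comp := Option a.Component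
  finite_comp := inferInstance
  pt p := some ((cylinder a).pt p)
  pt_source p := by rw [(cylinder a).pt_source]
  pt_target p := by rw [hm, (cylinder a).pt_source]
  source i := some (Sum.inr i)
  target i := if h : i.1 < a.circles then some (Sum.inr ⟨i.1, h⟩) else none
  euler := Finsupp.single none 1
  dots := Finsupp.single none k
  alpha := 0

/-- The cylinder over `b` together with a disc that is bounded by a circle of the source and
carries `k` dots. -/
noncomputable def death (a b : Diagram N) (hm : ∀ p, a.mate p = b.mate p) (k : ℕ) :
    Surface a b where
  Comp := Option b.Component
  finite_comp := inferInstance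
  pt p := some ((cylinder b).pt p)
  pt_source p := by rw [hm, (cylinder b).pt_source]
  pt_target p := by rw [(cylinder b).pt_source]
  source i := if h : i.1 < b.circles then some (Sum.inr ⟨i.1, h⟩) else none
  target i := some (Sum.inr i)
  euler := Finsupp.single none 1
  dots := Finsupp.single none k
  alpha := 0

/-- A triangle identity: the disc bounded by the new circle and the strip glued by bending form a
collar that can be pushed away. The `+1` of the disc cancels the `-1` of the strip in the Euler
characteristic. -/
theorem bend_birth_comp_cap (S : Surface a b) :
    (((birth (a.removeArc s) (a.cap s) (fun _ => rfl) 0).comp (S.cap s)).bend s h).Homeo S := by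
  let B := birth (a.removeArc s) (a.cap s) (fun _ => rfl) 0
  have hlr : S.pt s.left = S.pt s.right := by rw [← h, S.pt_source]
  let f : (B.comp (S.cap s)).Comp → S.Comp := Quot.lift (Sum.elim
    (fun x => Option.elim x (S.pt s.left) (Sum.elim (Quot.lift (fun j => S.pt (s.skip j)) (by
      rintro j _ rfl
      have := (S.cap s).pt_source j
      have h1 : s.skip ((a.removeArc s).mate j) = s.joinMate a (s.skip j) :=
        Diagram.skip_cap_mate s a j
      rw [h1, Slot.joinMate]
      split_ifs with e1 e2
      · rw [S.pt_source, ← hlr, ← e1, S.pt_source]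
      · rw [S.pt_source, hlr, ← e2, S.pt_source]
      · rw [S.pt_source])) S.source))
    (Quot.lift id (by rintro _ _ ⟨rfl, rfl⟩; exact hlr))) (by
      rintro _ _ (j | i)
      · rfl
      · by_cases hi : i.1 < a.circles
        · rw [cap_source_of_lt _ _ _ hi]
          have : B.target i = some (Sum.inr ⟨i.1, hi⟩) := dif_pos hi
          rw [this]; rfl
        · rw [cap_source_of_not_lt _ _ _ hi]
          have : B.target i = none := dif_neg hi
          rw [this]; rfl)
  have hf : ∀ p, f ((B.comp (S.cap s)).targetComp (capPoint s b p)) = S.pt p := by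
    refine targetComp_capPoint (f := f) (fun j => rfl) S.pt_target hlr ?_
    intro i hi
    change f (Quot.mk _ (Sum.inr ((S.cap s).target i))) = _
    rw [cap_target_of_not_lt _ _ _ hi]
    rfl
  refine Homeo.of_maps f (fun x => Quot.mk _ (Sum.inr (Quot.mk _ x))) ?_ (fun _ => rfl) hf
    (fun _ => rfl) ?_ ?_ ?_ (zero_add _)
  · have hnone : ∀ i : Fin (a.cap s).circles, ¬ i.1 < a.circles → B.target i = none := fun i hi =>
      dif_neg hi
    have hsome : ∀ (i : Fin (a.cap s).circles) (hi : i.1 < a.circles),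
      B.target i = some (Sum.inr ⟨i.1, hi⟩) := fun i hi => dif_pos hi
    have hm := fun i => Quot.sound (Meets.circle (S := B) (T := S.cap s) i)
    rintro ⟨(_ | (x | i)) | x⟩
    · have := hm ⟨a.circles, by simp [Diagram.cap, h]⟩
      rw [hnone _ (lt_irrefl _), cap_source_of_not_lt _ _ _ (lt_irrefl _)] at this
      exact this.symm
    · obtain ⟨j⟩ := x
      exact (Quot.sound (Meets.pt (S := B) (T := S.cap s) j)).symm
    · have := hm (Fin.castLE (Nat.le_add_right _ _) i)
      rw [hsome _ i.2, cap_source_of_lt _ _ _ i.2] at this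
      exact this.symm
    · obtain ⟨x⟩ := x; rfl
  · intro i
    change f (Quot.mk _ (Sum.inr ((S.cap s).target (Fin.castLE _ i)))) = _
    rw [cap_target_of_lt _ _ _ i.2]
    rfl
  · have : (B.comp (S.cap s)).euler.mapDomain f = Finsupp.single (S.pt s.left) 1 + S.euler :=
      (mapDomain_add_mapDomain f _ _ _ (Finsupp.single none 1) S.euler).trans
        (congrArg₂ _ Finsupp.mapDomain_single Finsupp.mapDomain_id)
    exact (mapDomain_sub _ _ _).trans ((congrArg₂ _ this (Finsupp.mapDomain_single.trans
      (congrArg (fun x => Finsupp.single x 1) (hf _)))).trans (add_sub_cancel_left _ _))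
  · refine (mapDomain_add_mapDomain f _ _ _ (Finsupp.single none 0) S.dots).trans
      ((congrArg₂ _ ?_ Finsupp.mapDomain_id).trans (zero_add _))
    rw [Finsupp.single_zero, Finsupp.mapDomain_zero]

-- The new component is a disc with one boundary circle, and the others are those of a cylinder.
open ParityMatching in
theorem hasGenus_birth (a b : Diagram N) (hm : ∀ p, b.mate p = a.mate p)
    (hc : b.circles = a.circles + 1) (k : ℕ) : (birth a b hm k).HasGenus := by
  obtain ⟨ma, ha1, ha2, ha3, ca⟩ := a
  obtain ⟨mb, hb1, hb2, hb3, cb⟩ := b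
  obtain rfl : mb = ma := funext hm
  obtain rfl : cb = ca + 1 := hc
  set a : Diagram N := ⟨mb, ha1, ha2, ha3, ca⟩
  rw [hasGenus_iff]
  intro (X : Option a.Component)
  obtain ⟨g, hg⟩ := (hasGenus_cylinder a).exists_fiber some X (fun p => some ((cylinder a).pt p))
    (fun _ => rfl) (fun p => congrArg some ((cylinder a).pt_source p))
    (fun p => congrArg some ((cylinder a).pt_source p))
  have he : (cylinder a).euler.mapDomain some X = 0 :=
    congrArg (fun e : Option a.Component →₀ ℤ => e X) Finsupp.mapDomain_zero
  rw [he] at hg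
  obtain ⟨n, hn⟩ : ∃ n, n = Nat.card { x : a.Component // some x = X } := ⟨_, rfl⟩
  obtain ⟨t, ht⟩ : ∃ t, t = Nat.card { i // (birth a ⟨mb, hb1, hb2, hb3, ca + 1⟩ hm k).target i =
    X } := ⟨_, rfl⟩
  obtain ⟨t₀, ht₀⟩ : ∃ t, t = Nat.card { i // some ((cylinder a).target i) = X } := ⟨_, rfl⟩
  have hcard : ((none : Option a.Component) = X → t = t₀ + if True then 1 else 0) ∧
      ((none : Option a.Component) ≠ X → t = t₀) := by
    rw [ht, ht₀]
    exact card_fin_fiber (k := ca + 1) rfl _ _ _ _ (fun i hi => dif_pos hi) (fun i hi => dif_neg hi)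
  refine ⟨g, ?_⟩
  change _ = 2 * (Nat.card { x : a.Component // some x = X } : ℤ) - _ -
    (_ + (Nat.card { i // some ((cylinder a).target i) = X } : ℤ)) at hg
  rw [← hn, ← ht₀] at hg
  rw [← ht]
  change (Finsupp.single none 1 : Option a.Component →₀ ℤ) X +
    Nat.card (EvenFiber (fun p => some ((cylinder a).pt p)) X) = 2 - 2 * (g : ℤ) -
      ((cycleCount (a.toParityMatching.halfPerm a.toParityMatching
        (fun p => some ((cylinder a).pt p)) _ _ X) : ℤ) +
      (Nat.card { i // some ((cylinder a).source i) = X } : ℤ) + _)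
  rcases X with _ | X
  · have := hcard.1 rfl
    rw [Finsupp.single_eq_same]
    have h0 : n = 0 := by rw [hn]; exact Finite.card_eq_zero_iff.mpr ⟨by simp⟩
    simp only [if_true] at this
    omega
  · have := hcard.2 (by simp)
    rw [Finsupp.single_eq_of_ne (by simp)]
    have h1 : n = 1 := by rw [hn]; simp
    omega

end Surface


/-! ### Exactness from contractibility after an additive functor -/

/-- A map `u : B ⟶ F.obj X` and additive maps `(B ⟶ F.obj Y) → (X ⟶ Y)`, natural in `Y`, by which
a map `x` can be recovered from `u ≫ F.map x`. -/
structure Bending {C D : Type*} [Category C] [Category D] [Preadditive C] [Preadditive D]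
    (F : C ⥤ D) (X : C) where
  base : D
  unit : base ⟶ F.obj X
  bend (Y : C) : (base ⟶ F.obj Y) →+ (X ⟶ Y)
  bend_comp {Y Z : C} (g : base ⟶ F.obj Y) (f : Y ⟶ Z) : bend Z (g ≫ F.map f) = bend Y g ≫ f
  bend_unit {Y : C} (x : X ⟶ Y) : bend Y (unit ≫ F.map x) = x

/-- A bending for a functor extends to the categories of matrices. -/
noncomputable def Bending.mapMat {C D : Type} [Category.{1} C] [Category.{1} D] [Preadditive C]
    [Preadditive D] {F : C ⥤ D} [F.Additive] {X : C} (β : Bending F X) :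
    Bending F.mapMat_ ((Mat_.embedding C).obj X) where
  base := (Mat_.embedding D).obj β.base
  unit := (Mat_.embedding D).map β.unit
  bend Y := AddMonoidHom.mk' (fun g _ j => β.bend _ (g PUnit.unit j)) (by
    intro f g
    ext i j
    exact map_add (β.bend _) _ _)
  bend_comp {Y Z} g f := by
    ext i k
    change β.bend _ (∑ j, g PUnit.unit j ≫ F.map (f j k)) = ∑ j, β.bend _ (g PUnit.unit j) ≫ f j k
    rw [map_sum]
    exact Finset.sum_congr rfl fun j _ => β.bend_comp _ _
  bend_unit {Y} x := by
    ext i j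
    change β.bend _ (∑ k : PUnit, β.unit ≫ F.map (x k j)) = x i j
    rw [Fintype.sum_unique]
    exact β.bend_unit _

/-- Through the bending, `Hom(X, Q)` is a retract of `Hom(β.base, F Q)`, on which the contraction of
`F Q` acts. -/
theorem Bending.homExact {C D : Type*} [Category C] [Category D] [Preadditive C] [Preadditive D]
    {F : C ⥤ D} [F.Additive] {X : C} (β : Bending F X) {Q : CochainComplex C ℤ}
    (h : Homotopy (𝟙 ((F.mapHomologicalComplex (ComplexShape.up ℤ)).obj Q)) 0) :
    HomExact X Q := by
  rintro i j k hij hjk x hx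
  obtain ⟨u, hu⟩ : ∃ u : F.obj (Q.X j) ⟶ F.obj (Q.X i), u = h.hom j i := ⟨_, rfl⟩
  obtain ⟨v, hv⟩ : ∃ v : F.obj (Q.X k) ⟶ F.obj (Q.X j), v = h.hom k j := ⟨_, rfl⟩
  have hc : 𝟙 (F.obj (Q.X j)) = F.map (Q.d j k) ≫ v + u ≫ F.map (Q.d i j) := by
    have hc := h.comm j
    rw [HomologicalComplex.zero_f, add_zero,
      dNext_eq h.hom (show (ComplexShape.up ℤ).Rel j k from hjk),
      prevD_eq h.hom (show (ComplexShape.up ℤ).Rel i j from hij)] at hc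
    rw [hu, hv]
    exact hc
  -- Map the cycle to the capped side, apply the contraction there, and bend back.
  refine ⟨β.bend _ (β.unit ≫ F.map x ≫ u), ?_⟩
  have e : F.map x = F.map x ≫ 𝟙 _ := (Category.comp_id _).symm
  rw [hc, Preadditive.comp_add, ← Category.assoc (F.map x), ← F.map_comp, hx, F.map_zero,
    zero_comp, zero_add] at e
  rw [← β.bend_comp, Category.assoc, Category.assoc, ← e, β.bend_unit]

/-- Exactness can be checked for the entries of an object of the category of matrices. -/
theorem homExact_of_entries {C : Type*} [Category C] [Preadditive C] {A : Mat_ C}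
    {Q : CochainComplex (Mat_ C) ℤ}
    (h : ∀ i, HomExact ((Mat_.embedding C).obj (A.X i)) Q) : HomExact A Q := by
  intro i j k hij hjk x hx
  have hrow : ∀ e : A.ι, ∃ y : (Mat_.embedding C).obj (A.X e) ⟶ Q.X i,
      y ≫ Q.d i j = fun _ l => x e l := by
    refine fun e => h e i j k hij hjk (fun _ l => x e l) ?_
    ext _ l
    exact congrArg (fun f : A ⟶ Q.X k => f e l) hx
  choose y hy using hrow
  refine ⟨fun e l => y e PUnit.unit l, ?_⟩
  ext e l
  exact congrArg (fun f : (Mat_.embedding C).obj (A.X e) ⟶ Q.X j => f PUnit.unit l) (hy e)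

/-! ### Bending morphisms of diagrams -/

variable {N M : ℕ}

/-- The shift compensates for the Euler characteristic of the strip, so that bending preserves
quantum degree zero. -/
def GradedDiagram.removeArc (s : Slot N M) (X : GradedDiagram N) : GradedDiagram M :=
  ⟨X.diagram.removeArc s, X.shift - 1⟩

/-- The bent surface is not given as a gluing of cobordisms, so it is recognised as a cobordism by
the genus of its components. -/
noncomputable def Cobordism.bend (s : Slot N M) {X Y : GradedDiagram N}
    (h : X.diagram.mate s.left = s.right)
    (T : Cobordism (X.removeArc s) ((capGraded s).obj Y)) : Cobordism X Y where
  surface := T.surface.bend s h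
  isCobordism := .of_genus _ (T.isCobordism.hasGenus.bend s h)
  degree_eq := by
    refine (Surface.degree_bend s h T.surface).trans ?_
    have h1 : (T.surface.degree : ℤ) = X.shift - 1 - Y.shift := T.degree_eq
    exact (congrArg (· + 1) h1).trans (by ring)

noncomputable def Cobordism.birthOfArc (s : Slot N M) (X : GradedDiagram N)
    (h : X.diagram.mate s.left = s.right) :
    Cobordism (X.removeArc s) ((capGraded s).obj X) where
  surface := Surface.birth (X.diagram.removeArc s) (X.diagram.cap s) (fun _ => rfl) 0
  isCobordism := .of_genus _ (Surface.hasGenus_birth _ _ _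
    (congrArg (X.diagram.circles + ·) (if_pos h)) _)
  degree_eq := by
    have h1 : (Surface.birth (X.diagram.removeArc s) (X.diagram.cap s) (fun _ => rfl) 0).euler.degree
      = 1 := Finsupp.degree_single _ _
    have h2 : (Surface.birth (X.diagram.removeArc s) (X.diagram.cap s) (fun _ => rfl) 0).dots.degree
      = 0 := Finsupp.degree_single _ _
    change 4 * ((0 : ℕ) : ℤ) + 2 * _ - _ = X.shift - 1 - X.shift
    rw [h1, h2]
    push_cast
    ring

theorem capDisc_map_toDisc (s : Slot N M) {X Y : GradedDiagram N} (F : Cobordism X Y) :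
    (capDisc s).map F.toDisc = (F.cap s).toDisc :=
  congrArg (CategoryTheory.Quotient.functor (localRel M)).map (capLinear_map_toLinear s F)

/-- Bending commutes with all local modifications and therefore carries each local relation to one
of the same kind. -/
theorem exists_bendDisc (s : Slot N M) {X : GradedDiagram N} (h : X.diagram.mate s.left = s.right)
    (Y : GradedDiagram N) : ∃ β : ((X.removeArc s).toDisc ⟶ ((capGraded s).obj Y).toDisc) →+
      (X.toDisc ⟶ Y.toDisc),
      ∀ T : Cobordism (X.removeArc s) ((capGraded s).obj Y), β T.toDisc = (T.bend s h).toDisc := by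
  refine exists_disc_addHom (fun T => (T.bend s h).toDisc)
    (fun F G hFG => Cobordism.toDisc_congr (Surface.bend_congr s h hFG)) ?_
  intro ψ hψ r hr
  have key : ∀ {S T : Surface (X.removeArc s).diagram ((capGraded s).obj Y).diagram},
    S.Homeo T → (S.bend s h).Homeo (T.bend s h) := Surface.bend_congr s h
  cases hr with
  | sphere_zero S F hF =>
    have := map_eq_zero_of_localRelation (.sphere_zero (S.bend s h) (F.bend s h)
      ((key hF).trans (Surface.bend_addSphere s h S 0)))
    rw [hψ]; exact this
  | sphere_one S F G hF hG =>
    have := map_eq_zero_of_localRelation (.sphere_one (S.bend s h) (F.bend s h) (G.bend s h)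
      ((key hF).trans (Surface.bend_addSphere s h S 1)) (key hG))
    rw [Functor.map_sub] at this
    rw [map_sub, hψ, hψ]; exact this
  | sphere_two S F hF =>
    have := map_eq_zero_of_localRelation (.sphere_two (S.bend s h) (F.bend s h)
      ((key hF).trans (Surface.bend_addSphere s h S 2)))
    rw [hψ]; exact this
  | sphere_three S F G hF hG =>
    have := map_eq_zero_of_localRelation (.sphere_three (S.bend s h) (F.bend s h) (G.bend s h)
      ((key hF).trans (Surface.bend_addSphere s h S 3))
      ((key hG).trans (Surface.bend_mulAlpha s h S)))
    rw [Functor.map_sub] at this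
    rw [map_sub, hψ, hψ]; exact this
  | tube S u v F G H hF hG hH =>
    have := map_eq_zero_of_localRelation (.tube (S.bend s h) u v (F.bend s h) (G.bend s h)
      (H.bend s h) ((key hF).trans (Surface.bend_addTube s h S u v))
      ((key hG).trans (Surface.bend_addDot s h S u)) ((key hH).trans (Surface.bend_addDot s h S v)))
    rw [Functor.map_sub, Functor.map_add] at this
    rw [map_sub, map_add, hψ, hψ, hψ]; exact this
  | handle S u F G hF hG =>
    have := map_eq_zero_of_localRelation (.handle (S.bend s h) u (F.bend s h) (G.bend s h)
      ((key hF).trans (Surface.bend_addHandle s h S u))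
      ((key hG).trans (Surface.bend_addDot s h S u)))
    rw [Functor.map_sub, Functor.map_add] at this
    rw [map_sub, map_add, hψ, hψ]; exact this

/-- The base is the diagram without its arc and the unit is the birth of a circle. Both conditions
are additive, so they reduce to the two homeomorphisms for single cobordisms. -/
theorem exists_bending_capDisc (s : Slot N M) {X : GradedDiagram N}
    (h : X.diagram.mate s.left = s.right) : Nonempty (Bending (capDisc s) X.toDisc) := by
  choose β hβ using exists_bendDisc s h
  let κ : ∀ Y Z : GradedDiagram N, (Y.toDisc ⟶ Z.toDisc) →+
    (((capGraded s).obj Y).toDisc ⟶ ((capGraded s).obj Z).toDisc) :=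
    fun Y Z => (capDisc s).mapAddHom
  let γ : ∀ {Y Z : GradedDiagram N}, Cobordism Y Z →
    Cobordism ((capGraded s).obj Y) ((capGraded s).obj Z) := fun F => F.cap s
  have hκ : ∀ {Y Z : GradedDiagram N} (F : Cobordism Y Z), κ Y Z F.toDisc = (γ F).toDisc :=
    fun F => capDisc_map_toDisc s F
  have hcomp : ∀ {Y Z : GradedDiagram N} (g : (X.removeArc s).toDisc ⟶ ((capGraded s).obj Y).toDisc)
      (f : Y.toDisc ⟶ Z.toDisc), β Z (g ≫ κ Y Z f) = β Y g ≫ f := by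
    intro Y Z g f
    refine disc_induction (p := fun f => β Z (g ≫ κ Y Z f) = β Y g ≫ f) ?_ ?_ ?_ ?_ f
    · rw [map_zero, comp_zero, comp_zero, map_zero]
    · intro f f' h h'
      rw [map_add, Preadditive.comp_add, Preadditive.comp_add, map_add, h, h']
    · intro f h
      rw [map_neg, Preadditive.comp_neg, Preadditive.comp_neg, map_neg, h]
    intro F
    refine disc_induction (p := fun g => β Z (g ≫ κ Y Z F.toDisc) = β Y g ≫ F.toDisc)
      ?_ ?_ ?_ ?_ g
    · rw [zero_comp, map_zero, map_zero, zero_comp]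
    · intro g g' h h'
      rw [Preadditive.add_comp, map_add, map_add, h, h', Preadditive.add_comp]
    · intro g h
      rw [Preadditive.neg_comp, map_neg, map_neg, h, Preadditive.neg_comp]
    intro T
    rw [hκ, ← Cobordism.toDisc_comp, hβ, hβ, ← Cobordism.toDisc_comp]
    exact Cobordism.toDisc_congr (Surface.bend_comp s h T.surface F.surface)
  have hunit : ∀ {Y : GradedDiagram N} (x : X.toDisc ⟶ Y.toDisc),
      β Y ((Cobordism.birthOfArc s X h).toDisc ≫ κ X Y x) = x := by
    intro Y x
    refine disc_induction (p := fun x => β Y ((Cobordism.birthOfArc s X h).toDisc ≫ κ X Y x) = x)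
      ?_ ?_ ?_ ?_ x
    · rw [map_zero, comp_zero, map_zero]
    · intro f f' h h'
      rw [map_add, Preadditive.comp_add, map_add, h, h']
    · intro f h
      rw [map_neg, Preadditive.comp_neg, map_neg, h]
    · intro F
      rw [hκ, ← Cobordism.toDisc_comp, hβ]
      exact Cobordism.toDisc_congr (Surface.bend_birth_comp_cap s h F.surface)
  exact ⟨{
    base := (X.removeArc s).toDisc
    unit := (Cobordism.birthOfArc s X h).toDisc
    bend := fun Y => β Y.as
    bend_comp := fun g f => hcomp g f
    bend_unit := fun x => hunit x }⟩

/-- Maps from a diagram with an arc between adjacent points to a complex that is contractible after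
these points are joined are exact. -/
theorem homExact_of_capDisc (s : Slot N M) {X : GradedDiagram N}
    (h : X.diagram.mate s.left = s.right) {Q : CochainComplex (Mat_ (DiscCob N)) ℤ}
    (hQ : Nonempty (Homotopy (𝟙 (((capDisc s).mapMat_.mapHomologicalComplex _).obj Q)) 0)) :
    HomExact ((Mat_.embedding _).obj X.toDisc) Q := by
  obtain ⟨β⟩ := exists_bending_capDisc s h
  obtain ⟨hQ⟩ := hQ
  exact β.mapMat.homExact hQ


/-! ### Diagrams without turnbacks -/

/-- An arc between two points of an interval forces an arc between adjacent points of it. -/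
theorem Diagram.exists_adjacent {N : ℕ} (a : Diagram N) (l r : ℕ) {p : Fin N} (hl : l ≤ p.1)
    (hp : p < a.mate p) (hr : (a.mate p).1 < r) :
    ∃ q : Fin N, l ≤ q.1 ∧ (a.mate q).1 = q.1 + 1 ∧ q.1 + 1 < r := by
  obtain ⟨d, hd⟩ : ∃ d, d = (a.mate p).1 - p.1 := ⟨_, rfl⟩
  induction d using Nat.strong_induction_on generalizing p with
  | _ d ih =>
    by_cases h1 : (a.mate p).1 = p.1 + 1
    · exact ⟨p, hl, h1, by omega⟩
    rw [Fin.lt_def] at hp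
    -- The arc at the next point lies strictly under the given one, hence is shorter; depending on
    -- its direction the induction continues from `q` or from its mate.
    let q : Fin N := ⟨p.1 + 1, by omega⟩
    have hq := a.noncrossing p q (by simp [q, Fin.lt_def]) (by simp only [q, Fin.lt_def]; omega)
    have hne := a.mate_ne q
    simp only [Fin.lt_def, ne_eq, Fin.ext_iff] at hq hne
    have hq1 : q.1 = p.1 + 1 := rfl
    by_cases h2 : q < a.mate q
    · rw [Fin.lt_def] at h2
      exact ih _ (by omega) (p := q) (by omega) h2 (by omega) rfl
    · rw [Fin.lt_def] at h2
      refine ih _ ?_ (p := a.mate q) (by omega) ?_ ?_ rfl <;> rw [a.mate_mate]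
      · omega
      · rw [Fin.lt_def]; omega
      · omega

/-- Without adjacent pairs among the first `n` points, no arc joins two of these points, so all of
them go to the other half, in reversed order since arcs do not cross. A decreasing map between two
sets of `n` consecutive points is the reversal. -/
theorem Diagram.mate_eq_rev {n : ℕ} (a : Diagram (n + n))
    (h1 : ∀ q : Fin (n + n), q.1 + 1 < n → (a.mate q).1 ≠ q.1 + 1) : a.mate = Fin.rev := by
  have hlt : ∀ p : Fin (n + n), p.1 < n → n ≤ (a.mate p).1 := by
    intro p hp
    by_contra! h
    have hne := a.mate_ne p
    rcases lt_or_gt_of_ne hne with h' | h'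
    · obtain ⟨q, -, h3, h4⟩ := a.exists_adjacent 0 n (p := a.mate p) (Nat.zero_le _)
        (by rwa [a.mate_mate]) (by rwa [a.mate_mate])
      exact h1 q h4 h3
    · obtain ⟨q, -, h3, h4⟩ := a.exists_adjacent 0 n (p := p) (Nat.zero_le _) h' h
      exact h1 q h4 h3
  have hdec : ∀ p q : Fin (n + n), p < q → q.1 < n → (a.mate q).1 < (a.mate p).1 := by
    intro p q hpq hq
    refine (a.noncrossing p q hpq ?_).2
    have := hlt p (by rw [Fin.lt_def] at hpq; omega)
    rw [Fin.lt_def]; omega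
  -- Strict monotonicity bounds each mate from above by counting from the first point and, in
  -- `hdown`, from below by counting from the `n`-th; the bounds coincide.
  have hup : ∀ (k : ℕ) (hk : k < n), (a.mate ⟨k, by omega⟩).1 + k + 1 ≤ n + n := by
    intro k
    induction k with
    | zero => intro hk; have := (a.mate ⟨0, by omega⟩).2; omega
    | succ k ih =>
      intro hk
      have := ih (by omega)
      have := hdec ⟨k, by omega⟩ ⟨k + 1, by omega⟩ (by simp [Fin.lt_def]) hk
      omega
  have hdown : ∀ (k : ℕ) (hk : k < n), n + k ≤ (a.mate ⟨n - 1 - k, by omega⟩).1 := by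
    intro k
    induction k with
    | zero => intro hk; exact hlt _ (by simp only; omega)
    | succ k ih =>
      intro hk
      have := ih (by omega)
      have := hdec ⟨n - 1 - (k + 1), by omega⟩ ⟨n - 1 - k, by omega⟩
        (by simp only [Fin.lt_def]; omega) (by simp only; omega)
      omega
  have key : ∀ p : Fin (n + n), p.1 < n → a.mate p = p.rev := by
    intro p hp
    have e1 := hup p.1 hp
    have e2 := hdown (n - 1 - p.1) (by omega)
    have e3 : (⟨n - 1 - (n - 1 - p.1), by omega⟩ : Fin (n + n)) = p := Fin.ext (by simp only; omega)
    rw [e3] at e2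
    ext
    rw [Fin.val_rev]
    simp only [Fin.eta] at e1
    omega
  funext p
  by_cases hp : p.1 < n
  · exact key p hp
  · have := key p.rev (by rw [Fin.val_rev]; omega)
    rw [Fin.rev_rev] at this
    rw [← this, a.mate_mate, this]

/-- Maps from a diagram that is not `n` parallel strands and circles to a complex that kills
turnbacks are exact. -/
theorem KillsTurnbacks.homExact {n : ℕ} {Q : CochainComplex (BN n n) ℤ} (hQ : KillsTurnbacks Q)
    {X : GradedDiagram (n + n)} (hX : X.diagram.mate ≠ Fin.rev) :
    HomExact ((Mat_.embedding _).obj X.toDisc) Q := by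
  by_cases h1 : ∃ q : Fin (n + n), q.1 + 1 < n ∧ (X.diagram.mate q).1 = q.1 + 1
  · obtain ⟨q, hq, h⟩ := h1
    exact homExact_of_capDisc (M := (n - 2) + n) ⟨by omega, q.1, by omega⟩ (X := X) (Fin.ext h)
      (hQ.above (n - 2) (by omega) q.1 (by omega))
  · push Not at h1
    exact absurd (X.diagram.mate_eq_rev h1) hX


/-! ### Delooping -/

namespace Surface

variable {N : ℕ}

open ParityMatching in
theorem hasGenus_death (a b : Diagram N) (hm : ∀ p, a.mate p = b.mate p)
    (hc : a.circles = b.circles + 1) (k : ℕ) : (death a b hm k).HasGenus := by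
  obtain ⟨ma, ha1, ha2, ha3, ca⟩ := a
  obtain ⟨mb, hb1, hb2, hb3, cb⟩ := b
  obtain rfl : ma = mb := funext hm
  obtain rfl : ca = cb + 1 := hc
  set b : Diagram N := ⟨ma, hb1, hb2, hb3, cb⟩
  rw [hasGenus_iff]
  intro (X : Option b.Component)
  obtain ⟨g, hg⟩ := (hasGenus_cylinder b).exists_fiber some X (fun p => some ((cylinder b).pt p))
    (fun _ => rfl) (fun p => congrArg some ((cylinder b).pt_source p))
    (fun p => congrArg some ((cylinder b).pt_source p))
  have he : (cylinder b).euler.mapDomain some X = 0 :=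
    congrArg (fun e : Option b.Component →₀ ℤ => e X) Finsupp.mapDomain_zero
  rw [he] at hg
  obtain ⟨n, hn⟩ : ∃ n, n = Nat.card { x : b.Component // some x = X } := ⟨_, rfl⟩
  obtain ⟨t, ht⟩ : ∃ t, t = Nat.card { i // (death ⟨ma, ha1, ha2, ha3, cb + 1⟩ b hm k).source i =
    X } := ⟨_, rfl⟩
  obtain ⟨t₀, ht₀⟩ : ∃ t, t = Nat.card { i // some ((cylinder b).source i) = X } := ⟨_, rfl⟩
  have hcard : ((none : Option b.Component) = X → t = t₀ + if True then 1 else 0) ∧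
      ((none : Option b.Component) ≠ X → t = t₀) := by
    rw [ht, ht₀]
    exact card_fin_fiber (k := cb + 1) rfl _ _ _ _ (fun i hi => dif_pos hi) (fun i hi => dif_neg hi)
  refine ⟨g, ?_⟩
  change _ = 2 * (Nat.card { x : b.Component // some x = X } : ℤ) - _ -
    (_ + (Nat.card { i // some ((cylinder b).source i) = X } : ℤ) + _) at hg
  rw [← hn, ← ht₀] at hg
  rw [← ht]
  change (Finsupp.single none 1 : Option b.Component →₀ ℤ) X +
    Nat.card (EvenFiber (fun p => some ((cylinder b).pt p)) X) = 2 - 2 * (g : ℤ) -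
      ((cycleCount (b.toParityMatching.halfPerm b.toParityMatching
        (fun p => some ((cylinder b).pt p)) _ _ X) : ℤ) + _ +
      (Nat.card { i // some ((cylinder b).target i) = X } : ℤ))
  rcases X with _ | X
  · have := hcard.1 rfl
    rw [Finsupp.single_eq_same]
    have h0 : n = 0 := by rw [hn]; exact Finite.card_eq_zero_iff.mpr ⟨by simp⟩
    simp only [if_true] at this
    omega
  · have := hcard.2 (by simp)
    rw [Finsupp.single_eq_of_ne (by simp)]
    have h1 : n = 1 := by rw [hn]; simp
    omega

section

variable {a b : Diagram N} (hm : ∀ p, b.mate p = a.mate p)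

theorem birth_target_of_lt (k : ℕ) (i : Fin b.circles) (hi : i.1 < a.circles) :
    (birth a b hm k).target i = some (Sum.inr ⟨i.1, hi⟩) := dif_pos hi

theorem birth_target_of_not_lt (k : ℕ) (i : Fin b.circles) (hi : ¬ i.1 < a.circles) :
    (birth a b hm k).target i = none := dif_neg hi

theorem death_source_of_lt (k : ℕ) (i : Fin b.circles) (hi : i.1 < a.circles) :
    (death b a hm k).source i = some (Sum.inr ⟨i.1, hi⟩) := dif_pos hi

theorem death_source_of_not_lt (k : ℕ) (i : Fin b.circles) (hi : ¬ i.1 < a.circles) :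
    (death b a hm k).source i = none := dif_neg hi

theorem comp_euler_of_single {c : Diagram N} {S : Surface a b} {T : Surface b c} {x : S.Comp}
    {y : T.Comp} {k l : ℤ} (hS : S.euler = Finsupp.single x k) (hT : T.euler = Finsupp.single y l) :
    (S.comp T).euler = Finsupp.single (Quot.mk _ (Sum.inl x)) k +
      Finsupp.single (Quot.mk _ (Sum.inr y)) l := by
  change S.euler.mapDomain _ + T.euler.mapDomain _ = _
  rw [hS, hT, Finsupp.mapDomain_single, Finsupp.mapDomain_single]

theorem comp_dots_of_single {c : Diagram N} {S : Surface a b} {T : Surface b c} {x : S.Comp}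
    {y : T.Comp} {k l : ℕ} (hS : S.dots = Finsupp.single x k) (hT : T.dots = Finsupp.single y l) :
    (S.comp T).dots = Finsupp.single (Quot.mk _ (Sum.inl x)) k +
      Finsupp.single (Quot.mk _ (Sum.inr y)) l := by
  change S.dots.mapDomain _ + T.dots.mapDomain _ = _
  rw [hS, hT, Finsupp.mapDomain_single, Finsupp.mapDomain_single]

/-- The two discs close up to a sphere with all the dots. Its value by the sphere relations gives
the orthogonality in delooping. -/
theorem birth_comp_death (hc : b.circles = a.circles + 1) (k l : ℕ) :
    ((birth a b hm k).comp (death b a hm l)).Homeo ((cylinder a).addSphere (k + l)) := by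
  have hq := fun i => Quot.sound (Meets.circle (S := birth a b hm k) (T := death b a hm l) i)
  let f : ((birth a b hm k).comp (death b a hm l)).Comp → Option a.Component :=
    Quot.lift (Sum.elim id id) (by rintro _ _ (p | i) <;> rfl)
  refine Homeo.of_maps f (fun x => Quot.mk _ (Sum.inl x)) ?_ (fun _ => rfl)
    (fun _ => rfl) (fun _ => rfl) (fun _ => rfl) ?_ ?_ rfl
  · rintro ⟨x | (_ | x | i)⟩
    · rfl
    · have := hq ⟨a.circles, by omega⟩
      rwa [birth_target_of_not_lt _ _ _ (lt_irrefl _),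
        death_source_of_not_lt _ _ _ (lt_irrefl _)] at this
    · obtain ⟨p⟩ := x
      exact Quot.sound (Meets.pt (S := birth a b hm k) (T := death b a hm l) p)
    · have := hq (Fin.castLE (by omega) i)
      rwa [birth_target_of_lt hm _ (Fin.castLE _ i) i.2,
        death_source_of_lt hm _ (Fin.castLE _ i) i.2] at this
  · rw [comp_euler_of_single (S := birth a b hm k) (T := death b a hm l) rfl rfl]
    refine Finsupp.mapDomain_add.trans ((congrArg₂ _ Finsupp.mapDomain_single
      Finsupp.mapDomain_single).trans ?_)
    refine (Finsupp.single_add _ _ _).symm.trans ?_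
    exact (congrArg (· + Finsupp.single (none : Option a.Component) (2 : ℤ))
      (Finsupp.mapDomain_zero (f := some)) |>.trans (zero_add _)).symm
  · rw [comp_dots_of_single (S := birth a b hm k) (T := death b a hm l) rfl rfl]
    refine Finsupp.mapDomain_add.trans ((congrArg₂ _ Finsupp.mapDomain_single
      Finsupp.mapDomain_single).trans ?_)
    refine (Finsupp.single_add _ _ _).symm.trans ?_
    exact (congrArg (· + Finsupp.single (none : Option a.Component) (k + l))
      (Finsupp.mapDomain_zero (f := some)) |>.trans (zero_add _)).symm

/-- Neck cutting in reverse: a tube between the two discs restores the annulus over the circle. The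
tube relation then writes the identity as a sum of two maps that pass through the diagram without
this circle. -/
theorem addTube_death_comp_birth (hc : b.circles = a.circles + 1) :
    (((death b a hm 0).comp (birth a b hm 0)).addTube (Quot.mk _ (Sum.inl none))
      (Quot.mk _ (Sum.inr none))).Homeo (cylinder b) := by
  let S := (death b a hm 0).comp (birth a b hm 0)
  let T := S.addTube (Quot.mk _ (Sum.inl none)) (Quot.mk _ (Sum.inr none))
  let c : Option a.Component → b.Component := fun x => Option.elim x (Sum.inr ⟨a.circles, by omega⟩)
    (Sum.elim (Quot.lift (fun p => Sum.inl (Quot.mk _ p)) (by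
      rintro p _ rfl
      rw [← hm]
      exact (cylinder b).pt_source p |>.symm)) (fun i => Sum.inr (Fin.castLE (by omega) i)))
  have hd : ∀ i, c ((death b a hm 0).source i) = Sum.inr i := by
    intro i
    by_cases hi : i.1 < a.circles
    · rw [death_source_of_lt _ _ _ hi]; rfl
    · rw [death_source_of_not_lt _ _ _ hi]
      exact congrArg Sum.inr (Fin.ext (by have := i.2; simp only; omega))
  have hbirth : ∀ i, c ((birth a b hm 0).target i) = Sum.inr i := hd
  let f : T.Comp → b.Component := Quot.lift (Quot.lift (Sum.elim c c) (by
    rintro _ _ (p | i) <;> rfl)) (by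
    rintro _ _ ⟨rfl, rfl⟩; rfl)
  have hr : ∀ x : Option a.Component, T.targetComp (c x) = Quot.mk _ (Quot.mk _ (Sum.inr x)) := by
    rintro (_ | x | i)
    · exact congrArg (fun x => Quot.mk _ (Quot.mk _ (Sum.inr x)))
        (birth_target_of_not_lt hm 0 _ (lt_irrefl _))
    · obtain ⟨p⟩ := x
      exact congrArg (Quot.mk _) (Quot.sound (Meets.pt (S := death b a hm 0) (T := birth a b hm 0) p))
    · exact congrArg (fun x => Quot.mk _ (Quot.mk _ (Sum.inr x)))
        (birth_target_of_lt hm 0 (Fin.castLE (by omega) i) i.2)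
  have hl : ∀ x : Option a.Component, (Quot.mk _ (Quot.mk _ (Sum.inl x)) : T.Comp) =
      Quot.mk _ (Quot.mk _ (Sum.inr x)) := by
    rintro (_ | x | i)
    · exact Quot.sound ⟨rfl, rfl⟩
    · obtain ⟨p⟩ := x
      exact congrArg (Quot.mk _) (Quot.sound (Meets.pt (S := death b a hm 0) (T := birth a b hm 0) p))
    · exact congrArg (Quot.mk _)
        (Quot.sound (Meets.circle (S := death b a hm 0) (T := birth a b hm 0) i))
  refine Homeo.of_maps f T.targetComp ?_ ?_ (fun _ => rfl) hd hbirth ?_ ?_ rfl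
  · rintro ⟨x⟩
    obtain ⟨x | x⟩ := x
    · exact (hr x).trans (hl x).symm
    · exact hr x
  · rintro (x | i)
    · obtain ⟨p⟩ := x; rfl
    · exact hbirth i
  · have h1 : S.euler = Finsupp.single (Quot.mk _ (Sum.inl none)) 1 +
        Finsupp.single (Quot.mk _ (Sum.inr none)) 1 :=
      comp_euler_of_single (S := death b a hm 0) (T := birth a b hm 0) rfl rfl
    refine Finsupp.mapDomain_add.trans ((congrArg₂ _ ((Finsupp.mapDomain_comp ..).symm.trans
      (congrArg _ h1 |>.trans (Finsupp.mapDomain_add.trans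
      (congrArg₂ _ Finsupp.mapDomain_single Finsupp.mapDomain_single)))) Finsupp.mapDomain_single).trans ?_)
    have h2 : (Finsupp.single (c none) 1 + Finsupp.single (c none) 1 +
        Finsupp.single (c none) (-2) : b.Component →₀ ℤ) = 0 := by
      rw [← Finsupp.single_add, ← Finsupp.single_add]
      exact Finsupp.single_zero _
    exact h2
  · have h1 : S.dots = 0 := by
      refine (comp_dots_of_single (S := death b a hm 0) (T := birth a b hm 0) rfl rfl).trans ?_
      rw [Finsupp.single_zero, Finsupp.single_zero]; rfl
    refine (Finsupp.mapDomain_comp ..).symm.trans ((congrArg _ h1).trans Finsupp.mapDomain_zero)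

theorem single_none_one {A : Type*} : (Finsupp.single none 0 + Finsupp.single none 1 : Option A →₀ ℕ) =
    Finsupp.single none 1 := by
  rw [Finsupp.single_zero, zero_add]

theorem birth_one_homeo :
    (birth a b hm 1).Homeo ((birth a b hm 0).addDot (none : Option a.Component)) :=
  ⟨Equiv.refl _, fun _ => rfl, fun _ => rfl, fun _ => rfl, Finsupp.mapDomain_id,
    Finsupp.mapDomain_id.trans single_none_one.symm, rfl⟩

theorem death_one_homeo :
    (death b a hm 1).Homeo ((death b a hm 0).addDot (none : Option a.Component)) :=
  ⟨Equiv.refl _, fun _ => rfl, fun _ => rfl, fun _ => rfl, Finsupp.mapDomain_id,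
    Finsupp.mapDomain_id.trans single_none_one.symm, rfl⟩

theorem death_comp_birth_addDot_left :
    ((death b a hm 1).comp (birth a b hm 0)).Homeo
      (((death b a hm 0).comp (birth a b hm 0)).addDot (Quot.mk _ (Sum.inl none))) :=
  (comp_congr (death_one_homeo hm) (.refl _)).trans (addDot_comp _ _ _)

theorem death_comp_birth_addDot_right :
    ((death b a hm 0).comp (birth a b hm 1)).Homeo
      (((death b a hm 0).comp (birth a b hm 0)).addDot (Quot.mk _ (Sum.inr none))) :=
  (comp_congr (.refl _) (birth_one_homeo hm)).trans (comp_addDot _ _ _)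

end

end Surface

/-! ### Births, deaths and delooping in the category of matrices. -/

variable {N : ℕ}

noncomputable def Cobordism.birth (X Y : GradedDiagram N)
    (hm : ∀ p, Y.diagram.mate p = X.diagram.mate p) (hc : Y.diagram.circles = X.diagram.circles + 1)
    (k : ℕ) (hk : 2 * (k : ℤ) - 1 = X.shift - Y.shift) : Cobordism X Y where
  surface := Surface.birth X.diagram Y.diagram hm k
  isCobordism := .of_genus _ (Surface.hasGenus_birth _ _ _ hc _)
  degree_eq := by
    have h1 : (Surface.birth X.diagram Y.diagram hm k).euler.degree = 1 := Finsupp.degree_single _ _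
    have h2 : (Surface.birth X.diagram Y.diagram hm k).dots.degree = k := Finsupp.degree_single _ _
    change 4 * ((0 : ℕ) : ℤ) + 2 * _ - _ = _
    rw [h1, h2, ← hk]
    push_cast
    ring

noncomputable def Cobordism.death (X Y : GradedDiagram N)
    (hm : ∀ p, X.diagram.mate p = Y.diagram.mate p) (hc : X.diagram.circles = Y.diagram.circles + 1)
    (k : ℕ) (hk : 2 * (k : ℤ) - 1 = X.shift - Y.shift) : Cobordism X Y where
  surface := Surface.death X.diagram Y.diagram hm k
  isCobordism := .of_genus _ (Surface.hasGenus_death _ _ _ hc _)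
  degree_eq := by
    have h1 : (Surface.death X.diagram Y.diagram hm k).euler.degree = 1 := Finsupp.degree_single _ _
    have h2 : (Surface.death X.diagram Y.diagram hm k).dots.degree = k := Finsupp.degree_single _ _
    change 4 * ((0 : ℕ) : ℤ) + 2 * _ - _ = _
    rw [h1, h2, ← hk]
    push_cast
    ring

theorem Cobordism.toDisc_eq_zero_of_sphere_zero {X Y : GradedDiagram N} {F : Cobordism X Y}
    {S : Surface X.diagram Y.diagram} (h : F.surface.Homeo (S.addSphere 0)) : F.toDisc = 0 :=
  map_eq_zero_of_localRelation (.sphere_zero S F h)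

theorem Cobordism.toDisc_eq_zero_of_sphere_two {X Y : GradedDiagram N} {F : Cobordism X Y}
    {S : Surface X.diagram Y.diagram} (h : F.surface.Homeo (S.addSphere 2)) : F.toDisc = 0 :=
  map_eq_zero_of_localRelation (.sphere_two S F h)

theorem Cobordism.toDisc_eq_of_sphere_one {X Y : GradedDiagram N} {F G : Cobordism X Y}
    (h : F.surface.Homeo (G.surface.addSphere 1)) : F.toDisc = G.toDisc := by
  have := map_eq_zero_of_localRelation (.sphere_one G.surface F G h (.refl _))
  rwa [Functor.map_sub, sub_eq_zero] at this

theorem Cobordism.toDisc_eq_of_handle {X Y : GradedDiagram N} {F G : Cobordism X Y}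
    {S : Surface X.diagram Y.diagram} {u : S.Comp} (hF : F.surface.Homeo (S.addHandle u))
    (hG : G.surface.Homeo (S.addDot u)) : F.toDisc = G.toDisc + G.toDisc := by
  have := map_eq_zero_of_localRelation (.handle S u F G hF hG)
  rwa [Functor.map_sub, Functor.map_add, sub_eq_zero] at this

theorem Cobordism.toDisc_eq_of_tube {X Y : GradedDiagram N} {F G H : Cobordism X Y}
    {S : Surface X.diagram Y.diagram} {u v : S.Comp} (hF : F.surface.Homeo (S.addTube u v))
    (hG : G.surface.Homeo (S.addDot u)) (hH : H.surface.Homeo (S.addDot v)) :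
    F.toDisc = G.toDisc + H.toDisc := by
  have := map_eq_zero_of_localRelation (.tube S u v F G H hF hG hH)
  rwa [Functor.map_sub, Functor.map_add, sub_eq_zero] at this

/-- The identity of a shifted diagram as a cobordism. -/
noncomputable def Cobordism.cylinder (X : GradedDiagram N) : Cobordism X X :=
  ⟨Surface.cylinder X.diagram, .cylinder _, by rw [Surface.degree_cylinder, sub_self]⟩

theorem Cobordism.toDisc_cylinder (X : GradedDiagram N) : (cylinder X).toDisc = 𝟙 X.toDisc :=
  toDisc_of_homeo_cylinder (.refl _)

/-- `B` is a direct summand of `A`. -/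
def IsSummand {C : Type*} [Category C] [Preadditive C] [HasBinaryBiproducts C] (B A : C) : Prop :=
  ∃ Z, Nonempty (A ≅ B ⊞ Z)

theorem IsSummand.trans {C : Type*} [Category C] [Preadditive C] [HasBinaryBiproducts C]
    {A B D : C} (h : IsSummand A B) (h' : IsSummand B D) : IsSummand A D := by
  obtain ⟨Z, ⟨e⟩⟩ := h
  obtain ⟨Z', ⟨e'⟩⟩ := h'
  exact ⟨Z ⊞ Z', ⟨e' ≪≫ biprod.mapIso e (Iso.refl _) ≪≫ biprod.associator _ _ _⟩⟩

theorem IsSummand.of_total {C : Type*} [Category C] [Preadditive C] [HasBinaryBiproducts C]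
    {A B Z : C} (i : B ⟶ A) (p : A ⟶ B) (j : Z ⟶ A) (q : A ⟶ Z) (hip : i ≫ p = 𝟙 B)
    (hiq : i ≫ q = 0) (hjp : j ≫ p = 0) (hjq : j ≫ q = 𝟙 Z) (h : p ≫ i + q ≫ j = 𝟙 A) :
    IsSummand B A :=
  ⟨Z, ⟨{
    hom := biprod.lift p q
    inv := biprod.desc i j
    hom_inv_id := by rw [biprod.lift_desc, h]
    inv_hom_id := by ext <;> simp [hip, hiq, hjp, hjq] }⟩⟩

theorem IsSummand.refl {C : Type*} [Category C] [Preadditive C] [HasBinaryBiproducts (Mat_ C)]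
    (A : Mat_ C) : IsSummand A A :=
  .of_total (Z := ⟨PEmpty, PEmpty.elim⟩) (𝟙 A) (𝟙 A) 0 0 (Category.comp_id _) comp_zero zero_comp
    (by ext i; exact i.elim) (by simp)

/-- Inclusions and projections are blocks of the identity matrix, so all identities among them are
entries of `𝟙 A ≫ 𝟙 A = 𝟙 A`. -/
theorem isSummand_entry {C : Type*} [Category C] [Preadditive C] [HasBinaryBiproducts (Mat_ C)]
    (A : Mat_ C) (e : A.ι) : IsSummand ((Mat_.embedding C).obj (A.X e)) A := by
  classical
  let Z : Mat_ C := ⟨{ i // i ≠ e }, fun i => A.X i.1⟩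
  have hid : ∀ l m, ∑ j, (𝟙 A : Mat_.Hom A A) l j ≫ (𝟙 A : Mat_.Hom A A) j m =
      (𝟙 A : Mat_.Hom A A) l m := fun l m => congrArg (fun f : A ⟶ A => f l m) (Category.comp_id (𝟙 A))
  refine IsSummand.of_total (Z := Z)
    (fun _ l => (𝟙 A : Mat_.Hom A A) e l) (fun l _ => (𝟙 A : Mat_.Hom A A) l e)
    (fun i l => (𝟙 A : Mat_.Hom A A) i.1 l) (fun l i => (𝟙 A : Mat_.Hom A A) l i.1) ?_ ?_ ?_ ?_ ?_
  · ext _ _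
    exact ((hid e e).trans (Mat_.id_apply_self A e)).trans
      (Mat_.id_apply_self ((Mat_.embedding C).obj (A.X e)) PUnit.unit).symm
  · ext _ l
    exact (hid e l.1).trans (Mat_.id_apply_of_ne A e l.1 l.2.symm)
  · ext l _
    exact (hid l.1 e).trans (Mat_.id_apply_of_ne A l.1 e l.2)
  · ext l m
    refine (hid l.1 m.1).trans ?_
    by_cases h : l = m
    · subst h
      rw [Mat_.id_apply_self]
      exact (Mat_.id_apply_self Z l).symm
    · rw [Mat_.id_apply_of_ne A l.1 m.1 fun h' => h (Subtype.ext h')]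
      exact (Mat_.id_apply_of_ne Z l m h).symm
  · ext l m
    refine Eq.trans ?_ (hid l m)
    refine Eq.trans ?_ (Fintype.sum_eq_add_sum_subtype_ne _ e).symm
    have h : ∑ j : PUnit, (𝟙 A : Mat_.Hom A A) l e ≫ (𝟙 A : Mat_.Hom A A) e m =
        (𝟙 A : Mat_.Hom A A) l e ≫ (𝟙 A : Mat_.Hom A A) e m := Fintype.sum_unique _
    exact congrArg (· + ∑ j : { i // i ≠ e },
      (𝟙 A : Mat_.Hom A A) l j.1 ≫ (𝟙 A : Mat_.Hom A A) j.1 m) h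

/-- A diagram with a circle is the sum of two shifts of the diagram without this circle. -/
theorem isSummand_deloop (X Y : GradedDiagram N)
    (hm : ∀ p, Y.diagram.mate p = X.diagram.mate p) (hc : Y.diagram.circles = X.diagram.circles + 1)
    (hs : X.shift = Y.shift - 1) [HasBinaryBiproducts (Mat_ (DiscCob N))] :
    IsSummand ((Mat_.embedding (DiscCob N)).obj X.toDisc)
      ((Mat_.embedding (DiscCob N)).obj Y.toDisc) := by
  let Z : GradedDiagram N := ⟨X.diagram, Y.shift + 1⟩
  -- In each of the two summands exactly one of birth and death carries a dot. The matching
  -- composites are spheres with one dot, and the mixed ones are spheres with zero or two dots.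
  let i := Cobordism.birth X Y hm hc 0 (by rw [hs]; norm_num)
  let p := Cobordism.death Y X hm hc 1 (by rw [hs]; norm_num)
  let j := Cobordism.birth Z Y hm hc 1 (by simp only [Z]; norm_num)
  let q := Cobordism.death Y Z hm hc 0 (by simp only [Z]; norm_num)
  have hip : i.toDisc ≫ p.toDisc = 𝟙 _ := by
    rw [← Cobordism.toDisc_comp, ← Cobordism.toDisc_cylinder]
    exact Cobordism.toDisc_eq_of_sphere_one (Surface.birth_comp_death hm hc 0 1)
  have hiq : i.toDisc ≫ q.toDisc = 0 := by
    rw [← Cobordism.toDisc_comp]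
    exact Cobordism.toDisc_eq_zero_of_sphere_zero (Surface.birth_comp_death hm hc 0 0)
  have hjp : j.toDisc ≫ p.toDisc = 0 := by
    rw [← Cobordism.toDisc_comp]
    exact Cobordism.toDisc_eq_zero_of_sphere_two (Surface.birth_comp_death hm hc 1 1)
  have hjq : j.toDisc ≫ q.toDisc = 𝟙 _ := by
    rw [← Cobordism.toDisc_comp, ← Cobordism.toDisc_cylinder]
    exact Cobordism.toDisc_eq_of_sphere_one (Surface.birth_comp_death hm hc 1 0)
  have h : p.toDisc ≫ i.toDisc + q.toDisc ≫ j.toDisc = 𝟙 _ := by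
    rw [← Cobordism.toDisc_comp, ← Cobordism.toDisc_comp, ← Cobordism.toDisc_cylinder]
    exact (Cobordism.toDisc_eq_of_tube (Surface.addTube_death_comp_birth hm hc).symm
      (Surface.death_comp_birth_addDot_left hm) (Surface.death_comp_birth_addDot_right hm)).symm
  let E := Mat_.embedding (DiscCob N)
  exact IsSummand.of_total (E.map i.toDisc) (E.map p.toDisc) (E.map j.toDisc) (E.map q.toDisc)
    (by rw [← E.map_comp, hip, E.map_id]) (by rw [← E.map_comp, hiq, E.map_zero])
    (by rw [← E.map_comp, hjp, E.map_zero]) (by rw [← E.map_comp, hjq, E.map_id])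
    (by rw [← E.map_comp, ← E.map_comp, ← E.map_add, h, E.map_id])

/-- Circles are removed one at a time, keeping the summand whose shift is lower by one. -/
theorem isSummand_identity {n : ℕ} (X : GradedDiagram (n + n)) (hX : X.diagram.mate = Fin.rev) :
    ∃ r, IsSummand (BN.identity n r) ((Mat_.embedding (DiscCob (n + n))).obj X.toDisc) := by
  obtain ⟨⟨m, h1, h2, h3, c⟩, k⟩ := X
  obtain rfl : m = Fin.rev := hX
  induction c generalizing k with
  | zero => exact ⟨k, .refl _⟩
  | succ c ih =>
    obtain ⟨r, hr⟩ := ih (k - 1)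
    exact ⟨r, hr.trans (isSummand_deloop ⟨⟨_, h1, h2, h3, c⟩, k - 1⟩
      ⟨⟨_, h1, h2, h3, c + 1⟩, k⟩ (fun _ => rfl) rfl rfl)⟩


/-! ### Endomorphisms of degree zero -/

theorem mapDomain_subtypeDomain_add_single {A R : Type*} [AddCommMonoid R] (e : A →₀ R) (x : A) :
    (e.subtypeDomain (· ≠ x)).mapDomain Subtype.val + Finsupp.single x (e x) = e := by
  ext y
  rw [Finsupp.add_apply]
  by_cases h : y = x
  · subst h
    rw [Finsupp.mapDomain_of_notMem_range _ _ (by simp), zero_add, Finsupp.single_eq_same]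
  · rw [Finsupp.mapDomain_apply Subtype.val_injective _ (⟨y, h⟩ : { y // y ≠ x }),
      Finsupp.single_eq_of_ne h, add_zero]
    rfl

namespace Surface

variable {N : ℕ} {a b : Diagram N}

theorem degree_congr {S T : Surface a b} (h : S.Homeo T) : S.degree = T.degree := by
  obtain ⟨e, -, -, -, h4, h5, h6⟩ := h
  rw [degree, degree, ← h4, ← h5, h6, Finsupp.degree_mapDomain, Finsupp.degree_mapDomain]

theorem degree_addSphere (S : Surface a b) (k : ℕ) :
    (S.addSphere k).degree = S.degree + 2 * k - 2 := by
  have h1 : (S.addSphere k).euler.degree = S.euler.degree + 2 :=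
    (map_add (Finsupp.degree : (Option S.Comp →₀ ℤ) →+ ℤ) _ _).trans
      (congrArg₂ _ (Finsupp.degree_mapDomain _ _) (Finsupp.degree_single _ _))
  have h2 : (S.addSphere k).dots.degree = S.dots.degree + k :=
    (map_add (Finsupp.degree : (Option S.Comp →₀ ℕ) →+ ℕ) _ _).trans
      (congrArg₂ _ (Finsupp.degree_mapDomain _ _) (Finsupp.degree_single _ _))
  have h3 : (S.addSphere k).alpha = S.alpha := rfl
  rw [degree, h1, h2, h3, degree]
  push_cast
  ring

theorem degree_addHandle (S : Surface a b) (u : S.Comp) :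
    (S.addHandle u).degree = S.degree + 2 := by
  have h1 : (S.addHandle u).euler.degree = S.euler.degree + -2 :=
    (map_add (Finsupp.degree : (S.Comp →₀ ℤ) →+ ℤ) _ _).trans
      (congrArg _ (Finsupp.degree_single _ _))
  have h2 : (S.addHandle u).dots.degree = S.dots.degree := rfl
  have h3 : (S.addHandle u).alpha = S.alpha := rfl
  rw [degree, h1, h2, h3, degree]
  ring

/-- Remove a closed component. -/
noncomputable def erase (S : Surface a b) (x : S.Comp) (hp : ∀ p, S.pt p ≠ x)
    (hs : ∀ i, S.source i ≠ x) (ht : ∀ i, S.target i ≠ x) : Surface a b where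
  Comp := { y // y ≠ x }
  finite_comp := by
    have := S.finite_comp
    infer_instance
  pt p := ⟨S.pt p, hp p⟩
  pt_source p := Subtype.ext (S.pt_source p)
  pt_target p := Subtype.ext (S.pt_target p)
  source i := ⟨S.source i, hs i⟩
  target i := ⟨S.target i, ht i⟩
  euler := S.euler.subtypeDomain (· ≠ x)
  dots := S.dots.subtypeDomain (· ≠ x)
  alpha := S.alpha

variable {S : Surface a b} {x : S.Comp} {hp : ∀ p, S.pt p ≠ x} {hs : ∀ i, S.source i ≠ x}
  {ht : ∀ i, S.target i ≠ x}

theorem HasGenus.erase (hS : S.HasGenus) : (S.erase x hp hs ht).HasGenus := by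
  rintro ⟨y, hy⟩
  obtain ⟨g, hg⟩ := hS y
  refine ⟨g, ?_⟩
  have h1 : (S.erase x hp hs ht).arcCount ⟨y, hy⟩ = S.arcCount y := by
    refine congrArg Set.ncard (Set.ext fun p => and_congr_left' ?_)
    exact Subtype.ext_iff
  have hl : ∀ l, ((S.erase x hp hs ht).loop l).1 = S.loop l := by rintro ⟨p⟩; rfl
  have h2 : (S.erase x hp hs ht).boundaryCount ⟨y, hy⟩ = S.boundaryCount y := by
    refine congrArg₂ _ (congrArg₂ _ ?_ ?_) ?_ <;> refine congrArg Set.ncard (Set.ext fun l => ?_)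
    · exact Subtype.ext_iff.trans (iff_of_eq (congrArg (· = y) (hl l)))
    · exact Subtype.ext_iff
    · exact Subtype.ext_iff
  rw [h1, h2]
  exact hg

theorem HasGenus.addSphere {S : Surface a b} (hS : S.HasGenus) (k : ℕ) :
    (S.addSphere k).HasGenus := by
  have hl : ∀ l, (S.addSphere k).loop l = some (S.loop l) := by rintro ⟨p⟩; rfl
  rintro (_ | (y : S.Comp))
  · refine ⟨0, ?_⟩
    have h1 : (S.addSphere k).arcCount none = 0 := by
      refine (congrArg Set.ncard (Set.eq_empty_of_forall_notMem ?_)).trans (Set.ncard_empty _)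
      rintro p ⟨h, -⟩
      exact Option.some_ne_none _ h
    have h2 : (S.addSphere k).boundaryCount none = 0 := by
      refine congrArg₂ (· + ·) (congrArg₂ (· + ·) (x' := 0) (y' := 0) ?_ ?_) (y' := 0) ?_ <;>
        refine (congrArg Set.ncard (Set.eq_empty_of_forall_notMem ?_)).trans (Set.ncard_empty _) <;>
        rintro l h
      · exact Option.some_ne_none _ ((hl l).symm.trans h)
      · exact Option.some_ne_none _ h
      · exact Option.some_ne_none _ h
    have h3 : (S.addSphere k).euler none = 2 := by
      refine (congrArg₂ (· + ·) (Finsupp.mapDomain_of_notMem_range _ _ (by simp))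
        Finsupp.single_eq_same).trans (zero_add _)
    rw [h1, h2, h3]
    norm_num
  · obtain ⟨g, hg⟩ := hS y
    refine ⟨g, ?_⟩
    have h1 : (S.addSphere k).arcCount (some y) = S.arcCount y :=
      congrArg Set.ncard (Set.ext fun p => and_congr_left' (Option.some_inj))
    have h2 : (S.addSphere k).boundaryCount (some y) = S.boundaryCount y := by
      refine congrArg₂ _ (congrArg₂ _ ?_ ?_) ?_ <;> refine congrArg Set.ncard (Set.ext fun l => ?_)
      · exact (iff_of_eq (congrArg (· = some y) (hl l))).trans Option.some_inj
      · exact Option.some_inj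
      · exact Option.some_inj
    have h3 : (S.addSphere k).euler (some y) = S.euler y := by
      refine (congrArg₂ (· + ·) (Finsupp.mapDomain_apply (Option.some_injective _) _ y)
        (Finsupp.single_eq_of_ne (by simp))).trans (add_zero _)
    rw [h1, h2, h3]
    exact hg

/-- A closed component of Euler characteristic `2` is a sphere, carrying the dots of `x`. -/
theorem erase_addSphere_homeo (he : S.euler x = 2) :
    ((S.erase x hp hs ht).addSphere (S.dots x)).Homeo S := by
  classical
  let f : Option { y // y ≠ x } → S.Comp := fun y => Option.elim y x Subtype.val
  refine Homeo.of_maps f (fun y => if h : y = x then none else some ⟨y, h⟩) ?_ ?_ (fun _ => rfl)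
    (fun _ => rfl) (fun _ => rfl) ?_ ?_ rfl
  · rintro (_ | y)
    · exact dif_pos rfl
    · exact dif_neg y.2
  · intro y
    by_cases h : y = x
    · exact (congrArg f (dif_pos h)).trans h.symm
    · exact congrArg f (dif_neg h)
  · have h1 := mapDomain_subtypeDomain_add_single S.euler x
    rw [he] at h1
    exact (Finsupp.mapDomain_add.trans (congrArg₂ _ (Finsupp.mapDomain_comp ..).symm
      Finsupp.mapDomain_single)).trans h1
  · have h1 := mapDomain_subtypeDomain_add_single S.dots x
    exact (Finsupp.mapDomain_add.trans (congrArg₂ _ (Finsupp.mapDomain_comp ..).symm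
      Finsupp.mapDomain_single)).trans h1

/-- A closed component of Euler characteristic `0` is a torus, that is, a sphere with a handle. -/
theorem erase_addSphere_addHandle_homeo (he : S.euler x = 0) (hd : S.dots x = 0) :
    (((S.erase x hp hs ht).addSphere 0).addHandle
      (none : Option { y // y ≠ x })).Homeo S := by
  classical
  let f : Option { y // y ≠ x } → S.Comp := fun y => Option.elim y x Subtype.val
  refine Homeo.of_maps f (fun y => if h : y = x then none else some ⟨y, h⟩) ?_ ?_ (fun _ => rfl)
    (fun _ => rfl) (fun _ => rfl) ?_ ?_ rfl
  · rintro (_ | y)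
    · exact dif_pos rfl
    · exact dif_neg y.2
  · intro y
    by_cases h : y = x
    · exact (congrArg f (dif_pos h)).trans h.symm
    · exact congrArg f (dif_neg h)
  · have h1 := mapDomain_subtypeDomain_add_single S.euler x
    rw [he, Finsupp.single_zero, add_zero] at h1
    have h2 : (Finsupp.single none 2 + Finsupp.single none (-2) : Option { y // y ≠ x } →₀ ℤ) = 0 :=
      (Finsupp.single_add _ _ _).symm.trans (Finsupp.single_zero _)
    refine (congrArg (Finsupp.mapDomain f) ((add_assoc _ _ _).trans
      ((congrArg _ h2).trans (add_zero _)))).trans ?_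
    exact (Finsupp.mapDomain_comp ..).symm.trans h1
  · have h1 := mapDomain_subtypeDomain_add_single S.dots x
    rw [hd] at h1
    exact (Finsupp.mapDomain_add.trans (congrArg₂ _ (Finsupp.mapDomain_comp ..).symm
      Finsupp.mapDomain_single)).trans h1

theorem addSphere_zero_addDot_homeo (S : Surface a b) :
    ((S.addSphere 0).addDot (none : Option S.Comp)).Homeo (S.addSphere 1) := by
  refine ⟨Equiv.refl _, fun _ => rfl, fun _ => rfl, fun _ => rfl, Finsupp.mapDomain_id,
    Finsupp.mapDomain_id.trans ((add_assoc _ _ _).trans (congrArg _ ?_)), rfl⟩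
  exact (Finsupp.single_add _ _ _).symm

/-- Source and target are the same diagram without circles, so every boundary circle consists of one
arc, its copy and two vertical segments. Thus a component has as many boundary circles as arcs. -/
theorem HasGenus.exists_euler_eq {S : Surface a a} (hS : S.HasGenus) (ha : a.circles = 0)
    (x : S.Comp) : ∃ g : ℕ, S.euler x = 2 - 2 * g - 2 * Nat.card (EvenFiber S.pt x) := by
  have : IsEmpty (Fin a.circles) := by rw [ha]; infer_instance
  rw [hasGenus_iff] at hS
  obtain ⟨g, hg⟩ := hS x
  have hs : Nat.card { i // S.source i = x } = 0 := Nat.card_of_isEmpty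
  have ht : Nat.card { i // S.target i = x } = 0 := Nat.card_of_isEmpty
  rw [hs, ht] at hg
  have h1 := cycleCount_halfPerm_self a.toParityMatching S.pt S.pt_source S.pt_target x
  obtain ⟨c, hc⟩ : ∃ c, c = cycleCount (a.toParityMatching.halfPerm a.toParityMatching S.pt
    S.pt_source S.pt_target x) := ⟨_, rfl⟩
  rw [← hc] at h1 hg
  rw [h1] at hg
  exact ⟨g, by push_cast at hg; linarith⟩

theorem exists_even_component (a : Diagram N) (x : Quot a.ArcRel) :
    ∃ p, Even p.1 ∧ Quot.mk _ p = x := by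
  obtain ⟨p, rfl⟩ := Quot.exists_rep x
  by_cases h : Even p.1
  · exact ⟨p, h, rfl⟩
  · exact ⟨a.mate p, (a.toParityMatching.even_mate p).mpr h, (Quot.sound (r := a.ArcRel) rfl).symm⟩

/-- With exactly one arc on each component and no circles, the components are the arcs of `a`. -/
theorem homeo_cylinder {S : Surface a a} (ha : a.circles = 0)
    (hcard : ∀ x, Nat.card (EvenFiber S.pt x) = 1) (he : S.euler = 0) (hd : S.dots = 0)
    (hα : S.alpha = 0) : S.Homeo (cylinder a) := by
  have : IsEmpty (Fin a.circles) := by rw [ha]; infer_instance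
  have hbij : Function.Bijective S.targetComp := by
    constructor
    · rintro (x | i) (y | j) h
      · obtain ⟨p, hp, rfl⟩ := exists_even_component a x
        obtain ⟨q, hq, rfl⟩ := exists_even_component a y
        change S.pt p = S.pt q at h
        have := (Nat.card_eq_one_iff_unique.mp (hcard (S.pt p))).1
        have e : (⟨p, hp, rfl⟩ : EvenFiber S.pt (S.pt p)) = ⟨q, hq, h.symm⟩ :=
          Subsingleton.elim _ _
        exact congrArg (fun x : EvenFiber S.pt (S.pt p) => Sum.inl (Quot.mk _ x.1)) e
      · exact isEmptyElim j
      · exact isEmptyElim i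
      · exact isEmptyElim i
    · intro x
      obtain ⟨p, -, hp⟩ := (Nat.card_eq_one_iff_unique.mp (hcard x)).2.some
      exact ⟨Sum.inl (Quot.mk _ p), hp⟩
  refine Homeo.symm ⟨Equiv.ofBijective _ hbij, fun _ => rfl, fun i => isEmptyElim i,
    fun i => isEmptyElim i, ?_, ?_, hα.symm⟩
  · rw [he]; exact Finsupp.mapDomain_zero
  · rw [hd]; exact Finsupp.mapDomain_zero

end Surface

/-- A cobordism of degree zero from a diagram without circles to itself is a multiple of the
identity modulo the local relations. -/
theorem Cobordism.toDisc_eq_zsmul_id {N : ℕ} {X : GradedDiagram N} (hX : X.diagram.circles = 0)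
    (F : Cobordism X X) : ∃ k : ℤ, F.toDisc = k • 𝟙 X.toDisc := by
  classical
  obtain ⟨m, hm⟩ : ∃ m, m = Nat.card F.surface.Comp := ⟨_, rfl⟩
  -- The induction removes closed components: a dotted sphere is `1`, and a torus is `2`.
  induction m using Nat.strong_induction_on generalizing F with
  | _ m ih =>
    have hempty : IsEmpty (Fin X.diagram.circles) := by rw [hX]; infer_instance
    let S := F.surface
    have hS : S.HasGenus := F.isCobordism.hasGenus
    have := S.finite_comp
    have := Fintype.ofFinite S.Comp
    have closed : ∀ x, Nat.card (EvenFiber S.pt x) = 0 → ∀ p, S.pt p ≠ x := by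
      intro x hx p hp
      have h0 : IsEmpty (EvenFiber S.pt x) := Finite.card_eq_zero_iff.mp hx
      obtain ⟨q, hq, hqp⟩ := Surface.exists_even_component X.diagram (Quot.mk _ p)
      refine h0.elim ⟨q, hq, ?_⟩
      have := congrArg (fun y => S.targetComp (Sum.inl y)) hqp
      exact Eq.trans this hp
    by_cases h0 : ∃ x, Nat.card (EvenFiber S.pt x) = 0 ∧ S.euler x = 2 ∧ S.dots x = 0
    · obtain ⟨x, hx, he, hd⟩ := h0
      refine ⟨0, ?_⟩
      rw [zero_smul]
      have := Surface.erase_addSphere_homeo (S := S) (hp := closed x hx)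
        (hs := fun i => isEmptyElim i) (ht := fun i => isEmptyElim i) he
      rw [hd] at this
      exact toDisc_eq_zero_of_sphere_zero this.symm
    push Not at h0
    -- By the Euler characteristic formula, only an undotted sphere has negative degree, and that
    -- case is already settled. In total degree zero every component then has degree zero and there
    -- is no `α`.
    have hnonneg : ∀ x, 0 ≤ 2 * (S.dots x : ℤ) - S.euler x := by
      intro x
      obtain ⟨g, hg⟩ := hS.exists_euler_eq hX x
      rw [hg]
      by_contra! hneg
      refine h0 x ?_ ?_ ?_ <;> omega
    have hdeg : 4 * (S.alpha : ℤ) + ∑ x, (2 * (S.dots x : ℤ) - S.euler x) = 0 := by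
      have := F.degree_eq
      rw [sub_self, Surface.degree, Finsupp.degree_eq_sum, Finsupp.degree_eq_sum] at this
      rw [Finset.sum_sub_distrib, ← Finset.mul_sum, ← this]
      push_cast
      ring
    have hsum := Finset.sum_nonneg fun x (_ : x ∈ Finset.univ) => hnonneg x
    have hterm : ∀ x, 2 * (S.dots x : ℤ) - S.euler x = 0 := by
      have : ∑ x, (2 * (S.dots x : ℤ) - S.euler x) = 0 := by omega
      rw [Finset.sum_eq_zero_iff_of_nonneg fun x _ => hnonneg x] at this
      exact fun x => this x (Finset.mem_univ x)
    have hα : S.alpha = 0 := by omega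
    by_cases h1 : ∃ x, Nat.card (EvenFiber S.pt x) = 0
    · obtain ⟨x, hx⟩ := h1
      let T := S.erase x (closed x hx) (fun i => isEmptyElim i) (fun i => isEmptyElim i)
      have hT : T.HasGenus := hS.erase
      have hcard : Nat.card T.Comp < m := by
        rw [hm]
        exact Finite.card_subtype_lt (x := x) (by simp)
      obtain ⟨g, hg⟩ := hS.exists_euler_eq hX x
      have hx1 := hterm x
      by_cases he : S.euler x = 2
      · have hd : S.dots x = 1 := by omega
        have hT' : (T.addSphere 1).Homeo S := by
          have := Surface.erase_addSphere_homeo (S := S) (hp := closed x hx)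
            (hs := fun i => isEmptyElim i) (ht := fun i => isEmptyElim i) he
          rwa [hd] at this
        let G : Cobordism X X := ⟨T, .of_genus _ hT, by
          rw [← F.degree_eq, ← Surface.degree_congr hT', Surface.degree_addSphere]; simp⟩
        obtain ⟨k, hk⟩ := ih _ hcard G rfl
        exact ⟨k, (toDisc_eq_of_sphere_one (G := G) hT'.symm).trans hk⟩
      -- A closed component of degree zero that is not a sphere has genus one and no dots. The
      -- handle relation replaces it by twice a dotted sphere.
      · have he' : S.euler x = 0 := by omega
        have hd : S.dots x = 0 := by omega
        have hT' : ((T.addSphere 0).addHandle (none : Option T.Comp)).Homeo S :=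
          Surface.erase_addSphere_addHandle_homeo he' hd
        have hdT : T.degree = X.shift - X.shift := by
          have h2 := Surface.degree_addHandle (T.addSphere 0) none
          rw [Surface.degree_addSphere, Surface.degree_congr hT', F.degree_eq] at h2
          rw [h2]; simp
        let G : Cobordism X X := ⟨T, .of_genus _ hT, hdT⟩
        let H : Cobordism X X := ⟨T.addSphere 1, .of_genus _ (hT.addSphere 1), by
          rw [Surface.degree_addSphere, hdT]; simp⟩
        obtain ⟨k, hk⟩ := ih _ hcard G rfl
        have h3 : F.toDisc = H.toDisc + H.toDisc :=
          toDisc_eq_of_handle hT'.symm (Surface.addSphere_zero_addDot_homeo T).symm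
        have h4 : H.toDisc = G.toDisc := toDisc_eq_of_sphere_one (.refl _)
        exact ⟨k + k, by rw [h3, h4, hk, add_smul]⟩
    · push Not at h1
      -- Without closed components, degree zero forces one arc, genus zero and no dots on each
      -- component.
      have key : ∀ x, Nat.card (EvenFiber S.pt x) = 1 ∧ S.euler x = 0 ∧ S.dots x = 0 := by
        intro x
        obtain ⟨g, hg⟩ := hS.exists_euler_eq hX x
        have hx1 := hterm x
        have hx2 := h1 x
        refine ⟨?_, ?_, ?_⟩ <;> omega
      refine ⟨1, ?_⟩
      rw [one_smul]
      exact toDisc_of_homeo_cylinder (Surface.homeo_cylinder hX (fun x => (key x).1)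
        (Finsupp.ext fun x => (key x).2.1) (Finsupp.ext fun x => (key x).2.2) hα)

theorem disc_eq_zsmul_id {N : ℕ} {X : GradedDiagram N} (hX : X.diagram.circles = 0)
    (f : X.toDisc ⟶ X.toDisc) : ∃ k : ℤ, f = k • 𝟙 X.toDisc := by
  refine disc_induction (p := fun f => ∃ k : ℤ, f = k • 𝟙 X.toDisc) ⟨0, (zero_smul _ _).symm⟩
    ?_ ?_ (fun F => F.toDisc_eq_zsmul_id hX) f
  · rintro _ _ ⟨k, rfl⟩ ⟨l, rfl⟩
    exact ⟨k + l, (add_smul _ _ _).symm⟩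
  · rintro _ ⟨k, rfl⟩
    exact ⟨-k, (neg_smul _ _).symm⟩


/-! ### A state sum -/

/-- A square root of twice the eigenvalue of the dot. -/
noncomputable def stateRoot (t : Bool) : ℂ := if t then (Real.sqrt 2 : ℂ) else Real.sqrt 2 * Complex.I

/-- The two eigenvalues of the dot for `α = 1`. -/
noncomputable def stateDot (t : Bool) : ℂ := if t then 1 else -1

theorem stateRoot_sq (t : Bool) : stateRoot t ^ (2 : ℤ) = 2 * stateDot t := by
  have h : ((Real.sqrt 2 : ℝ) : ℂ) ^ 2 = 2 := by
    rw [← Complex.ofReal_pow, Real.sq_sqrt (by norm_num)]; norm_num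
  have h2 : stateRoot t ^ (2 : ℤ) = stateRoot t ^ 2 := by norm_cast
  rw [h2]
  cases t
  · simp only [stateRoot, stateDot, Bool.false_eq_true, if_false]
    rw [mul_pow, h, Complex.I_sq]
  · simp only [stateRoot, stateDot, if_true]
    rw [h, mul_one]

theorem stateDot_mul_self (t : Bool) : stateDot t * stateDot t = 1 := by
  cases t <;> simp [stateDot]

theorem stateRoot_ne_zero (t : Bool) : stateRoot t ≠ 0 := by
  intro h
  have h1 := stateRoot_sq t
  have h2 := stateDot_mul_self t
  rw [h, zero_zpow _ (by norm_num)] at h1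
  have h3 : stateDot t = 0 := by simpa using h1.symm
  rw [h3] at h2
  simp at h2

namespace Surface

variable {N : ℕ} {a b : Diagram N}

/-- A component of colour `t` and Euler characteristic `χ` has weight `(2 * stateDot t) ^ (-χ / 2)`.
A square root has to be fixed because relative Euler characteristics can be odd. -/
noncomputable def eulerWeight {A : Type} (κ : A → Bool) (e : A →₀ ℤ) : ℂ :=
  e.prod fun x m => stateRoot (κ x) ^ (-m)

noncomputable def dotWeight {A : Type} (κ : A → Bool) (d : A →₀ ℕ) : ℂ :=
  d.prod fun x m => stateDot (κ x) ^ m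

section

variable {A B : Type} (κ : A → Bool)

theorem eulerWeight_add (e e' : A →₀ ℤ) :
    eulerWeight κ (e + e') = eulerWeight κ e * eulerWeight κ e' :=
  Finsupp.prod_add_index' (by simp) fun x m m' => by
    rw [neg_add, zpow_add₀ (stateRoot_ne_zero _)]

theorem eulerWeight_single (x : A) (m : ℤ) :
    eulerWeight κ (Finsupp.single x m) = stateRoot (κ x) ^ (-m) :=
  Finsupp.prod_single_index (by simp)

theorem eulerWeight_mapDomain (f : B → A) (e : B →₀ ℤ) :
    eulerWeight κ (e.mapDomain f) = eulerWeight (fun x => κ (f x)) e :=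
  Finsupp.prod_mapDomain_index (by simp) fun x m m' => by
    rw [neg_add, zpow_add₀ (stateRoot_ne_zero _)]

theorem dotWeight_add (d d' : A →₀ ℕ) : dotWeight κ (d + d') = dotWeight κ d * dotWeight κ d' :=
  Finsupp.prod_add_index' (by simp) fun x m m' => pow_add _ _ _

theorem dotWeight_single (x : A) (m : ℕ) :
    dotWeight κ (Finsupp.single x m) = stateDot (κ x) ^ m :=
  Finsupp.prod_single_index (by simp)

theorem dotWeight_mapDomain (f : B → A) (d : B →₀ ℕ) :
    dotWeight κ (d.mapDomain f) = dotWeight (fun x => κ (f x)) d :=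
  Finsupp.prod_mapDomain_index (by simp) fun x m m' => pow_add _ _ _

end

open Classical in
/-- The contribution of a colouring of the components to the state sum with boundary colouring
`c`. -/
noncomputable def stateWeight (c : Fin N → Bool) (S : Surface a b) (κ : S.Comp → Bool) : ℂ :=
  if ∀ p, κ (S.pt p) = c p then eulerWeight κ S.euler * dotWeight κ S.dots else 0

/-- The state sum over all colourings of the components with given colours of the marked points. -/
noncomputable def stateSum (c : Fin N → Bool) (S : Surface a b) : ℂ :=
  have := S.finite_comp
  have := Fintype.ofFinite (S.Comp → Bool)
  ∑ κ, S.stateWeight c κ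

theorem stateSum_eq (c : Fin N → Bool) (S : Surface a b) [Fintype (S.Comp → Bool)] :
    S.stateSum c = ∑ κ, S.stateWeight c κ := by
  unfold stateSum
  refine Finset.sum_congr ?_ fun _ _ => rfl
  ext; simp

variable (c : Fin N → Bool)

theorem stateSum_congr {S T : Surface a b} (h : S.Homeo T) : S.stateSum c = T.stateSum c := by
  classical
  obtain ⟨e, h1, -, -, h4, h5, -⟩ := h
  have := S.finite_comp
  have := T.finite_comp
  have := Fintype.ofFinite (S.Comp → Bool)
  have := Fintype.ofFinite (T.Comp → Bool)
  rw [stateSum_eq, stateSum_eq]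
  refine (Fintype.sum_equiv (Equiv.arrowCongr e.symm (Equiv.refl Bool)) _ _ fun κ => ?_).symm
  have hκ : (Equiv.arrowCongr e.symm (Equiv.refl Bool)) κ = fun x => κ (e x) := rfl
  rw [hκ, stateWeight, stateWeight, ← h4, ← h5, eulerWeight_mapDomain, dotWeight_mapDomain]
  simp only [← h1]

theorem stateSum_addSphere (S : Surface a b) (k : ℕ) : (S.addSphere k).stateSum c =
    S.stateSum c * ∑ t : Bool, stateRoot t ^ (-2 : ℤ) * stateDot t ^ k := by
  classical
  have := S.finite_comp
  have := Fintype.ofFinite S.Comp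
  have hF := Fintype.ofFinite (Option S.Comp → Bool)
  have h0 : (S.addSphere k).stateSum c =
      ∑ κ : Option S.Comp → Bool, (S.addSphere k).stateWeight c κ := @stateSum_eq _ _ _ c (S.addSphere k)
        hF
  rw [h0, stateSum_eq c S, Finset.sum_mul_sum, ← Fintype.sum_prod_type']
  let e : (Option S.Comp → Bool) ≃ (S.Comp → Bool) × Bool :=
    Equiv.piOptionEquivProd.trans (Equiv.prodComm _ _)
  refine Fintype.sum_equiv e _ _ fun (κ : Option S.Comp → Bool) => ?_
  have h1 : eulerWeight κ (S.euler.mapDomain some + Finsupp.single none 2) =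
      eulerWeight (fun x => κ (some x)) S.euler * stateRoot (κ none) ^ (-2 : ℤ) := by
    rw [eulerWeight_add, eulerWeight_single, eulerWeight_mapDomain]
  have h2 : dotWeight κ (S.dots.mapDomain some + Finsupp.single none k) =
      dotWeight (fun x => κ (some x)) S.dots * stateDot (κ none) ^ k := by
    rw [dotWeight_add, dotWeight_single, dotWeight_mapDomain]
  change _ = S.stateWeight c (fun x => κ (some x)) *
    (stateRoot (κ none) ^ (-2 : ℤ) * stateDot (κ none) ^ k)
  rw [stateWeight, ite_mul, zero_mul, mul_mul_mul_comm, ← h1, ← h2]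
  rfl

theorem stateSum_addDot (S : Surface a b) (u : S.Comp) [hF : Fintype (S.Comp → Bool)] :
    (S.addDot u).stateSum c = ∑ κ, S.stateWeight c κ * stateDot (κ u) := by
  have h0 : (S.addDot u).stateSum c = ∑ κ : S.Comp → Bool, (S.addDot u).stateWeight c κ :=
    @stateSum_eq _ _ _ c (S.addDot u) hF
  rw [h0]
  refine Finset.sum_congr rfl fun (κ : S.Comp → Bool) _ => ?_
  have h : dotWeight κ (S.dots + Finsupp.single u 1) = dotWeight κ S.dots * stateDot (κ u) := by
    rw [dotWeight_add, dotWeight_single, pow_one]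
  rw [stateWeight, ite_mul, zero_mul, mul_assoc, ← h]
  rfl

theorem stateSum_addHandle (S : Surface a b) (u : S.Comp) :
    (S.addHandle u).stateSum c = (S.addDot u).stateSum c + (S.addDot u).stateSum c := by
  have := S.finite_comp
  have hF := Fintype.ofFinite (S.Comp → Bool)
  have h0 : (S.addHandle u).stateSum c = ∑ κ : S.Comp → Bool, (S.addHandle u).stateWeight c κ :=
    @stateSum_eq _ _ _ c (S.addHandle u) hF
  rw [stateSum_addDot, h0, ← Finset.sum_add_distrib]
  refine Finset.sum_congr rfl fun (κ : S.Comp → Bool) _ => ?_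
  have h : eulerWeight κ (S.euler + Finsupp.single u (-2)) =
      eulerWeight κ S.euler * (2 * stateDot (κ u)) := by
    rw [eulerWeight_add, eulerWeight_single, neg_neg, stateRoot_sq]
  have h2 : (S.addHandle u).stateWeight c κ = S.stateWeight c κ * (2 * stateDot (κ u)) := by
    rw [stateWeight, ite_mul, zero_mul, mul_right_comm, ← h]
    rfl
  rw [h2]
  ring

/-- A tube forces its two ends to have one colour and contributes twice the eigenvalue of that
colour. On the other side, colourings that differ at `u` and `v` cancel, since the two eigenvalues
are opposite. -/
theorem stateSum_addTube (S : Surface a b) (u v : S.Comp) :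
    (S.addTube u v).stateSum c = (S.addDot u).stateSum c + (S.addDot v).stateSum c := by
  classical
  have := S.finite_comp
  have := Fintype.ofFinite (S.Comp → Bool)
  have := (S.addTube u v).finite_comp
  have := Fintype.ofFinite ((S.addTube u v).Comp → Bool)
  rw [stateSum_addDot, stateSum_addDot, stateSum_eq, ← Finset.sum_add_distrib]
  refine Finset.sum_of_injOn (fun κ x => κ (Quot.mk _ x)) ?_ (fun _ _ => Finset.mem_univ _) ?_ ?_
  · intro κ _ κ' _ h
    funext x
    obtain ⟨x, rfl⟩ := Quot.exists_rep x
    exact congrFun h x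
  · intro κ _ hκ
    have hne : κ u ≠ κ v := by
      intro h
      refine hκ ⟨Quot.lift κ (by rintro _ _ ⟨rfl, rfl⟩; exact h), Finset.mem_coe.mpr (Finset.mem_univ _), rfl⟩
    rw [← mul_add]
    have : stateDot (κ u) + stateDot (κ v) = 0 := by
      cases hu : κ u <;> cases hv : κ v <;> rw [hu, hv] at hne <;> simp_all [stateDot]
    rw [this, mul_zero]
  · intro (κ : Quot (fun x y => x = u ∧ y = v) → Bool) _
    have huv : κ (Quot.mk _ u) = κ (Quot.mk _ v) := congrArg κ (Quot.sound ⟨rfl, rfl⟩)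
    change _ = S.stateWeight c (fun x => κ (Quot.mk _ x)) * stateDot (κ (Quot.mk _ u)) +
      S.stateWeight c (fun x => κ (Quot.mk _ x)) * stateDot (κ (Quot.mk _ v))
    have h : eulerWeight κ (S.euler.mapDomain (Quot.mk _) + Finsupp.single (Quot.mk _ u) (-2)) =
        eulerWeight (fun x => κ (Quot.mk _ x)) S.euler * (2 * stateDot (κ (Quot.mk _ u))) := by
      rw [eulerWeight_add, eulerWeight_single, neg_neg, stateRoot_sq, eulerWeight_mapDomain]
    have h' : dotWeight κ (S.dots.mapDomain (Quot.mk _)) =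
        dotWeight (fun x => κ (Quot.mk _ x)) S.dots := dotWeight_mapDomain _ _ _
    rw [← huv, ← mul_add, ← two_mul, stateWeight, ite_mul, zero_mul, mul_right_comm, ← h, ← h']
    rfl

/-- The state sum sets `α = 1`. -/
theorem stateSum_mulAlpha (S : Surface a b) : S.mulAlpha.stateSum c = S.stateSum c := rfl

/-- Colours of components are constant along the arcs of the middle diagram, so a boundary colouring
that is not constant along them admits no colouring of the components. -/
theorem stateSum_comp_eq_zero {d : Diagram N} (S : Surface a b) (T : Surface b d)
    (h : ∃ p, c (b.mate p) ≠ c p) : (S.comp T).stateSum c = 0 := by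
  obtain ⟨p, hp⟩ := h
  unfold stateSum
  refine Finset.sum_eq_zero fun κ _ => if_neg fun hκ => hp ?_
  rw [← hκ, ← hκ]
  exact congrArg (fun x => κ (Quot.mk _ (Sum.inl x))) (S.pt_target p)

/-- Every component meets the marked points, so the boundary colours determine the only admissible
colouring, and its weight is `1`. -/
theorem stateSum_cylinder (ha : a.circles = 0) (hc : ∀ p, c (a.mate p) = c p) :
    (cylinder a).stateSum c = 1 := by
  have : IsEmpty (Fin a.circles) := by rw [ha]; infer_instance
  let κ₀ : (cylinder a).Comp → Bool := Sum.elim (Quot.lift c (by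
    rintro p _ rfl; exact (hc p).symm)) (fun i => isEmptyElim i)
  unfold stateSum
  refine (Finset.sum_eq_single κ₀ (fun κ _ hκ => if_neg fun h => hκ ?_) (by simp)).trans ?_
  · funext x
    rcases x with x | i
    · obtain ⟨p⟩ := x; exact h p
    · exact isEmptyElim i
  · refine (if_pos fun p => rfl).trans ?_
    exact (congrArg₂ (· * ·) Finsupp.prod_zero_index Finsupp.prod_zero_index).trans (mul_one 1)

theorem sum_stateRoot_stateDot : (∑ t : Bool, stateRoot t ^ (-2 : ℤ) * stateDot t ^ 0 = 0) ∧
    (∑ t : Bool, stateRoot t ^ (-2 : ℤ) * stateDot t ^ 1 = 1) ∧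
    (∑ t : Bool, stateRoot t ^ (-2 : ℤ) * stateDot t ^ 2 = 0) ∧
    (∑ t : Bool, stateRoot t ^ (-2 : ℤ) * stateDot t ^ 3 = 1) := by
  simp only [zpow_neg, stateRoot_sq, Fintype.sum_bool, stateDot]
  norm_num

end Surface

/-! ### The state sum as an invariant of morphisms. -/

variable {N : ℕ}

theorem exists_stateSum (c : Fin N → Bool) (X Y : GradedDiagram N) :
    ∃ ψ : (X.toDisc ⟶ Y.toDisc) →+ ℂ, ∀ F : Cobordism X Y, ψ F.toDisc = F.surface.stateSum c := by
  refine exists_disc_addHom (fun F => F.surface.stateSum c)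
    (fun F G hFG => Surface.stateSum_congr c hFG) ?_
  intro ψ hψ r hr
  obtain ⟨h0, h1, h2, h3⟩ := Surface.sum_stateRoot_stateDot
  cases hr with
  | sphere_zero S F hF =>
    rw [hψ, Surface.stateSum_congr c hF, Surface.stateSum_addSphere, h0, mul_zero]
  | sphere_one S F G hF hG =>
    rw [map_sub, hψ, hψ, Surface.stateSum_congr c hF, Surface.stateSum_congr c hG,
      Surface.stateSum_addSphere, h1, mul_one, sub_self]
  | sphere_two S F hF =>
    rw [hψ, Surface.stateSum_congr c hF, Surface.stateSum_addSphere, h2, mul_zero]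
  | sphere_three S F G hF hG =>
    rw [map_sub, hψ, hψ, Surface.stateSum_congr c hF, Surface.stateSum_congr c hG,
      Surface.stateSum_addSphere, h3, mul_one, Surface.stateSum_mulAlpha, sub_self]
  | tube S u v F G H hF hG hH =>
    rw [map_sub, map_add, hψ, hψ, hψ, Surface.stateSum_congr c hF, Surface.stateSum_congr c hG,
      Surface.stateSum_congr c hH, Surface.stateSum_addTube, sub_self]
  | handle S u F G hF hG =>
    rw [map_sub, map_add, hψ, hψ, Surface.stateSum_congr c hF, Surface.stateSum_congr c hG,
      Surface.stateSum_addHandle, sub_self]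

/-- An additive functional with values in `ℂ` that takes the value `1` on the identity separates its
integer multiples. -/
theorem zsmul_id_injective {X : GradedDiagram N} (hX : X.diagram.circles = 0) {k l : ℤ}
    (h : k • 𝟙 X.toDisc = l • 𝟙 X.toDisc) : k = l := by
  obtain ⟨ψ, hψ⟩ := exists_stateSum (fun _ => true) X X
  have h1 : ψ (𝟙 X.toDisc) = 1 := by
    rw [← Cobordism.toDisc_cylinder, hψ]
    exact Surface.stateSum_cylinder _ hX fun _ => rfl
  have h2 := congrArg ψ h
  rw [map_zsmul, map_zsmul, h1, zsmul_one, zsmul_one] at h2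
  exact_mod_cast h2

/-- A map of degree zero between equal diagrams without circles vanishes if it factors through a
diagram with other arcs. -/
theorem disc_comp_eq_zero {X Y : GradedDiagram N} (hX : X.diagram.circles = 0)
    (hY : Y.diagram.mate ≠ X.diagram.mate) (f : X.toDisc ⟶ Y.toDisc) (g : Y.toDisc ⟶ X.toDisc) :
    f ≫ g = 0 := by
  classical
  obtain ⟨p, hp⟩ := Function.ne_iff.mp hY
  -- The colouring marks a single arc of `X`, chosen at a point where `Y` has another arc. The state
  -- sum then vanishes on maps through `Y` but is `1` on the identity of `X`.
  let c : Fin N → Bool := fun q => decide (q = p ∨ q = X.diagram.mate p)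
  have hc : ∀ q, c (X.diagram.mate q) = c q := by
    intro q
    have := X.diagram.mate_mate
    refine decide_eq_decide.mpr ?_
    grind
  have hc' : ∃ q, c (Y.diagram.mate q) ≠ c q := by
    refine ⟨p, ?_⟩
    simp [c, hp, Y.diagram.mate_ne]
  obtain ⟨ψ, hψ⟩ := exists_stateSum c X X
  have h1 : ψ (𝟙 X.toDisc) = 1 := by
    rw [← Cobordism.toDisc_cylinder, hψ]
    exact Surface.stateSum_cylinder _ hX hc
  have h2 : ψ (f ≫ g) = 0 := by
    refine disc_induction (p := fun f => ψ (f ≫ g) = 0) ?_ ?_ ?_ ?_ f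
    · rw [zero_comp, map_zero]
    · intro f f' h h'; rw [Preadditive.add_comp, map_add, h, h', add_zero]
    · intro f h; rw [Preadditive.neg_comp, map_neg, h, neg_zero]
    intro F
    refine disc_induction (p := fun g => ψ (F.toDisc ≫ g) = 0) ?_ ?_ ?_ ?_ g
    · rw [comp_zero, map_zero]
    · intro f f' h h'; rw [Preadditive.comp_add, map_add, h, h', add_zero]
    · intro f h; rw [Preadditive.comp_neg, map_neg, h, neg_zero]
    intro G
    rw [← Cobordism.toDisc_comp, hψ]
    exact Surface.stateSum_comp_eq_zero c _ _ hc'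
  obtain ⟨k, hk⟩ := disc_eq_zsmul_id hX (f ≫ g)
  rw [hk, map_zsmul, h1, zsmul_one] at h2
  have : k = 0 := by exact_mod_cast h2
  rw [hk, this, zero_smul]


/-! ### Universal projectors -/

variable {n : ℕ}

/-- An entry with the arcs of `1_n` and any number of circles would deloop and contribute a shift of
`1_n` as a summand. -/
theorem UniversalProjector.mate_ne_rev (P : UniversalProjector n) {i : ℤ} (hi : i ≠ 0)
    (e : (P.complex.X i).ι) (X : GradedDiagram (n + n)) (hX : X.toDisc = (P.complex.X i).X e) :
    X.diagram.mate ≠ Fin.rev := by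
  intro h
  obtain ⟨r, hr⟩ := isSummand_identity X h
  rw [hX] at hr
  obtain ⟨Z, ⟨f⟩⟩ := hr.trans (isSummand_entry (P.complex.X i) e)
  exact (P.not_summand i hi r Z).false f

theorem UniversalProjector.homExact (P Q : UniversalProjector n) {i : ℤ} (hi : i < 0) :
    HomExact (P.complex.X i) Q.complex :=
  homExact_of_entries fun e => Q.killsTurnbacks.homExact (X := ((P.complex.X i).X e).as)
    (P.mate_ne_rev hi.ne e _ rfl)

theorem BN.map_embedding_zsmul_id (n : ℕ) (k : ℤ) :
    (Mat_.embedding (DiscCob (n + n))).map (k • 𝟙 (GradedDiagram.toDisc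
      (⟨Diagram.identity n, 0⟩ : GradedDiagram (n + n)))) = k • 𝟙 (BN.identity n 0) := by
  rw [Functor.map_zsmul, CategoryTheory.Functor.map_id]
  rfl

theorem BN.identity_endomorphism (f : BN.identity n 0 ⟶ BN.identity n 0) :
    ∃ k : ℤ, f = k • 𝟙 (BN.identity n 0) := by
  obtain ⟨k, hk⟩ := disc_eq_zsmul_id (X := ⟨Diagram.identity n, 0⟩) rfl
    (f PUnit.unit PUnit.unit)
  refine ⟨k, Eq.trans ?_ (BN.map_embedding_zsmul_id n k)⟩
  ext i j
  exact hk

theorem BN.zsmul_id_injective {k l : ℤ}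
    (h : k • 𝟙 (BN.identity n 0) = l • 𝟙 (BN.identity n 0)) : k = l := by
  rw [← BN.map_embedding_zsmul_id, ← BN.map_embedding_zsmul_id] at h
  exact BarNatan.zsmul_id_injective (X := ⟨Diagram.identity n, 0⟩) rfl
    (congrFun (congrFun h PUnit.unit) PUnit.unit)

/-- Endomorphisms of `1_n` that factor through another chain group of a projector vanish. -/
theorem UniversalProjector.comp_eq_zero (P : UniversalProjector n) {i : ℤ} (hi : i ≠ 0)
    (f : BN.identity n 0 ⟶ P.complex.X i) (g : P.complex.X i ⟶ BN.identity n 0) : f ≫ g = 0 := by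
  ext a b
  refine Finset.sum_eq_zero fun e _ => ?_
  exact disc_comp_eq_zero (X := ⟨Diagram.identity n, 0⟩) (Y := ((P.complex.X i).X e).as) rfl
    (P.mate_ne_rev hi e _ rfl) (f a e) (g e b)

theorem UniversalProjector.ι_comp_eq_iff (P Q : UniversalProjector n) (ψ : P.complex ⟶ Q.complex) :
    P.ι ≫ ψ = Q.ι ↔ P.zeroIso.hom ≫ ψ.f 0 = Q.zeroIso.hom := by
  constructor
  · intro h
    have h1 := congrArg (fun f => f.f 0) h
    simpa [UniversalProjector.ι, HomologicalComplex.mkHomFromSingle_f] using h1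
  · intro h
    apply HomologicalComplex.from_single_hom_ext
    simp [UniversalProjector.ι, HomologicalComplex.mkHomFromSingle_f, h]

/-- Existence and, in `homotopy_of_eq`, uniqueness up to homotopy both rest on the exactness of maps
from the negative chain groups of `P` to `Q`. -/
theorem UniversalProjector.exists_extension (P Q : UniversalProjector n)
    (f : P.complex.X 0 ⟶ Q.complex.X 0) : ∃ ψ : P.complex ⟶ Q.complex, ψ.f 0 = f :=
  exists_chainMap_of_homExact Q.isZero_of_pos (fun _ hi => P.homExact Q hi) f

theorem UniversalProjector.homotopy_of_eq (P Q : UniversalProjector n) {f g : P.complex ⟶ Q.complex}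
    (h : f.f 0 = g.f 0) : Nonempty (Homotopy f g) := by
  obtain ⟨H⟩ := homotopy_zero_of_homExact P.isZero_of_pos (fun _ hi => P.homExact Q hi) (f - g)
    (by rw [HomologicalComplex.sub_f_apply, h, sub_self])
  exact ⟨Homotopy.equivSubZero.symm H⟩

/-- The component in degree zero of a homotopy equivalence of projectors is the identity of `1_n` up
to a sign. -/
theorem UniversalProjector.eq_or_eq_neg (P Q : UniversalProjector n)
    (e : HomotopyEquiv P.complex Q.complex) :
    e.hom.f 0 = P.zeroIso.inv ≫ Q.zeroIso.hom ∨ e.hom.f 0 = -(P.zeroIso.inv ≫ Q.zeroIso.hom) := by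
  obtain ⟨k, hk⟩ := BN.identity_endomorphism (P.zeroIso.hom ≫ e.hom.f 0 ≫ Q.zeroIso.inv)
  obtain ⟨l, hl⟩ := BN.identity_endomorphism (Q.zeroIso.hom ≫ e.inv.f 0 ≫ P.zeroIso.inv)
  obtain ⟨y, hy⟩ := exists_factor_of_homotopy (P.isZero_of_pos 1 one_pos) e.homotopyHomInvId
  have h1 : (P.zeroIso.hom ≫ e.hom.f 0 ≫ Q.zeroIso.inv) ≫
      (Q.zeroIso.hom ≫ e.inv.f 0 ≫ P.zeroIso.inv) = 𝟙 _ := by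
    -- The correction due to the homotopy passes through `P.complex.X (-1)` and therefore vanishes
    -- between copies of `1_n`.
    have h2 := P.comp_eq_zero (i := -1) (by norm_num) (P.zeroIso.hom ≫ y)
      (P.complex.d (-1) 0 ≫ P.zeroIso.inv)
    have h3 : (P.zeroIso.hom ≫ e.hom.f 0 ≫ Q.zeroIso.inv) ≫
        (Q.zeroIso.hom ≫ e.inv.f 0 ≫ P.zeroIso.inv) =
        P.zeroIso.hom ≫ (e.hom ≫ e.inv).f 0 ≫ P.zeroIso.inv := by
      simp
    rw [h3, hy, Preadditive.add_comp, Preadditive.comp_add]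
    simp only [Category.assoc] at h2 ⊢
    rw [h2]
    simp
  rw [hk, hl, Preadditive.zsmul_comp, Category.id_comp, smul_smul] at h1
  have h4 : k * l = 1 := BN.zsmul_id_injective (h1.trans (one_smul ℤ _).symm)
  have h5 : e.hom.f 0 = k • (P.zeroIso.inv ≫ Q.zeroIso.hom) := by
    have := congrArg (fun f => P.zeroIso.inv ≫ f ≫ Q.zeroIso.hom) hk
    simpa using this
  rcases Int.eq_one_or_neg_one_of_mul_eq_one h4 with rfl | rfl
  · left; simpa using h5
  · right; simpa using h5

end BarNatan

/-! ### Uniqueness of universal projectors. -/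

theorem mainTheorem8 (n : ℕ) (P Q : BarNatan.UniversalProjector n) :
    ∃ ψ : P.complex ⟶ Q.complex,
      P.ι ≫ ψ = Q.ι ∧
      (∀ ψ' : P.complex ⟶ Q.complex, P.ι ≫ ψ' = Q.ι → Nonempty (Homotopy ψ' ψ)) ∧
      HomologicalComplex.homotopyEquivalences (BarNatan.BN n n) (ComplexShape.up ℤ) ψ ∧
      ∀ φ : P.complex ⟶ Q.complex,
        HomologicalComplex.homotopyEquivalences (BarNatan.BN n n) (ComplexShape.up ℤ) φ →
          Nonempty (Homotopy φ ψ) ∨ Nonempty (Homotopy φ (-ψ)) := by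
  obtain ⟨ψ, hψ⟩ := P.exists_extension Q (P.zeroIso.inv ≫ Q.zeroIso.hom)
  obtain ⟨χ, hχ⟩ := Q.exists_extension P (Q.zeroIso.inv ≫ P.zeroIso.hom)
  have hψι : P.ι ≫ ψ = Q.ι := (P.ι_comp_eq_iff Q ψ).mpr (by rw [hψ]; simp)
  refine ⟨ψ, hψι, fun ψ' hψ' => P.homotopy_of_eq Q ?_, ?_, ?_⟩
  · rw [P.ι_comp_eq_iff Q, ← Iso.eq_inv_comp] at hψ'
    rw [hψ', hψ]
  -- Both composites agree with the identity in degree zero and hence are homotopic to it.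
  · obtain ⟨h₁⟩ := P.homotopy_of_eq P (f := ψ ≫ χ) (g := 𝟙 _) (by simp [hψ, hχ])
    obtain ⟨h₂⟩ := Q.homotopy_of_eq Q (f := χ ≫ ψ) (g := 𝟙 _) (by simp [hψ, hχ])
    exact ⟨⟨ψ, χ, h₁, h₂⟩, rfl⟩
  · rintro φ ⟨e, rfl⟩
    rcases P.eq_or_eq_neg Q e with h | h
    · exact Or.inl (P.homotopy_of_eq Q (by rw [h, hψ]))
    · exact Or.inr (P.homotopy_of_eq Q (by rw [h, HomologicalComplex.neg_f_apply, hψ]))
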